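/- Let $\mathbb F=\mathbb F_q$ be a finite field with $q$ elements, $\mathbb E=\mathbb F_{q^2}$ its quadratic extension with norm $N(\lambda)=\lambda\overline\lambda$ and trace $\mathrm{Tr}(\lambda)=\lambda+\overline\lambda$, and $G=GL(2,\mathbb F)$. For a finite group $G$, let $\widehat G$ be the (finite) set of isomorphism classes of irreducible finite-dimensional complex representations, $\chi_\pi$ the character of $\pi\in\widehat G$, and $\nu_2(\pi)=|G|^{-1}\sum_{g\in G}\chi_\pi(g^2)$ its Frobenius–Schur indicator. For $s\in\mathbb C$, $r\ge 0$, $\gamma_1,\dots,\gamma_r\in G$ and $\epsilon\in\{1,-1,0\}$ put $$\zeta_G(s)=\sum_{\pi\in\widehat G}\frac1{(\dim\pi)^s},\qquad \zeta_G^{(r)}(\gamma_1,\dots,\gamma_r)(s)=\sum_{\pi\in\widehat G}\frac{\prod_{j=1}^r\chi_\pi(\gamma_j)}{(\dim\pi)^{s+r}},\qquad \zeta_{G,\epsilon}(s)=\sum_{\pi\in\widehat G,\ \nu_2(\pi)=\epsilon}\frac1{(\dim\pi)^s},$$ and let $\zeta_{D(G)}(s)=\sum_\Pi(\dim\Pi)^{-s}$,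 the sum running over the isomorphism classes of irreducible finite-dimensional representations of the quantum double $D(G)$, that is, of the complex algebra with basis $\delta_g x$ ($g,x\in G$) and product $(\delta_g x)(\delta_h y)=\delta_g\,xy$ if $g=xhx^{-1}$ and $0$ otherwise. Let $\delta(a)=1$ if $a=1$ and $\delta(a)=0$ otherwise. Then, for every $s\in\mathbb C$, the following hold. 1. $\displaystyle \zeta_G(s)=q-1+\frac{(q-1)(q-2)}{2(q+1)^s}+\frac{q-1}{q^s}+\frac{q(q-1)}{2(q-1)^s}.$ 2. For all $r$ and all $\gamma_1,\dots,\gamma_r\in G$ with $\det(\gamma_1\cdots\gamma_r)\ne1$, $\zeta_G^{(r)}(\gamma_1,\dots,\gamma_r)(s)=0$. 3. For $x\in\mathbb F^\times$ and $c_1(x)=\begin{pmatrix}x&0\\0&x\end{pmatrix}$, $$\zeta^{(1)}_G(c_1(x))(s)=(q-1)\delta(x^2)+\tfrac12(q+1)^{-s}\big((q-1)^2\delta(x)-(q-1)\delta(x^2)\big)+q^{-s}(q-1)\delta(x^2)+\tfrac12(q-1)^{-s}\big((q^2-1)\delta(x)-(q-1)\delta(x^2)\big).$$ For $x\in\mathbb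 F^\times$ and $c_2(x)=\begin{pmatrix}x&1\\0&x\end{pmatrix}$, $$\zeta^{(1)}_G(c_2(x))(s)=(q-1)\delta(x^2)+\tfrac12(q+1)^{-s-1}\big((q-1)^2\delta(x)-(q-1)\delta(x^2)\big)-\tfrac12(q-1)^{-s-1}\big((q^2-1)\delta(x)-(q-1)\delta(x^2)\big).$$ For $x\neq y$ in $\mathbb F^\times$ and $c_3(x,y)=\begin{pmatrix}x&0\\0&y\end{pmatrix}$, $$\zeta^{(1)}_G(c_3(x,y))(s)=(q-1)\delta(xy)+(q+1)^{-s-1}\big((q-1)^2\delta(x)\delta(y)-(q-1)\delta(xy)\big)+q^{-s-1}(q-1)\delta(xy).$$ For $\lambda\in\mathbb E\setminus\mathbb F$ and $c_4(\lambda)=\begin{pmatrix}0&-N(\lambda)\\1&\mathrm{Tr}(\lambda)\end{pmatrix}$, $$\zeta^{(1)}_G(c_4(\lambda))(s)=(q-1)\delta(N(\lambda))-(q-1)q^{-s-1}\delta(N(\lambda))-(q^2-1)(q-1)^{-s-1}\delta(\lambda)+(q-1)(q-1)^{-s-1}\delta(N(\lambda)).$$ 4. $$\zeta_{D(G)}(s)=(q-1)^2+\frac{(q-1)^2(q-2)}{2(q+1)^s}+\frac{(q-1)^2}{q^s}+\frac{(q-1)^2q}{2(q-1)^s}+\frac{q(q-1)^2}{(q^2-1)^s}+\frac{(q-1)^3(q-2)}{2(q(q+1))^s}+\frac{q(q-1)^2(q+1)}{2(q(q-1))^s}.$$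 5. $\zeta_{G,-1}(s)=0$. If $q$ is odd, $$\zeta_{G,1}(s)=2+\frac{q-1}{2(q+1)^s}+\frac2{q^s}+\frac{q-1}{2(q-1)^s};$$ if $q$ is even, $$\zeta_{G,1}(s)=1+\frac{q-2}{2(q+1)^s}+\frac1{q^s}+\frac q{2(q-1)^s}.$$ In both cases $\zeta_{G,0}(s)=\zeta_G(s)-\zeta_{G,1}(s)$. -/

import Mathlib

open scoped MatrixGroups

noncomputable section

namespace RepZeta

section Group

variable (G : Type*) [Group G]

/-- An irreducible finite-dimensional complex representation of `G`. -/
structure IrrRep where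
  carrier : Type
  [addCommGroup : AddCommGroup carrier]
  [module : Module ℂ carrier]
  [finite : FiniteDimensional ℂ carrier]
  rep : Representation ℂ G carrier
  irreducible : rep.IsIrreducible

attribute [instance] IrrRep.addCommGroup IrrRep.module IrrRep.finite IrrRep.irreducible

/-- Two irreducible representations are identified when there is a `G`-equivariant linear
isomorphism between them. -/
instance irrSetoid : Setoid (IrrRep G) where
  r V W := Nonempty (V.rep.Equiv W.rep)
  iseqv :=
    { refl := fun V => ⟨Representation.Equiv.refl V.rep⟩
      symm := fun ⟨e⟩ => ⟨e.symm⟩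
      trans := fun ⟨e⟩ ⟨f⟩ => ⟨e.trans f⟩ }

/-- The set `Ĝ` of isomorphism classes of irreducible finite-dimensional complex
representations of `G`. -/
def Irr : Type _ := Quotient (irrSetoid G)

variable {G}

/-- The dimension of an irreducible representation. -/
def Irr.dim (π : Irr G) : ℕ :=
  Quotient.lift (fun V : IrrRep G => Module.finrank ℂ V.carrier)
    (fun _ _ h => Nonempty.elim h fun e => e.toLinearEquiv.finrank_eq) π

/-- The character `χ_π` of an irreducible representation. -/
def Irr.character (π : Irr G) : G → ℂ :=
  Quotient.lift (fun V : IrrRep G => V.rep.character)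
    (fun _ _ h => Nonempty.elim h fun e => Representation.char_iso e) π

/-- The Frobenius-Schur indicator `ν₂(π) = |G|⁻¹ ∑_g χ_π(g²)`. -/
def Irr.indicator [Finite G] (π : Irr G) : ℂ :=
  (Nat.card G : ℂ)⁻¹ * ∑ᶠ g : G, π.character (g ^ 2)

variable (G)

/-- The representation zeta function `ζ_G(s) = ∑_{π ∈ Ĝ} (dim π)^{-s}` of a finite group
(the set `Ĝ` is then finite). -/
def zeta [Finite G] (s : ℂ) : ℂ :=
  ∑ᶠ π : Irr G, 1 / (π.dim : ℂ) ^ s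

variable {G} in
/-- The zeta function with `r` insertions,
`ζ_G^{(r)}(γ₁, …, γ_r)(s) = ∑_{π ∈ Ĝ} (∏_j χ_π(γ_j)) / (dim π)^{s+r}`. -/
def zetaIns [Finite G] {r : ℕ} (γ : Fin r → G) (s : ℂ) : ℂ :=
  ∑ᶠ π : Irr G, (∏ j, π.character (γ j)) / (π.dim : ℂ) ^ (s + r)

/-- The zeta function `ζ_{G,ε}(s)`: the sum of `(dim π)^{-s}` over the `π ∈ Ĝ` whose
Frobenius-Schur indicator equals `ε`. -/
def zetaInd [Finite G] (ε : ℤ) (s : ℂ) : ℂ :=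
  ∑ᶠ π : {π : Irr G // π.indicator = (ε : ℂ)}, 1 / (π.1.dim : ℂ) ^ s

end Group

section Algebra

variable (A : Type*) [Ring A] [Algebra ℂ A]

/-- Isomorphism of simple finite-dimensional modules over a complex algebra. -/
instance algIrrSetoid : Setoid {M : ModuleCat.{0} A //
    IsSimpleModule A M ∧ Module.Finite ℂ (RestrictScalars ℂ A M)} where
  r M N := Nonempty (M.1 ≃ₗ[A] N.1)
  iseqv :=
    { refl := fun M => ⟨LinearEquiv.refl A M.1⟩
      symm := fun ⟨e⟩ => ⟨e.symm⟩
      trans := fun ⟨e⟩ ⟨f⟩ => ⟨e.trans f⟩ }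

/-- The set of isomorphism classes of irreducible finite-dimensional representations of a complex
algebra `A`. -/
def AlgIrr : Type _ := Quotient (algIrrSetoid A)

variable {A}

/-- An `A`-linear isomorphism is a `ℂ`-linear isomorphism of the underlying vector spaces. -/
def restrictEquiv {M N : Type*} [AddCommGroup M] [AddCommGroup N] [Module A M] [Module A N]
    (e : M ≃ₗ[A] N) : RestrictScalars ℂ A M ≃ₗ[ℂ] RestrictScalars ℂ A N where
  toFun x := e x
  invFun y := e.symm y
  left_inv x := e.symm_apply_apply x
  right_inv y := e.apply_symm_apply y
  map_add' x y := e.map_add x y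
  map_smul' c x := e.map_smul (algebraMap ℂ A c) x

/-- The complex dimension of an irreducible representation of a complex algebra. -/
def AlgIrr.dim (P : AlgIrr A) : ℕ :=
  Quotient.lift (fun M : {M : ModuleCat.{0} A //
      IsSimpleModule A M ∧ Module.Finite ℂ (RestrictScalars ℂ A M)} =>
      Module.finrank ℂ (RestrictScalars ℂ A M.1))
    (fun _ _ h => Nonempty.elim h fun e => (restrictEquiv e).finrank_eq) P

end Algebra

section Double

variable (G : Type*) [Group G]

/-- The algebra of complex functions on `G`, with pointwise operations, carrying the action of `G`
by conjugation. -/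
def FunAlg : Type _ := G → ℂ

instance : CommRing (FunAlg G) := inferInstanceAs (CommRing (G → ℂ))

instance : Algebra ℂ (FunAlg G) := inferInstanceAs (Algebra ℂ (G → ℂ))

/-- The conjugation action `(x • f)(g) = f(x⁻¹ g x)`, so that `x • δ_h = δ_{x h x⁻¹}`. -/
instance : MulSemiringAction G (FunAlg G) where
  smul x f := fun g => f (x⁻¹ * g * x)
  one_smul f := by
    funext g
    change f (1⁻¹ * g * 1) = f g
    simp
  mul_smul x y f := by
    funext g
    change f ((x * y)⁻¹ * g * (x * y)) = f (y⁻¹ * (x⁻¹ * g * x) * y)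
    simp [mul_assoc]
  smul_zero _ := rfl
  smul_add _ _ _ := rfl
  smul_one _ := rfl
  smul_mul _ _ _ := rfl

instance : SMulCommClass G ℂ (FunAlg G) := ⟨fun _ _ _ => rfl⟩

/-- The quantum double `D(G)` of a finite group, as an algebra: formal sums `∑ f_x x` with
`x ∈ G` and `f_x` a complex function on `G`, multiplied by `(f x)(h y) = (f · (x • h)) (x y)`
for the conjugation action above.  On the basis `δ_g x` this is
`(δ_g x)(δ_h y) = δ_g (x y)` if `g = x h x⁻¹`, and `0` otherwise. -/
abbrev QuantumDouble : Type _ := SkewMonoidAlgebra (FunAlg G) G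

/-- The zeta function `ζ_{D(G)}(s) = ∑_Π (dim Π)^{-s}`, the sum running over the isomorphism
classes of irreducible finite-dimensional representations of `D(G)` (a finite set). -/
def zetaDouble [Finite G] (s : ℂ) : ℂ :=
  ∑ᶠ P : AlgIrr (QuantumDouble G), 1 / (P.dim : ℂ) ^ s

end Double

section Classes

variable {F : Type*} [Field F]

/-- Central elements. -/
def c₁ (x : Fˣ) : GL (Fin 2) F :=
  Matrix.GeneralLinearGroup.mkOfDetNeZero !![(x : F), 0; 0, x] (by simp)

/-- Non-semisimple elements (a scalar times a non-trivial unipotent). -/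
def c₂ (x : Fˣ) : GL (Fin 2) F :=
  Matrix.GeneralLinearGroup.mkOfDetNeZero !![(x : F), 1; 0, x] (by simp)

/-- Diagonal elements. -/
def c₃ (x y : Fˣ) : GL (Fin 2) F :=
  Matrix.GeneralLinearGroup.mkOfDetNeZero !![(x : F), 0; 0, y] (by simp)

/-- Elliptic elements: the companion matrix of `X² - Tr(l) X + N(l)`, for `l` in the quadratic
extension `E` of `F`. -/
def c₄ {E : Type*} [Field E] [Algebra F E] (l : Eˣ) : GL (Fin 2) F :=
  Matrix.GeneralLinearGroup.mkOfDetNeZero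
    !![0, -Algebra.norm F (l : E); 1, Algebra.trace F E (l : E)]
    (by simpa using (l.isUnit.map (Algebra.norm F)).ne_zero)

end Classes

open scoped Classical in
/-- The delta function at the identity. -/
def delta {M : Type*} [One M] (a : M) : ℂ := if a = 1 then 1 else 0

end RepZeta

end

open scoped MatrixGroups

noncomputable section

namespace RepZeta

/-! ### Irreducible characters and their orthogonality -/

section Characters

variable {G : Type*} [Group G]

/-! Every sum over irreducible representations is evaluated from the character table of GL(2, F),
and the table is found without constructing the principal series or the cuspidal representations. By
`exists_character_eq`, a class function is an irreducible character once its inner products with all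
irreducible characters are integers, its norm is one and its value at the identity is a positive
integer. Candidates come from the two tori. A non-scalar matrix is determined up to conjugacy by its
trace and determinant (`isConj_companion`), so class functions are functions of these two data apart
from a correction at the scalars. Pushing a function on F× × F× or on E× forward along the
trace-determinant map, with the right correction, gives `splitFun` and `extFun`.

Integrality comes from restriction to abelian subgroups. By `sum_splitFun_mul` and `sum_extFun_mul`
the inner product with an irreducible character is ±(a − w), where a is the multiplicity of the
torus character and w that of a character of (scalars) × (unipotents) which is nontrivial on the
unipotents. The norm is one for α ≠ β, respectively χ^q ≠ χ. For α = β it is two, and removing α ∘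
det leaves a twist of the Steinberg character.

Completeness is checked against the regular character. Weight one is given to each α ∘ det and each
Steinberg twist, and weight 1/2 to each ordered pair α ≠ β and each χ with χ^q ≠ χ, because (α, β)
and (β, α), or χ and χ^q, give the same character. The weighted sum of dim · character is the
regular character (`sum_family_character`), so each irreducible representation has total weight one
(`sum_weight_eq_one`). Hence nothing is missing, there are no further coincidences, and any sum over
irreducible representations becomes a sum over characters of tori (`sum_irr`). Tensoring with α ∘
det permutes the irreducible representations, which gives the vanishing with insertions.

A simple module over the quantum double is graded by the group and supported on one conjugacy class;
it is coinduced from the irreducible representation of the centralizer of g on its degree g part. So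
the zeta function is a sum over g, weighted by the inverse class size, of zeta functions of
centralizers (`zetaDouble_eq`). In GL(2, F) a scalar has the whole group as centralizer, and all
other centralizers are abelian.

For the indicators, ν₂ is 0, 1 or −1 and vanishes unless the character is self-dual, while the sum
of ν₂ · dim counts the solutions of g² = 1. The self-dual dimensions add up to exactly this number,
so no indicator is −1 (`indicator_eq_one`), and it remains to count self-dual parameters. -/

theorem isIrreducible_iff {V : Type*} [AddCommGroup V] [Module ℂ V] (ρ : Representation ℂ G V) :
    ρ.IsIrreducible ↔ Nontrivial V ∧
      ∀ W : Submodule ℂ V, (∀ g, ∀ v ∈ W, ρ g v ∈ W) → W = ⊥ ∨ W = ⊤ := by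
  constructor
  · intro h
    refine ⟨?_, fun W hW => ?_⟩
    · by_contra hV
      rw [not_nontrivial_iff_subsingleton] at hV
      obtain ⟨a, b, hab⟩ := h.toNontrivial
      exact hab (Subrepresentation.toSubmodule_injective (Subsingleton.elim _ _))
    · rcases h.eq_bot_or_eq_top ⟨W, fun g v hv => hW g v hv⟩ with h | h
      · exact Or.inl (congrArg Subrepresentation.toSubmodule h)
      · exact Or.inr (congrArg Subrepresentation.toSubmodule h)
  · rintro ⟨hV, h⟩
    refine { exists_pair_ne := ⟨⊥, ⊤, fun e => ?_⟩, eq_bot_or_eq_top := fun W => ?_ }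
    · exact bot_ne_top (congrArg Subrepresentation.toSubmodule e : (⊥ : Submodule ℂ V) = ⊤)
    · rcases h W.toSubmodule (fun g v hv => W.apply_mem_toSubmodule g hv) with h | h
      · exact Or.inl (Subrepresentation.toSubmodule_injective h)
      · exact Or.inr (Subrepresentation.toSubmodule_injective h)

theorem isIrreducible_of_equiv {V W : Type*} [AddCommGroup V] [Module ℂ V] [AddCommGroup W]
    [Module ℂ W] {ρ : Representation ℂ G V} {σ : Representation ℂ G W} (e : ρ.Equiv σ)
    (h : ρ.IsIrreducible) : σ.IsIrreducible := by
  rw [isIrreducible_iff] at h ⊢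
  obtain ⟨hV, h⟩ := h
  refine ⟨e.symm.toLinearEquiv.toEquiv.nontrivial, fun X hX => ?_⟩
  have := h (X.comap e.toLinearEquiv.toLinearMap) fun g v hv => by
    have h1 : σ g (e v) ∈ X := hX g _ hv
    have h2 : σ g (e v) = e (ρ g v) :=
      (congrArg (fun f => f v) (e.toIntertwiningMap.isIntertwining' g)).symm
    rw [h2] at h1
    exact h1
  rcases this with h | h
  · left
    rw [Submodule.eq_bot_iff] at h ⊢
    intro x hx
    have h3 : e.symm x = 0 := h _ (by
      change e (e.symm x) ∈ X
      simpa using hx)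
    simpa using congrArg e h3
  · right
    rw [Submodule.eq_top_iff'] at h ⊢
    intro x
    have h3 : e (e.symm x) ∈ X := h (e.symm x)
    simpa using h3

/-- The class of an irreducible representation. -/
def Irr.mk (V : IrrRep G) : Irr G := Quotient.mk _ V

theorem Irr.mk_eq_mk_iff {V W : IrrRep G} : Irr.mk V = Irr.mk W ↔ Nonempty (V.rep.Equiv W.rep) :=
  Quotient.eq

/-- The class of an irreducible representation on a space in any universe. -/
def Irr.ofRep {V : Type*} [AddCommGroup V] [Module ℂ V] [FiniteDimensional ℂ V]
    (ρ : Representation ℂ G V) [hρ : ρ.IsIrreducible] : Irr G :=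
  let e : V ≃ₗ[ℂ] (Fin (Module.finrank ℂ V) → ℂ) := (Module.finBasis ℂ V).equivFun
  let σ : Representation ℂ G (Fin (Module.finrank ℂ V) → ℂ) :=
    { toFun := fun g => e.conj (ρ g)
      map_one' := by ext; simp [LinearEquiv.conj_apply]
      map_mul' := fun g h => by ext; simp [LinearEquiv.conj_apply] }
  let E : ρ.Equiv σ := Representation.Equiv.mk e fun g => by
    ext v; simp [σ, LinearEquiv.conj_apply]
  Irr.mk
    { carrier := Fin (Module.finrank ℂ V) → ℂ
      rep := σ
      irreducible := isIrreducible_of_equiv E hρ }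

theorem Irr.exists_equiv_ofRep {V : Type*} [AddCommGroup V] [Module ℂ V] [FiniteDimensional ℂ V]
    (ρ : Representation ℂ G V) [hρ : ρ.IsIrreducible] :
    ∃ W : IrrRep G, Irr.ofRep ρ = Irr.mk W ∧ Nonempty (ρ.Equiv W.rep) :=
  ⟨_, rfl, ⟨Representation.Equiv.mk (Module.finBasis ℂ V).equivFun fun g => by
    ext v; simp [LinearEquiv.conj_apply]⟩⟩

theorem Irr.character_ofRep {V : Type*} [AddCommGroup V] [Module ℂ V] [FiniteDimensional ℂ V]
    (ρ : Representation ℂ G V) [ρ.IsIrreducible] : (Irr.ofRep ρ).character = ρ.character := by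
  obtain ⟨W, hW, ⟨e⟩⟩ := Irr.exists_equiv_ofRep ρ
  rw [hW]
  exact (Representation.char_iso e).symm

theorem Irr.ofRep_eq_mk_iff {V : Type*} [AddCommGroup V] [Module ℂ V] [FiniteDimensional ℂ V]
    (ρ : Representation ℂ G V) [ρ.IsIrreducible] (U : IrrRep G) :
    Irr.ofRep ρ = Irr.mk U ↔ Nonempty (ρ.Equiv U.rep) := by
  obtain ⟨W, hW, ⟨e⟩⟩ := Irr.exists_equiv_ofRep ρ
  rw [hW]
  refine Irr.mk_eq_mk_iff.trans ⟨fun ⟨f⟩ => ⟨e.trans f⟩, fun ⟨f⟩ => ⟨e.symm.trans f⟩⟩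

theorem Irr.exists_rep (π : Irr G) : ∃ V : IrrRep G, Irr.mk V = π := Quotient.exists_rep π

theorem Irr.character_mk (V : IrrRep G) :
    Irr.character (Irr.mk V) = V.rep.character := rfl

theorem Irr.character_one (π : Irr G) : π.character 1 = π.dim := by
  obtain ⟨V, rfl⟩ := π.exists_rep
  exact Representation.char_one V.rep

theorem Irr.dim_pos (π : Irr G) : 0 < π.dim := by
  obtain ⟨V, rfl⟩ := π.exists_rep
  have := ((isIrreducible_iff V.rep).1 V.irreducible).1
  exact Module.finrank_pos (R := ℂ) (M := V.carrier)

theorem Irr.dim_ne_zero (π : Irr G) : (π.dim : ℂ) ≠ 0 :=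
  Nat.cast_ne_zero.2 π.dim_pos.ne'

theorem Irr.character_conj (π : Irr G) (g h : G) :
    π.character (h * g * h⁻¹) = π.character g := by
  obtain ⟨V, rfl⟩ := π.exists_rep
  exact Representation.char_conj V.rep g h

theorem Irr.character_eq_of_isConj (π : Irr G) {g h : G} (e : IsConj g h) :
    π.character g = π.character h := by
  obtain ⟨c, rfl⟩ := isConj_iff.1 e
  exact (π.character_conj g c).symm

open scoped Classical in
theorem Irr.sum_character_mul_character_inv [Fintype G] (π σ : Irr G) :
    ∑ g, π.character g * σ.character g⁻¹ = if π = σ then (Nat.card G : ℂ) else 0 := by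
  obtain ⟨V, rfl⟩ := π.exists_rep
  obtain ⟨W, rfl⟩ := σ.exists_rep
  have hc : (Nat.card G : ℂ) ≠ 0 := Nat.cast_ne_zero.2 Nat.card_pos.ne'
  let := invertibleOfNonzero hc
  have h := Representation.char_orthonormal (G := G) V.rep W.rep
  rw [inv_mul_eq_iff_eq_mul₀ hc] at h
  refine h.trans ?_
  have : (Irr.mk V) = Irr.mk W ↔ Nonempty (W.rep.Equiv V.rep) :=
    Irr.mk_eq_mk_iff.trans ⟨fun ⟨f⟩ => ⟨f.symm⟩, fun ⟨f⟩ => ⟨f.symm⟩⟩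
  by_cases h : (Irr.mk V) = Irr.mk W
  · rw [if_pos h, if_pos (this.1 h), mul_one]
  · rw [if_neg h, if_neg (fun h' => h (this.2 h')), mul_zero]

theorem Irr.character_injective [Finite G] :
    Function.Injective (Irr.character : Irr G → G → ℂ) := by
  classical
  have := Fintype.ofFinite G
  intro π σ h
  by_contra hne
  have h1 := Irr.sum_character_mul_character_inv π π
  have h2 := Irr.sum_character_mul_character_inv π σ
  rw [← h, h1] at h2
  simp [hne, Nat.card_eq_fintype_card] at h2

/-- Orthogonality makes the irreducible characters linearly independent in the finite-dimensional
space of functions on the group. -/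
instance [Finite G] : Finite (Irr G) := by
  classical
  have := Fintype.ofFinite G
  refine LinearIndependent.finite_of_isNoetherian (R := ℂ) (M := G → ℂ)
    (v := (Irr.character : Irr G → G → ℂ)) ?_
  rw [linearIndependent_iff']
  intro s c hc σ hσ
  have h : ∑ g, (∑ π ∈ s, c π • π.character) g * σ.character g⁻¹ = 0 := by rw [hc]; simp
  simp only [Finset.sum_apply, Pi.smul_apply, smul_eq_mul, Finset.sum_mul] at h
  rw [Finset.sum_comm] at h
  simp only [mul_assoc, ← Finset.mul_sum, Irr.sum_character_mul_character_inv] at h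
  simpa [hσ, Nat.card_eq_fintype_card] using h

end Characters

/-! ### Completeness of the characters, and criteria for irreducibility and exhaustion -/

section Completeness

variable {G : Type*} [Group G]

theorem intertwining_eq_smul {V : Type*} [AddCommGroup V] [Module ℂ V] [FiniteDimensional ℂ V]
    {ρ : Representation ℂ G V} (hρ : ρ.IsIrreducible) {T : V →ₗ[ℂ] V}
    (hT : ∀ g v, T (ρ g v) = ρ g (T v)) : ∃ c : ℂ, T = c • LinearMap.id := by
  obtain ⟨c, hc⟩ := (Representation.IsIrreducible.algebraMap_intertwiningMap_bijective_of_isAlgClosed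
    (ρ := ρ)).2
    (LinearMap.intertwiningMap_of_isIntertwiningMap ρ ρ T hT)
  refine ⟨c, ?_⟩
  have := congrArg Representation.IntertwiningMap.toLinearMap hc
  exact this.symm

variable [Fintype G]

/-- The operator `∑ f(g) ρ(g⁻¹)`. -/
def classOperator {V : Type*} [AddCommGroup V] [Module ℂ V] (f : G → ℂ)
    (ρ : Representation ℂ G V) : V →ₗ[ℂ] V := ∑ g, f g • ρ g⁻¹

theorem classOperator_apply {V : Type*} [AddCommGroup V] [Module ℂ V] (f : G → ℂ)
    (ρ : Representation ℂ G V) (v : V) : classOperator f ρ v = ∑ g, f g • ρ g⁻¹ v := by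
  simp [classOperator, LinearMap.sum_apply]

theorem classOperator_comm {V : Type*} [AddCommGroup V] [Module ℂ V] {f : G → ℂ}
    (hf : ∀ g h, f (h * g * h⁻¹) = f g) (ρ : Representation ℂ G V) (g : G) (v : V) :
    classOperator f ρ (ρ g v) = ρ g (classOperator f ρ v) := by
  simp only [classOperator_apply, map_sum, map_smul]
  refine Fintype.sum_equiv (MulAut.conj g⁻¹).toEquiv _ _ fun x => ?_
  simp only [MulEquiv.toEquiv_eq_coe, EquivLike.coe_coe, MulAut.conj_apply]
  rw [hf, ← Module.End.mul_apply, ← Module.End.mul_apply, ← map_mul, ← map_mul]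
  congr 3
  group

/-- On an irreducible space the operator is a scalar by Schur's lemma, and its trace is one of the
sums assumed to vanish. A reducible space splits by Maschke into two proper invariant subspaces,
which induction on the dimension handles. -/
theorem classOperator_eq_zero {f : G → ℂ} (hf : ∀ g h, f (h * g * h⁻¹) = f g)
    (h0 : ∀ π : Irr G, ∑ g, f g * π.character g⁻¹ = 0) (n : ℕ) :
    ∀ {V : Type*} [AddCommGroup V] [Module ℂ V] [FiniteDimensional ℂ V]
      (ρ : Representation ℂ G V), Module.finrank ℂ V = n → classOperator f ρ = 0 := by
  induction n using Nat.strong_induction_on with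
  | _ n ih =>
    intro V _ _ _ ρ hn
    by_cases hV : Nontrivial V
    swap
    · rw [not_nontrivial_iff_subsingleton] at hV
      exact Subsingleton.elim _ _
    by_cases hρ : ρ.IsIrreducible
    · obtain ⟨c, hc⟩ := intertwining_eq_smul hρ (classOperator_comm hf ρ)
      have h1 : LinearMap.trace ℂ V (classOperator f ρ) = 0 := by
        have := h0 (Irr.ofRep ρ)
        rw [Irr.character_ofRep] at this
        simpa [classOperator, Representation.character] using this
      rw [hc] at h1 ⊢
      have h2 : (Module.finrank ℂ V : ℂ) ≠ 0 :=
        Nat.cast_ne_zero.2 Module.finrank_pos.ne'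
      simp only [map_smul, LinearMap.trace_id, smul_eq_mul, mul_eq_zero, h2, or_false] at h1
      simp [h1]
    · rw [isIrreducible_iff] at hρ
      push Not at hρ
      obtain ⟨W, hW, hbot, htop⟩ := hρ hV
      let S : Subrepresentation ρ := ⟨W, fun g v hv => hW g v hv⟩
      obtain ⟨S', hS'⟩ := exists_isCompl S
      have hc : IsCompl W S'.toSubmodule := by
        constructor
        · rw [disjoint_iff]
          exact congrArg Subrepresentation.toSubmodule hS'.inf_eq_bot
        · rw [codisjoint_iff]
          exact congrArg Subrepresentation.toSubmodule hS'.sup_eq_top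
      have hlt : Module.finrank ℂ W < n := hn ▸ Submodule.finrank_lt htop
      have hlt' : Module.finrank ℂ S'.toSubmodule < n := by
        refine hn ▸ Submodule.finrank_lt fun h => hbot ?_
        have := hc.inf_eq_bot
        rwa [h, inf_top_eq] at this
      have key : ∀ (X : Subrepresentation ρ), Module.finrank ℂ X.toSubmodule < n →
          ∀ v ∈ X.toSubmodule, classOperator f ρ v = 0 := fun X hX v hv => by
        have := ih _ hX X.toRepresentation rfl
        have h3 := congrArg (fun T => ((T ⟨v, hv⟩ : X.toSubmodule) : V)) this
        simpa [classOperator_apply, Subrepresentation.toRepresentation] using h3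
      ext v
      have hv : v ∈ W ⊔ S'.toSubmodule := by rw [hc.sup_eq_top]; trivial
      obtain ⟨w, hw, w', hw', rfl⟩ := Submodule.mem_sup.1 hv
      simp [key S hlt w hw, key S' hlt' w' hw']

/-- A class function orthogonal to all irreducible characters vanishes. -/
theorem eq_zero_of_orthogonal {f : G → ℂ} (hf : ∀ g h, f (h * g * h⁻¹) = f g)
    (h0 : ∀ π : Irr G, ∑ g, f g * π.character g⁻¹ = 0) : f = 0 := by
  classical
  -- The regular representation separates coefficients: the operator sends the delta function at 1
  -- to `f` itself.
  let R : Representation ℂ G (G → ℂ) :=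
    { toFun := fun g => LinearMap.funLeft ℂ ℂ (· * g)
      map_one' := by ext; simp [LinearMap.funLeft_apply]
      map_mul' := fun g h => by ext; simp [LinearMap.funLeft_apply, mul_assoc] }
  have h := classOperator_eq_zero hf h0 _ R rfl
  funext x
  have h2 := congrArg (fun T => T (Pi.single 1 1) x) h
  have h3 : classOperator f R (Pi.single 1 1) x = ∑ g, if x = g then f g else 0 := by
    rw [classOperator_apply, Finset.sum_apply]
    refine Finset.sum_congr rfl fun g _ => ?_
    simp [R, LinearMap.funLeft_apply, Pi.single_apply, mul_inv_eq_one]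
  rw [Finset.sum_ite_eq, if_pos (Finset.mem_univ _)] at h3
  exact h3.symm.trans h2

open scoped Classical in
/-- The expansion of a class function in irreducible characters. -/
theorem classFunction_eq_sum [Fintype (Irr G)] {f : G → ℂ}
    (hf : ∀ g h, f (h * g * h⁻¹) = f g) (x : G) :
    Nat.card G * f x = ∑ π : Irr G, (∑ g, f g * π.character g⁻¹) * π.character x := by
  have h := eq_zero_of_orthogonal
    (f := fun x => Nat.card G * f x -
      ∑ π : Irr G, (∑ g, f g * π.character g⁻¹) * π.character x)
    (fun g h => by simp only [hf, Irr.character_conj])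
    (fun σ => by
      simp only [sub_mul, Finset.sum_sub_distrib, Finset.sum_mul (s := Finset.univ (α := Irr G))]
      rw [Finset.sum_comm]
      simp only [mul_assoc, ← Finset.mul_sum, Irr.sum_character_mul_character_inv]
      simp [mul_comm])
  exact sub_eq_zero.1 (congrFun h x)

open scoped Classical in
-- This is the expansion of the delta function at 1, whose coefficient at π is the dimension of π.
theorem sum_dim_mul_character [Fintype (Irr G)] (x : G) :
    ∑ π : Irr G, π.dim * π.character x = if x = 1 then (Nat.card G : ℂ) else 0 := by
  have h := classFunction_eq_sum (f := fun x : G => if x = 1 then (1 : ℂ) else 0)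
    (fun g h => by simp) x
  simp only [ite_mul, one_mul, zero_mul, Finset.sum_ite_eq', Finset.mem_univ, if_true, inv_one,
    Irr.character_one, mul_ite, mul_one, mul_zero] at h
  exact h.symm

theorem sum_dim_sq [Fintype (Irr G)] : ∑ π : Irr G, (π.dim : ℂ) ^ 2 = Nat.card G := by
  have := sum_dim_mul_character (G := G) 1
  simpa [Irr.character_one, ← sq] using this

/-- A class function of norm one with integral coefficients and positive value at `1` is an
irreducible character. -/
theorem exists_character_eq {f : G → ℂ} (hf : ∀ g h, f (h * g * h⁻¹) = f g)
    (hint : ∀ π : Irr G, ∃ n : ℤ, ∑ g, f g * π.character g⁻¹ = Nat.card G * n)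
    (hnorm : ∑ g, f g * f g⁻¹ = Nat.card G) {d : ℕ} (hd : 0 < d) (h1 : f 1 = d) :
    ∃ π : Irr G, π.character = f := by
  classical
  have := Fintype.ofFinite (Irr G)
  choose n hn using hint
  have hc : (Nat.card G : ℂ) ≠ 0 := Nat.cast_ne_zero.2 Nat.card_pos.ne'
  have hexp : ∀ x, f x = ∑ π : Irr G, n π * π.character x := fun x => by
    have := classFunction_eq_sum hf x
    simp only [hn, mul_assoc, ← Finset.mul_sum] at this
    exact mul_left_cancel₀ hc this
  have hsq : ∑ π : Irr G, n π ^ 2 = 1 := by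
    have h2 : ∑ g, f g * f g⁻¹ = Nat.card G * ∑ π : Irr G, (n π : ℂ) ^ 2 := by
      calc ∑ g, f g * f g⁻¹ = ∑ g, ∑ π : Irr G, f g * (n π * π.character g⁻¹) := by
            refine Finset.sum_congr rfl fun g _ => ?_
            rw [hexp g⁻¹, Finset.mul_sum]
        _ = ∑ π : Irr G, n π * ∑ g, f g * π.character g⁻¹ := by
            rw [Finset.sum_comm]
            refine Finset.sum_congr rfl fun π _ => ?_
            rw [Finset.mul_sum]
            exact Finset.sum_congr rfl fun g _ => by ring
        _ = _ := by
            rw [Finset.mul_sum]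
            exact Finset.sum_congr rfl fun π _ => by rw [hn]; ring
    rw [hnorm] at h2
    have h3 := mul_left_cancel₀ hc ((mul_one _).trans h2)
    exact_mod_cast h3.symm
  -- Integers whose squares add up to one: a single coefficient is ±1 and the others vanish.
  -- Positivity of the value at 1 then excludes −1.
  obtain ⟨π, hπ⟩ : ∃ π, n π ≠ 0 := by
    by_contra h
    push Not at h
    simp [h] at hsq
  have hsplit := Finset.add_sum_erase Finset.univ (fun π => n π ^ 2) (Finset.mem_univ π)
  simp only [hsq] at hsplit
  have hpos : 0 < n π ^ 2 := by positivity
  have hrest : ∑ σ ∈ Finset.univ.erase π, n σ ^ 2 = 0 := by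
    have : 0 ≤ ∑ σ ∈ Finset.univ.erase π, n σ ^ 2 := Finset.sum_nonneg fun _ _ => sq_nonneg _
    omega
  have hzero : ∀ σ, σ ≠ π → n σ = 0 := fun σ hσ => by
    have := (Finset.sum_eq_zero_iff_of_nonneg fun _ _ => sq_nonneg _).1 hrest σ (by simp [hσ])
    simpa using this
  have hfπ : ∀ x, f x = n π * π.character x := fun x => by
    rw [hexp, Finset.sum_eq_single π (fun σ _ hσ => by simp [hzero σ hσ]) (by simp)]
  have h4 : (d : ℤ) = n π * π.dim := by
    have := hfπ 1
    rw [h1, Irr.character_one] at this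
    exact_mod_cast this
  have h5 : n π = 1 := by
    have h6 : n π ^ 2 = 1 := by omega
    rcases mul_self_eq_one_iff.1 ((sq _).symm.trans h6) with h | h
    · exact h
    · rw [h] at h4
      omega
  exact ⟨π, funext fun x => by rw [hfπ, h5]; simp⟩

/-- If `∑ wᵢ dim(πᵢ) χ_{πᵢ}` is the regular character, then every irreducible representation
occurs among the `πᵢ` with total weight one. -/
theorem sum_weight_eq_one {ι : Type*} [Fintype ι] [DecidableEq (Irr G)] (w : ι → ℂ) (p : ι → Irr G)
    (h : ∀ x : G, x ≠ 1 → ∑ i, w i * ((p i).dim * (p i).character x) = 0)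
    (h1 : ∑ i, w i * (p i).dim ^ 2 = Nat.card G) (π : Irr G) :
    ∑ i, (if p i = π then w i else 0) = 1 := by
  classical
  have hc : (Nat.card G : ℂ) ≠ 0 := Nat.cast_ne_zero.2 Nat.card_pos.ne'
  -- The weighted sum is paired with the character of π in two ways: as a function supported at 1,
  -- and term by term through orthogonality.
  have key : ∑ x : G, (∑ i, w i * ((p i).dim * (p i).character x)) * π.character x⁻¹ =
      Nat.card G * π.dim := by
    rw [Fintype.sum_eq_single 1 fun x hx => by rw [h x hx, zero_mul]]
    simp only [inv_one, Irr.character_one]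
    rw [← h1]
    simp only [sq]
  simp only [Finset.sum_mul] at key
  rw [Finset.sum_comm] at key
  have h2 : ∀ i, ∑ x : G, w i * ((p i).dim * (p i).character x) * π.character x⁻¹ =
      Nat.card G * π.dim * (if p i = π then w i else 0) := fun i => by
    calc _ = w i * (p i).dim * ∑ x : G, (p i).character x * π.character x⁻¹ := by
          rw [Finset.mul_sum]
          exact Finset.sum_congr rfl fun x _ => by ring
      _ = _ := by
          rw [Irr.sum_character_mul_character_inv]
          split_ifs with h
          · rw [h]; ring
          · simp
  simp only [h2, ← Finset.mul_sum] at key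
  exact mul_left_cancel₀ (mul_ne_zero hc π.dim_ne_zero) (key.trans (mul_one _).symm)

theorem sum_eq_weighted_sum {ι : Type*} [Fintype ι] [Fintype (Irr G)] (w : ι → ℂ) (p : ι → Irr G)
    (h : ∀ x : G, x ≠ 1 → ∑ i, w i * ((p i).dim * (p i).character x) = 0)
    (h1 : ∑ i, w i * (p i).dim ^ 2 = Nat.card G) (F : Irr G → ℂ) :
    ∑ π, F π = ∑ i, w i * F (p i) := by
  classical
  calc ∑ π, F π = ∑ π, ∑ i, (if p i = π then w i else 0) * F π := by
        refine Finset.sum_congr rfl fun π _ => ?_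
        rw [← Finset.sum_mul, sum_weight_eq_one w p h h1, one_mul]
    _ = _ := by
        rw [Finset.sum_comm]
        refine Finset.sum_congr rfl fun i _ => ?_
        simp

end Completeness

/-! ### Integrality of multiplicities of linear characters -/

section Multiplicity

variable {G : Type*} [Group G]

/-- The multiplicity of a linear character in the pullback of a representation. -/
theorem exists_nat_multiplicity {H : Type*} [Group H] [Fintype H] (φ : H →* G) (ψ : H →* ℂˣ)
    (π : Irr G) : ∃ n : ℕ, ∑ h, (ψ h : ℂ) * π.character (φ h) = Nat.card H * n := by
  obtain ⟨V, rfl⟩ := π.exists_rep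
  -- The natural number is the dimension of the invariants of the pullback twisted by ψ, that is,
  -- the multiplicity of the inverse of ψ.
  let σ : Representation ℂ H V.carrier :=
    { toFun := fun h => (ψ h : ℂ) • V.rep (φ h)
      map_one' := by simp
      map_mul' := fun g h => by
        simp only [map_mul, Units.val_mul, smul_mul_smul_comm] }
  have hc : (Nat.card H : ℂ) ≠ 0 := Nat.cast_ne_zero.2 Nat.card_pos.ne'
  let := invertibleOfNonzero hc
  refine ⟨Module.finrank ℂ σ.invariants, ?_⟩
  have h := Representation.card_inv_mul_sum_char_eq_finrank σ
  rw [inv_mul_eq_iff_eq_mul₀ hc] at h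
  rw [← h]
  refine Finset.sum_congr rfl fun x _ => ?_
  simp [σ, Representation.character, Irr.character_mk]

end Multiplicity

/-! ### The Frobenius–Schur indicator -/

section Indicator

variable {G : Type*} [Group G]

theorem Irr.exists_matrix_rep (π : Irr G) : ∃ (n : ℕ) (σ : Representation ℂ G (Fin n → ℂ)),
    σ.IsIrreducible ∧ π.character = σ.character := by
  obtain ⟨V, rfl⟩ := π.exists_rep
  have h : Irr.ofRep V.rep = Irr.mk V := (Irr.ofRep_eq_mk_iff _ _).2 ⟨Representation.Equiv.refl _⟩
  rw [← h]
  exact ⟨_, _, IrrRep.irreducible _, rfl⟩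

/-- The character is invariant under `g ↦ g⁻¹`. -/
def Irr.SelfDual (π : Irr G) : Prop := ∀ g, π.character g⁻¹ = π.character g

/-- Averaging matrix units over the group produces invariant bilinear forms, and the indicator is,
up to the factor |G|, a sum of entries of these averages. Without a nonzero invariant form it is
therefore 0. Otherwise a nonzero invariant form B has an invariant kernel, so it is nondegenerate,
and it makes the character self-dual; by Schur's lemma every invariant form is a multiple of B. In
particular the transpose of B is ε B with ε² = 1. The sum for the indicator differs from the one for
∑ χ² = |G| by exchanging the two indices of each form, hence by the factor ε. -/
theorem Irr.indicator_cases [Finite G] (π : Irr G) :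
    π.indicator = 0 ∨ (π.SelfDual ∧
      (π.indicator = 1 ∨ π.indicator = -1)) := by
  classical
  have := Fintype.ofFinite G
  obtain ⟨n, σ, hσ, hχ⟩ := π.exists_matrix_rep
  have hc : (Nat.card G : ℂ) ≠ 0 := Nat.cast_ne_zero.2 Nat.card_pos.ne'
  set M : G → Matrix (Fin n) (Fin n) ℂ := fun g => LinearMap.toMatrix' (σ g) with hM
  have hmul : ∀ g h, M (g * h) = M g * M h := fun g h => by
    simp [hM, Module.End.mul_eq_comp, LinearMap.toMatrix'_comp]
  have hone : M 1 = 1 := by simp [hM]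
  have hvec : ∀ g v, (M g).mulVec v = σ g v := fun g v => by simp [hM, LinearMap.toMatrix'_mulVec]
  have htr : ∀ g, π.character g = (M g).trace := fun g => by
    rw [hχ, Representation.character, LinearMap.trace_eq_matrix_trace ℂ (Pi.basisFun ℂ (Fin n))]
    rfl
  have hinvT : ∀ g, (M g⁻¹).transpose * (M g).transpose = 1 := fun g => by
    rw [← Matrix.transpose_mul, ← hmul, mul_inv_cancel, hone, Matrix.transpose_one]
  have hswap : ∀ B : Matrix (Fin n) (Fin n) ℂ, (∀ g, (M g).transpose * B * M g = B) →
      ∀ g, B * M g = (M g⁻¹).transpose * B := fun B hB g => by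
    calc B * M g = ((M g⁻¹).transpose * (M g).transpose) * B * M g := by rw [hinvT, one_mul]
      _ = (M g⁻¹).transpose * ((M g).transpose * B * M g) := by simp only [mul_assoc]
      _ = _ := by rw [hB]
  set P : Matrix (Fin n) (Fin n) ℂ → Matrix (Fin n) (Fin n) ℂ :=
    fun B => ∑ g, (M g).transpose * B * M g with hP
  have hPinv : ∀ B g, (M g).transpose * P B * M g = P B := fun B g => by
    simp only [hP, Finset.mul_sum, Finset.sum_mul]
    refine Fintype.sum_equiv (Equiv.mulRight g) _ _ fun x => ?_
    simp only [Equiv.coe_mulRight, hmul, Matrix.transpose_mul, mul_assoc]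
  have hPentry : ∀ i j k l, P (Matrix.single i j 1) k l = ∑ g, M g i k * M g j l :=
      fun i j k l => by
    simp only [hP, Matrix.sum_apply]
    refine Finset.sum_congr rfl fun g _ => ?_
    rw [Matrix.mul_apply, Finset.sum_eq_single j]
    · simp [Matrix.mul_single_apply_same]
    · intro b _ hb
      rw [Matrix.mul_single_apply_of_ne _ _ _ _ _ hb, zero_mul]
    · simp
  have hsw : ∀ f : Fin n → Fin n → G → ℂ, ∑ i, ∑ j, ∑ g, f i j g = ∑ g, ∑ i, ∑ j, f i j g :=
    fun f => (Finset.sum_congr rfl fun i _ => Finset.sum_comm).trans Finset.sum_comm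
  have hind : (Nat.card G : ℂ) * π.indicator = ∑ i, ∑ j, P (Matrix.single i j 1) j i := by
    rw [Irr.indicator, finsum_eq_sum_of_fintype, mul_inv_cancel_left₀ hc]
    simp only [hPentry]
    rw [hsw]
    refine Finset.sum_congr rfl fun g _ => ?_
    rw [htr, sq, hmul, Matrix.trace]
    simp only [Matrix.diag_apply, Matrix.mul_apply]
  have hnorm : ∑ g, π.character g * π.character g = ∑ i, ∑ j, P (Matrix.single i j 1) i j := by
    simp only [hPentry]
    rw [hsw]
    refine Finset.sum_congr rfl fun g _ => ?_
    rw [htr, Matrix.trace, Finset.sum_mul_sum]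
    simp only [Matrix.diag_apply]
  by_cases hex : ∃ B : Matrix (Fin n) (Fin n) ℂ, B ≠ 0 ∧ ∀ g, (M g).transpose * B * M g = B
  swap
  · left
    push Not at hex
    have hz : ∀ B, P B = 0 := fun B => by
      by_contra h
      obtain ⟨g, hg⟩ := hex _ h
      exact hg (hPinv B g)
    simp only [hz, Matrix.zero_apply, Finset.sum_const_zero] at hind
    exact (mul_eq_zero.1 hind).resolve_left hc
  right
  obtain ⟨B, hB0, hB⟩ := hex
  have hunit : IsUnit B := by
    rw [← Matrix.mulVec_injective_iff_isUnit]
    change Function.Injective B.mulVecLin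
    rw [← LinearMap.ker_eq_bot]
    refine (((isIrreducible_iff σ).1 hσ).2 (LinearMap.ker B.mulVecLin)
      fun g v hv => ?_).resolve_right
      fun h => hB0 ?_
    · rw [LinearMap.mem_ker, Matrix.mulVecLin_apply] at hv ⊢
      rw [← hvec, Matrix.mulVec_mulVec, hswap B hB, ← Matrix.mulVec_mulVec, hv, Matrix.mulVec_zero]
    · rw [LinearMap.ker_eq_top] at h
      exact Matrix.toLin'.injective (by simpa [Matrix.toLin'_apply'] using h)
  have hdet : IsUnit B.det := (Matrix.isUnit_iff_isUnit_det B).1 hunit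
  have hBinv : B⁻¹ * B = 1 := Matrix.nonsing_inv_mul B hdet
  have hBinv' : B * B⁻¹ = 1 := Matrix.mul_nonsing_inv B hdet
  have hMB : ∀ g, M g * B⁻¹ = B⁻¹ * (M g⁻¹).transpose := fun g => by
    calc M g * B⁻¹ = B⁻¹ * (B * M g) * B⁻¹ := by rw [← mul_assoc, hBinv, one_mul]
      _ = B⁻¹ * (M g⁻¹).transpose * (B * B⁻¹) := by rw [hswap B hB]; simp only [mul_assoc]
      _ = _ := by rw [hBinv', mul_one]
  have hreal : ∀ g, π.character g⁻¹ = π.character g := fun g => by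
    rw [htr, htr, ← Matrix.trace_transpose]
    calc _ = Matrix.trace ((M g⁻¹).transpose * B * B⁻¹) := by rw [mul_assoc, hBinv', mul_one]
      _ = Matrix.trace (B * M g * B⁻¹) := by rw [hswap B hB]
      _ = _ := by rw [Matrix.trace_mul_comm, ← mul_assoc, hBinv, one_mul]
  have hschur : ∀ C : Matrix (Fin n) (Fin n) ℂ, (∀ g, (M g).transpose * C * M g = C) →
      ∃ c : ℂ, C = c • B := fun C hC => by
    obtain ⟨c, hc⟩ := intertwining_eq_smul hσ (T := (B⁻¹ * C).mulVecLin) fun g v => by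
      rw [Matrix.mulVecLin_apply, Matrix.mulVecLin_apply, ← hvec, ← hvec, Matrix.mulVec_mulVec,
        Matrix.mulVec_mulVec, ← mul_assoc, hMB, mul_assoc, hswap C hC, mul_assoc]
    refine ⟨c, ?_⟩
    have h1 : B⁻¹ * C = c • 1 := Matrix.toLin'.injective (by
      rw [Matrix.toLin'_apply', hc, map_smul, Matrix.toLin'_one])
    calc C = B * (B⁻¹ * C) := by rw [← mul_assoc, hBinv', one_mul]
      _ = _ := by rw [h1]; simp
  refine ⟨hreal, ?_⟩
  obtain ⟨ε, hε⟩ := hschur B.transpose fun g => by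
    have := congrArg Matrix.transpose (hB g)
    simpa [Matrix.transpose_mul, mul_assoc] using this
  have hε2 : ε * ε = 1 := by
    have h1 : B = (ε * ε) • B := by
      have := congrArg Matrix.transpose hε
      rwa [Matrix.transpose_transpose, Matrix.transpose_smul, hε, smul_smul] at this
    by_contra hne
    refine hB0 ((smul_eq_zero.1 (?_ : (ε * ε - 1) • B = 0)).resolve_left (sub_ne_zero.2 hne))
    rw [sub_smul, one_smul, ← h1, sub_self]
  have hfin : π.indicator = ε := by
    have h1 : ∑ g, π.character g * π.character g = Nat.card G := by
      have := Irr.sum_character_mul_character_inv π π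
      simpa only [hreal, if_true] using this
    refine mul_left_cancel₀ hc ?_
    rw [hind, mul_comm, ← h1, hnorm, Finset.mul_sum]
    refine Finset.sum_congr rfl fun i _ => ?_
    rw [Finset.mul_sum]
    refine Finset.sum_congr rfl fun j _ => ?_
    obtain ⟨c, hc⟩ := hschur _ (hPinv (Matrix.single i j 1))
    have h2 : B j i = ε * B i j := congrFun (congrFun hε i) j
    rw [hc, Matrix.smul_apply, Matrix.smul_apply, h2, smul_eq_mul, smul_eq_mul]
    ring
  rw [hfin]
  exact mul_self_eq_one_iff.1 hε2

/-- After exchanging the sums, the regular character evaluated at g² detects g² = 1. -/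
theorem sum_indicator_mul_dim [Finite G] [Fintype (Irr G)] :
    ∑ π : Irr G, π.indicator * π.dim = Nat.card {g : G // g ^ 2 = 1} := by
  classical
  have := Fintype.ofFinite G
  have hc : (Nat.card G : ℂ) ≠ 0 := Nat.cast_ne_zero.2 Nat.card_pos.ne'
  simp only [Irr.indicator, finsum_eq_sum_of_fintype]
  refine mul_left_cancel₀ hc ?_
  rw [Finset.mul_sum]
  calc _ = ∑ π : Irr G, ∑ g : G, (π.dim : ℂ) * π.character (g ^ 2) :=
        Finset.sum_congr rfl fun π _ => by
          rw [mul_assoc, mul_inv_cancel_left₀ hc, mul_comm, Finset.mul_sum]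
    _ = ∑ g : G, if g ^ 2 = 1 then (Nat.card G : ℂ) else 0 := by
        rw [Finset.sum_comm]
        exact Finset.sum_congr rfl fun g _ => sum_dim_mul_character (g ^ 2)
    _ = _ := by
        rw [← Finset.sum_filter, Finset.sum_const, nsmul_eq_mul, mul_comm,
          Nat.card_eq_fintype_card (α := {g : G // g ^ 2 = 1}), Fintype.card_subtype]

open scoped Classical in
/-- If the dimensions of the self-dual irreducible representations add up to the number of
solutions of `g² = 1`, then every self-dual irreducible representation is orthogonal. -/
theorem indicator_eq_one [Finite G] [Fintype (Irr G)]
    (h : ∑ π : Irr G, (if π.SelfDual then (π.dim : ℂ) else 0) =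
      Nat.card {g : G // g ^ 2 = 1}) (π : Irr G) :
    π.indicator = if π.SelfDual then 1 else 0 := by
  -- The defect is 0, 1 or 2, being 2 for a self-dual representation of indicator −1. The hypothesis
  -- makes the sum of defect times dimension zero, so every defect vanishes.
  have hex : ∀ π : Irr G, ∃ m : ℕ,
      (if π.SelfDual then (1 : ℂ) else 0) - π.indicator = m := fun π => by
    rcases π.indicator_cases with h0 | ⟨hr, h1 | h1⟩
    · rw [h0]
      split_ifs
      exacts [⟨1, by simp⟩, ⟨0, by simp⟩]
    · exact ⟨0, by simp [hr, h1]⟩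
    · exact ⟨2, by simp only [if_pos hr, h1]; norm_num⟩
  choose m hm using hex
  have hsum : ∑ π : Irr G, (m π * π.dim : ℕ) = 0 := by
    have : ((∑ π : Irr G, (m π * π.dim : ℕ) : ℕ) : ℂ) = 0 := by
      push_cast
      simp only [← hm, sub_mul, Finset.sum_sub_distrib, sum_indicator_mul_dim, ite_mul, one_mul,
        zero_mul]
      rw [h, sub_self]
    exact_mod_cast this
  have h0 := (Finset.sum_eq_zero_iff.1 hsum) π (Finset.mem_univ _)
  have h1 : m π = 0 := (Nat.mul_eq_zero.1 h0).resolve_right π.dim_pos.ne'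
  have h2 := hm π
  rw [h1, Nat.cast_zero, sub_eq_zero] at h2
  exact h2.symm

end Indicator

/-! ### Zeta functions of abelian and of isomorphic groups -/

section Transport

theorem zeta_eq_sum {G : Type*} [Group G] [Finite G] [Fintype (Irr G)] (s : ℂ) :
    zeta G s = ∑ π : Irr G, 1 / (π.dim : ℂ) ^ s := finsum_eq_sum_of_fintype _

/-- The irreducible representations of a commutative group are its linear characters. -/
theorem zeta_of_commutative {G : Type*} [Group G] [Finite G] (hG : ∀ a b : G, a * b = b * a)
    (s : ℂ) : zeta G s = Nat.card G := by
  classical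
  have := Fintype.ofFinite G
  have := Fintype.ofFinite (Irr G)
  have hd : ∀ π : Irr G, π.dim = 1 := fun π => by
    obtain ⟨V, rfl⟩ := π.exists_rep
    have : IsMulCommutative G := ⟨⟨hG⟩⟩
    exact Representation.IsIrreducible.finrank_eq_one_of_isMulCommutative V.rep
  have h := sum_dim_sq (G := G)
  simp only [hd, Nat.cast_one, one_pow] at h
  simp only [zeta_eq_sum, hd, Nat.cast_one, Complex.one_cpow, div_one]
  exact h

/-- Transport of irreducible representations along a group isomorphism. -/
def IrrRep.comap {G H : Type*} [Group G] [Group H] (e : G ≃* H) (V : IrrRep H) : IrrRep G where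
  carrier := V.carrier
  rep := V.rep.comp e.toMonoidHom
  irreducible := by
    have h := V.irreducible
    rw [isIrreducible_iff] at h ⊢
    refine ⟨h.1, fun W hW => h.2 W fun g v hv => ?_⟩
    simpa using hW (e.symm g) v hv

/-- Serves to identify the centralizer of a scalar matrix, which is the top subgroup, with the group
itself. -/
theorem zeta_congr {G H : Type*} [Group G] [Group H] [Finite G] [Finite H] (e : G ≃* H) (s : ℂ) :
    zeta G s = zeta H s := by
  let E : Irr H ≃ Irr G :=
    { toFun := Quotient.map (IrrRep.comap e) fun V W ⟨f⟩ => ⟨Representation.Equiv.mk f.toLinearEquiv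
        fun g => f.toIntertwiningMap.isIntertwining' (e g)⟩
      invFun := Quotient.map (IrrRep.comap e.symm) fun V W ⟨f⟩ =>
        ⟨Representation.Equiv.mk f.toLinearEquiv
          fun g => f.toIntertwiningMap.isIntertwining' (e.symm g)⟩
      left_inv := by
        rintro ⟨V⟩
        refine Quotient.sound ⟨Representation.Equiv.mk (LinearEquiv.refl ℂ _) fun g => ?_⟩
        ext v
        change V.rep (e (e.symm g)) v = V.rep g v
        rw [e.apply_symm_apply]
      right_inv := by
        rintro ⟨V⟩
        refine Quotient.sound ⟨Representation.Equiv.mk (LinearEquiv.refl ℂ _) fun g => ?_⟩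
        ext v
        change V.rep (e.symm (e g)) v = V.rep g v
        rw [e.symm_apply_apply] }
  refine (finsum_eq_of_bijective E E.bijective ?_).symm
  rintro ⟨V⟩
  rfl

end Transport

/-! ### Class sizes as indices of centralizers -/

section ConjugacyIndex

variable {G : Type*} [Group G]

theorem mem_centralizer_singleton_iff_conj {g z : G} :
    z ∈ Subgroup.centralizer {g} ↔ z * g * z⁻¹ = g := by
  rw [Subgroup.mem_centralizer_singleton_iff, mul_inv_eq_iff_eq_mul]

/-- Orbit–stabilizer: x ↦ x g x⁻¹ descends to a bijection from the left cosets of the centralizer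
onto the class. -/
theorem card_isConj_eq_index (g : G) :
    Nat.card {h : G // IsConj g h} = (Subgroup.centralizer {g}).index := by
  have hrel : ∀ x y : G, x * g * x⁻¹ = y * g * y⁻¹ ↔ x⁻¹ * y ∈ Subgroup.centralizer {g} := by
    intro x y
    rw [mem_centralizer_singleton_iff_conj]
    constructor
    · intro h
      calc x⁻¹ * y * g * (x⁻¹ * y)⁻¹ = x⁻¹ * (y * g * y⁻¹) * x := by group
        _ = g := by rw [← h]; group
    · intro h
      calc x * g * x⁻¹ = x * (x⁻¹ * y * g * (x⁻¹ * y)⁻¹) * x⁻¹ := by rw [h]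
        _ = _ := by group
  refine (Nat.card_congr (Equiv.ofBijective
    (Quotient.lift (s := QuotientGroup.leftRel (Subgroup.centralizer {g}))
      (fun x => (⟨x * g * x⁻¹, isConj_iff.2 ⟨x, rfl⟩⟩ : {h : G // IsConj g h})) ?_) ⟨?_, ?_⟩)).symm
  · intro x y hxy
    exact Subtype.ext ((hrel x y).2 (QuotientGroup.leftRel_apply.1 hxy))
  · rintro ⟨x⟩ ⟨y⟩ hxy
    exact Quotient.sound (QuotientGroup.leftRel_apply.2 ((hrel x y).1 (congrArg Subtype.val hxy)))
  · rintro ⟨h, hh⟩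
    obtain ⟨c, rfl⟩ := isConj_iff.1 hh
    exact ⟨Quotient.mk _ c, rfl⟩

end ConjugacyIndex

/-! ### Modules over the quantum double and their fibres -/

section DoubleModules

variable {G : Type*} [Group G]

open SkewMonoidAlgebra

open scoped Classical in
/-- The indicator function of a point. -/
def funDelta (g : G) : FunAlg G := fun h => if h = g then 1 else 0

theorem FunAlg.smul_apply (x : G) (φ : FunAlg G) (h : G) : (x • φ) h = φ (x⁻¹ * h * x) := rfl

omit [Group G] in
theorem FunAlg.mul_apply (φ ψ : FunAlg G) (h : G) : (φ * ψ) h = φ h * ψ h := rfl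

omit [Group G] in
theorem FunAlg.mul_funDelta (φ : FunAlg G) (g : G) : φ * funDelta g = φ g • funDelta g := by
  funext h
  change φ h * funDelta g h = φ g * funDelta g h
  by_cases hg : h = g
  · rw [hg]
  · simp [funDelta, hg]

open scoped Classical in
theorem smul_funDelta (x g : G) : x • funDelta g = funDelta (x * g * x⁻¹) := by
  funext h
  rw [FunAlg.smul_apply]
  have : x⁻¹ * h * x = g ↔ h = x * g * x⁻¹ := by
    constructor
    · rintro rfl; group
    · rintro rfl; group
  simp only [funDelta]
  exact if_congr this rfl rfl

omit [Group G] in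
theorem funDelta_mul_funDelta_of_ne {g h : G} (hgh : g ≠ h) : funDelta g * funDelta h = 0 := by
  rw [FunAlg.mul_funDelta]
  simp [funDelta, hgh.symm]

omit [Group G] in
theorem funDelta_mul_self (g : G) : funDelta g * funDelta g = funDelta g := by
  rw [FunAlg.mul_funDelta]
  simp [funDelta]

omit [Group G] in
theorem sum_funDelta [Fintype G] : ∑ g : G, funDelta g = 1 := by
  classical
  funext h
  refine (Finset.sum_apply (M := fun _ => ℂ) h Finset.univ
    (fun g => (funDelta g : G → ℂ))).trans ?_
  change ∑ g : G, (if h = g then (1 : ℂ) else 0) = 1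
  simp

/-- The idempotent `δ_g` of the quantum double. -/
def dbl (g : G) : QuantumDouble G := single 1 (funDelta g)

/-- The group-like element `x` of the quantum double. -/
def grp (x : G) : QuantumDouble G := single x 1

theorem grp_one : grp (1 : G) = 1 := rfl

theorem grp_mul (x y : G) : grp (x * y) = grp x * grp y := by
  simp [grp, single_mul_single]

theorem grp_mul_dbl (x g : G) : grp x * dbl g = dbl (x * g * x⁻¹) * grp x := by
  simp [grp, dbl, single_mul_single, smul_funDelta]

theorem dbl_mul_self (g : G) : dbl g * dbl g = dbl g := by
  simp [dbl, single_mul_single, funDelta_mul_self]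

theorem dbl_mul_of_ne {g h : G} (hgh : g ≠ h) : dbl g * dbl h = 0 := by
  simp [dbl, single_mul_single, funDelta_mul_funDelta_of_ne hgh]

theorem single_eq_mul_grp (x : G) (φ : FunAlg G) :
    (single x φ : QuantumDouble G) = single 1 φ * grp x := by
  simp [grp, single_mul_single]

/-- Functions act on the degree `g` part through their value at `g`; this reduces the action of the
double on a fibre to that of group elements. -/
theorem dbl_mul_single_one (g : G) (φ : FunAlg G) :
    dbl g * (single 1 φ : QuantumDouble G) = algebraMap ℂ (QuantumDouble G) (φ g) * dbl g := by
  rw [coe_algebraMap]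
  simp only [dbl, Function.comp_apply, single_mul_single, one_mul, one_smul]
  rw [mul_comm, FunAlg.mul_funDelta, Algebra.smul_def]

theorem sum_dbl [Fintype G] : ∑ g : G, dbl g = (1 : QuantumDouble G) := by
  have := map_sum (singleAddHom (k := FunAlg G) (1 : G)) funDelta Finset.univ
  rw [sum_funDelta] at this
  exact this.symm

section Fiber

variable {M : Type*} [AddCommGroup M] [Module ℂ M] [Module (QuantumDouble G) M]
  [IsScalarTower ℂ (QuantumDouble G) M]

variable (M) in
/-- The degree `g` part of a module over the quantum double. -/
def fiber (g : G) : Submodule ℂ M where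
  carrier := {m | dbl g • m = m}
  zero_mem' := smul_zero _
  add_mem' {a b} ha hb := by
    change dbl g • (a + b) = a + b
    rw [smul_add, ha, hb]
  smul_mem' c m hm := by
    change dbl g • c • m = c • m
    have : dbl g • c • m = c • dbl g • m := by
      rw [← algebraMap_smul (QuantumDouble G) c m, ← mul_smul, ← Algebra.commutes, mul_smul,
        algebraMap_smul]
    rw [this, hm]

theorem mem_fiber {g : G} {m : M} : m ∈ fiber M g ↔ dbl g • m = m := Iff.rfl

theorem dbl_smul_mem_fiber (g : G) (m : M) : dbl g • m ∈ fiber M g := by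
  rw [mem_fiber, ← mul_smul, dbl_mul_self]

theorem grp_smul_mem_fiber {g : G} {m : M} (hm : m ∈ fiber M g) (x : G) :
    grp x • m ∈ fiber M (x * g * x⁻¹) := by
  rw [mem_fiber] at hm ⊢
  rw [← mul_smul, ← grp_mul_dbl, mul_smul, hm]

theorem dbl_smul_of_ne {g h : G} (hgh : h ≠ g) {m : M} (hm : m ∈ fiber M g) : dbl h • m = 0 := by
  rw [← mem_fiber.1 hm, ← mul_smul, dbl_mul_of_ne hgh, zero_smul]

theorem smul_comm_complex (a : QuantumDouble G) (c : ℂ) (m : M) : a • c • m = c • a • m := by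
  rw [← algebraMap_smul (QuantumDouble G) c m, ← mul_smul, ← Algebra.commutes, mul_smul,
    algebraMap_smul]

variable (M) in
/-- The action of the centralizer of `g` on the degree `g` part. -/
def fiberRep (g : G) : Representation ℂ (Subgroup.centralizer {g}) (fiber M g) where
  toFun z :=
    { toFun := fun m => ⟨grp (z : G) • (m : M), by
        have := grp_smul_mem_fiber m.2 (z : G)
        rwa [mem_centralizer_singleton_iff_conj.1 z.2] at this⟩
      map_add' := fun a b => Subtype.ext (smul_add _ _ _)
      map_smul' := fun c a => Subtype.ext (smul_comm_complex _ _ _) }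
  map_one' := by
    ext m
    exact one_smul _ _
  map_mul' x y := by
    ext m
    change grp ((x * y : Subgroup.centralizer {g}) : G) • (m : M) =
      grp (x : G) • grp (y : G) • (m : M)
    rw [← mul_smul, ← grp_mul]
    rfl

theorem fiberRep_apply (g : G) (z : Subgroup.centralizer {g}) (m : fiber M g) :
    ((fiberRep M g z m : fiber M g) : M) = grp (z : G) • (m : M) := rfl

/-- A nonzero vector w of an invariant subspace W generates the whole simple module. Projecting an
element (φ x) w back to degree `g` gives φ(g) times x w if x centralizes `g`, and 0 otherwise; in
both cases the result lies in W. So W is the whole fibre. -/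
theorem fiberRep_irreducible [IsSimpleModule (QuantumDouble G) M] {g : G} (hg : fiber M g ≠ ⊥) :
    (fiberRep M g).IsIrreducible := by
  rw [isIrreducible_iff]
  refine ⟨Submodule.nontrivial_iff_ne_bot.2 hg, fun W hW => or_iff_not_imp_left.2 fun hbot => ?_⟩
  obtain ⟨w, hw, hw0⟩ := Submodule.exists_mem_ne_zero_of_ne_bot hbot
  have hspan : Submodule.span (QuantumDouble G) {(w : M)} = ⊤ := by
    refine (eq_bot_or_eq_top _).resolve_left fun h => hw0 (Subtype.ext ?_)
    rwa [Submodule.span_singleton_eq_bot] at h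
  have key : ∀ a : QuantumDouble G, ∃ u : fiber M g, u ∈ W ∧ (u : M) = dbl g • a • (w : M) := by
    intro a
    induction a using SkewMonoidAlgebra.induction_on with
    | zero => exact ⟨0, W.zero_mem, by simp⟩
    | add a b ha hb =>
      obtain ⟨u, hu, hua⟩ := ha
      obtain ⟨v, hv, hvb⟩ := hb
      exact ⟨u + v, W.add_mem hu hv, by simp [hua, hvb, add_smul]⟩
    | single x φ =>
      have h1 : dbl g • (single x φ : QuantumDouble G) • (w : M) =
          φ g • dbl g • grp x • (w : M) := by
        rw [single_eq_mul_grp, ← mul_smul, ← mul_assoc, dbl_mul_single_one, mul_assoc, mul_smul,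
          algebraMap_smul, mul_smul]
      by_cases hx : x * g * x⁻¹ = g
      · refine ⟨φ g • fiberRep M g ⟨x, mem_centralizer_singleton_iff_conj.2 hx⟩ w,
          W.smul_mem _ (hW _ _ hw), ?_⟩
        have h2 := grp_smul_mem_fiber w.2 x
        rw [hx, mem_fiber] at h2
        rw [h1, h2]
        rfl
      · exact ⟨0, W.zero_mem, by
          rw [h1, dbl_smul_of_ne (Ne.symm hx) (grp_smul_mem_fiber w.2 x), smul_zero]; rfl⟩
  rw [Submodule.eq_top_iff']
  intro m
  have hm : (m : M) ∈ Submodule.span (QuantumDouble G) {(w : M)} := by rw [hspan]; trivial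
  obtain ⟨a, ha⟩ := Submodule.mem_span_singleton.1 hm
  obtain ⟨u, hu, hua⟩ := key a
  rw [ha, mem_fiber.1 m.2] at hua
  exact (Subtype.ext hua : u = m) ▸ hu

theorem exists_fiber_ne_bot [Finite G] [Nontrivial M] : ∃ g : G, fiber M g ≠ ⊥ := by
  have := Fintype.ofFinite G
  by_contra h
  push Not at h
  obtain ⟨m, hm⟩ := exists_ne (0 : M)
  refine hm ?_
  have h1 : (∑ g : G, dbl g) • m = m := by rw [sum_dbl, one_smul]
  rw [← h1, Finset.sum_smul]
  refine Finset.sum_eq_zero fun g _ => ?_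
  have := dbl_smul_mem_fiber g m
  rwa [h g, Submodule.mem_bot] at this

end Fiber

section Equivs

variable {M N : Type*} [AddCommGroup M] [Module ℂ M] [Module (QuantumDouble G) M]
  [IsScalarTower ℂ (QuantumDouble G) M] [AddCommGroup N] [Module ℂ N] [Module (QuantumDouble G) N]
  [IsScalarTower ℂ (QuantumDouble G) N]

theorem LinearEquiv.map_complex_smul (e : M ≃ₗ[QuantumDouble G] N) (c : ℂ) (m : M) :
    e (c • m) = c • e m := by
  rw [← algebraMap_smul (QuantumDouble G) c m, map_smul, algebraMap_smul]

/-- Isomorphic modules have equivalent fibers. -/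
def fiberEquiv (e : M ≃ₗ[QuantumDouble G] N) (g : G) :
    (fiberRep M g).Equiv (fiberRep N g) :=
  Representation.Equiv.mk
    { toFun := fun m => ⟨e m, by rw [mem_fiber, ← map_smul, mem_fiber.1 m.2]⟩
      invFun := fun m => ⟨e.symm m, by rw [mem_fiber, ← map_smul, mem_fiber.1 m.2]⟩
      left_inv := fun m => Subtype.ext (e.symm_apply_apply _)
      right_inv := fun m => Subtype.ext (e.apply_symm_apply _)
      map_add' := fun a b => Subtype.ext (map_add e _ _)
      map_smul' := fun c a => Subtype.ext (LinearEquiv.map_complex_smul e c a) }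
    fun z => by
      ext m
      exact map_smul e (grp (z : G)) (m : M)

theorem fiber_ne_bot_congr (e : M ≃ₗ[QuantumDouble G] N) (g : G) (h : fiber M g ≠ ⊥) :
    fiber N g ≠ ⊥ := by
  rw [← Submodule.nontrivial_iff_ne_bot] at h ⊢
  exact (fiberEquiv e g).symm.toLinearEquiv.toEquiv.nontrivial

end Equivs

end DoubleModules

/-! ### Coinduction from a centralizer to the quantum double -/

open SkewMonoidAlgebra
section Coinduced

variable {G : Type*} [Group G] {g : G} {N : Type*} [AddCommGroup N] [Module ℂ N]

/-- The space of functions `f : G → N` with `f(xz) = σ(z)⁻¹ f(x)` for `z` in the centralizer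
of `g`. -/
def coindSpace (σ : Representation ℂ (Subgroup.centralizer {g}) N) : Submodule ℂ (G → N) where
  carrier := {f | ∀ (x : G) (z : Subgroup.centralizer {g}), f (x * z) = σ z⁻¹ (f x)}
  zero_mem' x z := by simp
  add_mem' {a b} ha hb x z := by simp only [Pi.add_apply, ha x z, hb x z, map_add]
  smul_mem' c a ha x z := by simp only [Pi.smul_apply, ha x z, map_smul]

/-- The module over the quantum double attached to a representation of a centralizer. -/
def Coind (σ : Representation ℂ (Subgroup.centralizer {g}) N) : Type _ := coindSpace σ

variable (σ : Representation ℂ (Subgroup.centralizer {g}) N)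

instance : AddCommGroup (Coind σ) := inferInstanceAs (AddCommGroup (coindSpace σ))
instance : Module ℂ (Coind σ) := inferInstanceAs (Module ℂ (coindSpace σ))

variable {σ}

@[ext] theorem Coind.ext {f f' : Coind σ} (h : ∀ x, f.1 x = f'.1 x) : f = f' :=
  Subtype.ext (funext h)

theorem Coind.prop (f : Coind σ) (x : G) (z : Subgroup.centralizer {g}) :
    f.1 (x * z) = σ z⁻¹ (f.1 x) := f.2 x z

variable (σ) in
/-- Translation operators. -/
def Coind.translate : G →* Module.End ℂ (Coind σ) where
  toFun y :=
    { toFun := fun f => ⟨fun x => f.1 (y⁻¹ * x), fun x z =>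
        (congrArg f.1 (mul_assoc _ _ _)).symm.trans (f.2 (y⁻¹ * x) z)⟩
      map_add' := fun _ _ => rfl
      map_smul' := fun _ _ => rfl }
  map_one' := by
    ext f x
    change f.1 (1⁻¹ * x) = f.1 x
    simp
  map_mul' a b := by
    ext f x
    change f.1 ((a * b)⁻¹ * x) = f.1 (b⁻¹ * (a⁻¹ * x))
    rw [mul_inv_rev, mul_assoc]

variable (σ) in
/-- Multiplication operators. -/
def Coind.multiply : FunAlg G →ₐ[ℂ] Module.End ℂ (Coind σ) where
  toFun φ :=
    { toFun := fun f => ⟨fun x => φ (x * g * x⁻¹) • f.1 x, fun x z => by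
        have h : x * z * g * (x * z : G)⁻¹ = x * g * x⁻¹ := by
          have := mem_centralizer_singleton_iff_conj.1 z.2
          calc x * z * g * (x * z : G)⁻¹ = x * (z * g * (z : G)⁻¹) * x⁻¹ := by group
            _ = _ := by rw [this]
        change φ (x * z * g * (x * z : G)⁻¹) • f.1 (x * z) = σ z⁻¹ (φ (x * g * x⁻¹) • f.1 x)
        rw [h, f.2 x z, map_smul]⟩
      map_add' := fun _ _ => Coind.ext fun _ => smul_add _ _ _
      map_smul' := fun _ _ => Coind.ext fun _ => smul_comm _ _ _ }
  map_one' := LinearMap.ext fun _ => Coind.ext fun _ => one_smul _ _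
  map_mul' _ _ := LinearMap.ext fun _ => Coind.ext fun _ => mul_smul _ _ _
  map_zero' := LinearMap.ext fun _ => Coind.ext fun _ => zero_smul _ _
  map_add' _ _ := LinearMap.ext fun _ => Coind.ext fun _ => add_smul _ _ _
  commutes' c := LinearMap.ext fun f => Coind.ext fun x => by
    rfl

variable (σ) in
/-- The action of the quantum double on the coinduced module. -/
def Coind.action : QuantumDouble G →ₐ[ℂ] Module.End ℂ (Coind σ) :=
  liftNCAlgHom (Coind.multiply σ) (Coind.translate σ) fun {φ y} => by
    ext f x
    change φ (y⁻¹ * (x * g * x⁻¹) * y) • f.1 (y⁻¹ * x) =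
      φ (y⁻¹ * x * g * (y⁻¹ * x)⁻¹) • f.1 (y⁻¹ * x)
    congr 2
    group

instance : Module (QuantumDouble G) (Coind σ) :=
  Module.compHom (Coind σ) (Coind.action σ).toRingHom

theorem Coind.smul_def (a : QuantumDouble G) (f : Coind σ) : a • f = Coind.action σ a f := rfl

instance : IsScalarTower ℂ (QuantumDouble G) (Coind σ) where
  smul_assoc c a f := by
    rw [Coind.smul_def, Coind.smul_def, map_smul, LinearMap.smul_apply]

theorem Coind.single_smul_apply (y : G) (φ : FunAlg G) (f : Coind σ) (x : G) :
    ((single y φ : QuantumDouble G) • f).1 x = φ (x * g * x⁻¹) • f.1 (y⁻¹ * x) := by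
  have : Coind.action σ (single y φ) = Coind.multiply σ φ * Coind.translate σ y :=
    liftNC_single _ _ _ _
  rw [Coind.smul_def, this]
  rfl

theorem Coind.grp_smul_apply (y : G) (f : Coind σ) (x : G) : (grp y • f).1 x = f.1 (y⁻¹ * x) := by
  rw [grp, Coind.single_smul_apply]
  exact one_smul _ _

open scoped Classical in
theorem Coind.dbl_smul_apply (h : G) (f : Coind σ) (x : G) :
    (dbl h • f).1 x = if x * g * x⁻¹ = h then f.1 x else 0 := by
  rw [dbl, Coind.single_smul_apply]
  simp only [funDelta, ite_smul, one_smul, zero_smul, inv_one, one_mul]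

theorem Coind.isConj_of_fiber_ne_bot {h : G} (hh : fiber (Coind σ) h ≠ ⊥) : IsConj g h := by
  classical
  obtain ⟨f, hf, hf0⟩ := Submodule.exists_mem_ne_zero_of_ne_bot hh
  by_contra hc
  refine hf0 (Coind.ext fun x => ?_)
  rw [← mem_fiber.1 hf, Coind.dbl_smul_apply, if_neg fun e => hc (isConj_iff.2 ⟨x, e⟩)]
  rfl

open scoped Classical in
variable (σ) in
/-- The element of the fiber at `g` supported on the centralizer. -/
def Coind.extend (n : N) : Coind σ :=
  ⟨fun x => if h : x * g * x⁻¹ = g then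
      σ ⟨x, mem_centralizer_singleton_iff_conj.2 h⟩⁻¹ n else 0, fun x z => by
    have hz := mem_centralizer_singleton_iff_conj.1 z.2
    have hxz : x * z * g * (x * z : G)⁻¹ = x * g * x⁻¹ := by
      calc x * z * g * (x * z : G)⁻¹ = x * (z * g * (z : G)⁻¹) * x⁻¹ := by group
        _ = _ := by rw [hz]
    beta_reduce
    by_cases hx : x * g * x⁻¹ = g
    · rw [dif_pos hx, dif_pos (hxz.trans hx), ← Module.End.mul_apply, ← map_mul, ← mul_inv_rev]
      rfl
    · rw [dif_neg hx, dif_neg fun h => hx (hxz.symm.trans h), map_zero]⟩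

theorem Coind.extend_apply (n : N) {x : G} (h : x * g * x⁻¹ = g) :
    (Coind.extend σ n).1 x = σ ⟨x, mem_centralizer_singleton_iff_conj.2 h⟩⁻¹ n := dif_pos h

theorem Coind.extend_apply_of_not (n : N) {x : G} (h : x * g * x⁻¹ ≠ g) :
    (Coind.extend σ n).1 x = 0 := dif_neg h

theorem Coind.extend_apply_one (n : N) : (Coind.extend σ n).1 1 = n := by
  have h : (1 : G) * g * 1⁻¹ = g := by simp
  rw [Coind.extend_apply n h]
  have : (⟨1, mem_centralizer_singleton_iff_conj.2 h⟩ : Subgroup.centralizer {g}) = 1 := rfl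
  rw [this, inv_one, map_one]
  rfl

theorem Coind.extend_mem_fiber (n : N) : Coind.extend σ n ∈ fiber (Coind σ) g := by
  classical
  rw [mem_fiber]
  ext x
  rw [Coind.dbl_smul_apply]
  split_ifs with h
  · rfl
  · exact (Coind.extend_apply_of_not n h).symm

/-- Degree `g` forces the support into the centralizer, where equivariance recovers every value from
the one at 1. -/
theorem Coind.eq_extend {f : Coind σ} (hf : f ∈ fiber (Coind σ) g) :
    f = Coind.extend σ (f.1 1) := by
  classical
  ext x
  by_cases hx : x * g * x⁻¹ = g
  · rw [Coind.extend_apply _ hx]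
    have := f.prop 1 ⟨x, mem_centralizer_singleton_iff_conj.2 hx⟩
    rwa [one_mul] at this
  · rw [← mem_fiber.1 hf, Coind.dbl_smul_apply, if_neg hx]
    exact (Coind.extend_apply_of_not _ hx).symm

variable (σ) in
/-- The fiber at `g` of the coinduced module is the representation one started from. -/
def Coind.fiberEquiv : (fiberRep (Coind σ) g).Equiv σ :=
  Representation.Equiv.mk
    { toFun := fun f => f.1.1 1
      invFun := fun n => ⟨Coind.extend σ n, Coind.extend_mem_fiber n⟩
      left_inv := fun f => Subtype.ext (Coind.eq_extend f.2).symm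
      right_inv := fun n => Coind.extend_apply_one n
      map_add' := fun _ _ => rfl
      map_smul' := fun _ _ => rfl }
    fun z => by
      ext f
      change (grp (z : G) • f.1).1 1 = σ z (f.1.1 1)
      rw [Coind.grp_smul_apply, mul_one]
      have := f.1.prop 1 z⁻¹
      rwa [one_mul, inv_inv] at this

/-- The vectors whose extension lies in a submodule S form an invariant subspace of N. If S is
nonzero this subspace is nonzero, hence everything, and S contains the fibre at `g`. Translation
then gives the fibres over the whole class, and the idempotents δ_h decompose every element into
such pieces. -/
instance Coind.isSimple [Finite G] [hσ : σ.IsIrreducible] :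
    IsSimpleModule (QuantumDouble G) (Coind σ) := by
  classical
  have := Fintype.ofFinite G
  have hσ' := (isIrreducible_iff σ).1 hσ
  have hnt : Nontrivial N := hσ'.1
  rw [isSimpleModule_iff]
  refine { exists_pair_ne := ⟨⊥, ⊤, fun e => ?_⟩, eq_bot_or_eq_top := fun S => ?_ }
  · obtain ⟨n, hn⟩ := exists_ne (0 : N)
    have : Coind.extend σ n ∈ (⊥ : Submodule (QuantumDouble G) (Coind σ)) := by rw [e]; trivial
    rw [Submodule.mem_bot] at this
    have h2 := Coind.extend_apply_one (σ := σ) n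
    rw [this] at h2
    exact hn h2.symm
  refine or_iff_not_imp_left.2 fun hS => ?_
  obtain ⟨f, hf, hf0⟩ := Submodule.exists_mem_ne_zero_of_ne_bot hS
  obtain ⟨x0, hx0⟩ : ∃ x, f.1 x ≠ 0 := by
    by_contra h
    push Not at h
    exact hf0 (Coind.ext h)
  let W : Submodule ℂ N :=
    { carrier := {n | Coind.extend σ n ∈ S}
      zero_mem' := by
        have : Coind.extend σ 0 = (0 : Coind σ) :=
          congrArg Subtype.val ((Coind.fiberEquiv σ).symm.toLinearEquiv.map_zero)
        change Coind.extend σ 0 ∈ S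
        rw [this]
        exact S.zero_mem
      add_mem' := fun {a b} ha hb => by
        have : Coind.extend σ (a + b) = Coind.extend σ a + Coind.extend σ b :=
          congrArg Subtype.val ((Coind.fiberEquiv σ).symm.toLinearEquiv.map_add a b)
        change Coind.extend σ (a + b) ∈ S
        rw [this]
        exact S.add_mem ha hb
      smul_mem' := fun c a ha => by
        have : Coind.extend σ (c • a) = c • Coind.extend σ a :=
          congrArg Subtype.val ((Coind.fiberEquiv σ).symm.toLinearEquiv.map_smul c a)
        change Coind.extend σ (c • a) ∈ S
        rw [this, ← algebraMap_smul (QuantumDouble G)]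
        exact S.smul_mem _ ha }
  have hW : W = ⊤ := by
    refine (hσ'.2 W fun z n hn => ?_).resolve_left fun hbot => ?_
    · have h1 : grp (z : G) • Coind.extend σ n = Coind.extend σ (σ z n) := by
        have := (Coind.fiberEquiv σ).symm.toIntertwiningMap.isIntertwining' z
        exact (congrArg Subtype.val (congrArg (fun T => T n) this)).symm
      change Coind.extend σ (σ z n) ∈ S
      rw [← h1]
      exact S.smul_mem _ hn
    -- Translating by the inverse of `x0` moves a nonzero value to 1, and δ_g keeps it.
    · have h1 : dbl g • grp x0⁻¹ • f ∈ S := S.smul_mem _ (S.smul_mem _ hf)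
      rw [Coind.eq_extend (dbl_smul_mem_fiber g (grp x0⁻¹ • f))] at h1
      have h2 : (dbl g • grp x0⁻¹ • f).1 1 ∈ W := h1
      rw [hbot, Submodule.mem_bot, Coind.dbl_smul_apply, if_pos (by simp), Coind.grp_smul_apply,
        inv_inv, mul_one] at h2
      exact hx0 h2
  rw [Submodule.eq_top_iff']
  intro F
  have hsum : ∀ h : G, dbl h • F ∈ S := fun h => by
    by_cases hc : IsConj g h
    · obtain ⟨x, rfl⟩ := isConj_iff.1 hc
      have h1 : dbl (x * g * x⁻¹) • F = grp x • dbl g • grp x⁻¹ • F := by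
        rw [← mul_smul (dbl g), ← mul_smul (grp x), ← mul_assoc, grp_mul_dbl,
          mul_assoc (dbl _) (grp x), ← grp_mul, mul_inv_cancel, grp_one, mul_one]
      rw [h1]
      refine S.smul_mem _ ?_
      rw [Coind.eq_extend (dbl_smul_mem_fiber g (grp x⁻¹ • F))]
      have : ∀ n, n ∈ W := fun n => hW ▸ Submodule.mem_top
      exact this _
    · have h1 : dbl h • F = 0 := by
        by_contra hne
        exact hc (Coind.isConj_of_fiber_ne_bot fun hb => hne (by
          have := dbl_smul_mem_fiber h F
          rwa [hb, Submodule.mem_bot] at this))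
      rw [h1]
      exact S.zero_mem
  have h1 : (∑ h : G, dbl h) • F = F := by rw [sum_dbl, one_smul]
  rw [← h1, Finset.sum_smul]
  exact S.sum_mem fun h _ => hsum h

instance Coind.finite [Finite G] [FiniteDimensional ℂ N] : FiniteDimensional ℂ (Coind σ) :=
  inferInstanceAs (FiniteDimensional ℂ (coindSpace σ))

variable (σ) in
-- An equivariant function is freely determined by its values on representatives of the cosets of
-- the centralizer.
theorem Coind.finrank [Finite G] [FiniteDimensional ℂ N] : Module.finrank ℂ (Coind σ) =
    (Subgroup.centralizer {g}).index * Module.finrank ℂ N := by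
  have := Fintype.ofFinite (G ⧸ Subgroup.centralizer {g})
  have hout : ∀ x : G, (QuotientGroup.mk (s := Subgroup.centralizer {g}) x).out⁻¹ * x ∈
      Subgroup.centralizer {g} := fun x =>
    QuotientGroup.eq.1 (QuotientGroup.out_eq' _)
  let e : Coind σ ≃ₗ[ℂ] (G ⧸ Subgroup.centralizer {g} → N) :=
    { toFun := fun f c => f.1 c.out
      invFun := fun h => ⟨fun x => σ ⟨_, hout x⟩⁻¹ (h (QuotientGroup.mk x)), fun x z => by
        have h1 : (QuotientGroup.mk (x * z : G) : G ⧸ Subgroup.centralizer {g}) =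
            QuotientGroup.mk x := QuotientGroup.mk_mul_of_mem x z.2
        have h2 : (⟨_, hout (x * z)⟩ : Subgroup.centralizer {g}) = ⟨_, hout x⟩ * z := by
          refine Subtype.ext ?_
          simp only [Subgroup.coe_mul, h1, mul_assoc]
        beta_reduce
        rw [h2, mul_inv_rev, map_mul, h1]
        rfl⟩
      left_inv := fun f => Coind.ext fun x => by
        have := f.prop (QuotientGroup.mk (s := Subgroup.centralizer {g}) x).out ⟨_, hout x⟩
        simp only [mul_inv_cancel_left] at this
        exact this.symm
      right_inv := fun h => by
        funext c
        have h1 : (QuotientGroup.mk (s := Subgroup.centralizer {g}) c.out) = c :=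
          QuotientGroup.out_eq' c
        have h2 : (⟨_, hout c.out⟩ : Subgroup.centralizer {g}) = 1 := by
          refine Subtype.ext ?_
          simp only [h1, inv_mul_cancel, Subgroup.coe_one]
        change σ _ _ = _
        rw [h2, inv_one, map_one, h1]
        rfl
      map_add' := fun _ _ => rfl
      map_smul' := fun _ _ => rfl }
  rw [e.finrank_eq, Module.finrank_pi_fintype, Finset.sum_const, Finset.card_univ, smul_eq_mul,
    Subgroup.index, Nat.card_eq_fintype_card]

/-- A simple module is coinduced from any of its nonzero fibers. -/
theorem nonempty_equiv_coind [Finite G] {M : Type*} [AddCommGroup M] [Module ℂ M]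
    [Module (QuantumDouble G) M] [IsScalarTower ℂ (QuantumDouble G) M]
    [IsSimpleModule (QuantumDouble G) M] (hg : fiber M g ≠ ⊥) [σ.IsIrreducible]
    (e : (fiberRep M g).Equiv σ) : Nonempty (M ≃ₗ[QuantumDouble G] Coind σ) := by
  have hint : ∀ z m, e (fiberRep M g z m) = σ z (e m) := fun z m =>
    congrArg (fun T => T m) (e.toIntertwiningMap.isIntertwining' z)
  -- Frobenius reciprocity: m is sent to the function x ↦ e(δ_g x⁻¹ m). This is a nonzero linear map
  -- between simple modules over the double, hence bijective.
  let T0 (m : M) (x : G) : fiber M g := ⟨_, dbl_smul_mem_fiber g (grp x⁻¹ • m)⟩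
  have hadd : ∀ m m' x, T0 (m + m') x = T0 m x + T0 m' x := fun m m' x =>
    Subtype.ext (by simp [T0, smul_add])
  let T1 (m : M) : Coind σ := ⟨fun x => e (T0 m x), fun x z => by
    change e (T0 m (x * z)) = σ z⁻¹ (e (T0 m x))
    rw [← hint]
    congr 1
    refine Subtype.ext ?_
    rw [fiberRep_apply]
    have h1 : (z : G)⁻¹ * g * (z : G)⁻¹⁻¹ = g :=
      mem_centralizer_singleton_iff_conj.1 (z⁻¹).2
    change dbl g • grp (x * z : G)⁻¹ • m = grp (z : G)⁻¹ • dbl g • grp x⁻¹ • m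
    rw [← mul_smul (grp (z : G)⁻¹), grp_mul_dbl, h1, mul_inv_rev, grp_mul, mul_smul, mul_smul]⟩
  let T : M →ₗ[QuantumDouble G] Coind σ :=
    { toFun := T1
      map_add' := fun m m' => Coind.ext fun x => by
        change e _ = e _ + e _
        rw [hadd, map_add]
      map_smul' := fun a m => by
        induction a using SkewMonoidAlgebra.induction_on with
        | zero =>
          refine Coind.ext fun x => ?_
          have : T0 (0 : M) x = 0 := Subtype.ext (by simp [T0])
          change e (T0 ((0 : QuantumDouble G) • m) x) = ((0 : QuantumDouble G) • T1 m).1 x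
          rw [zero_smul, zero_smul, this, map_zero]
          rfl
        | add a b ha hb =>
          simp only [RingHom.id_apply] at ha hb ⊢
          rw [add_smul, add_smul, ← ha, ← hb]
          refine Coind.ext fun x => ?_
          change e _ = e _ + e _
          rw [hadd, map_add]
        | single y φ =>
          refine Coind.ext fun x => ?_
          rw [RingHom.id_apply, Coind.single_smul_apply]
          change e _ = _ • e _
          rw [← map_smul]
          congr 1
          refine Subtype.ext ?_
          change dbl g • grp x⁻¹ • (single y φ : QuantumDouble G) • m =
            φ (x * g * x⁻¹) • dbl g • grp (y⁻¹ * x)⁻¹ • m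
          have h1 : grp x⁻¹ * (single y φ : QuantumDouble G) =
              single 1 (x⁻¹ • φ) * grp (y⁻¹ * x)⁻¹ := by
            simp [grp, single_mul_single]
          rw [← mul_smul (grp x⁻¹), h1, mul_smul, ← mul_smul (dbl g), dbl_mul_single_one, mul_smul,
            algebraMap_smul, FunAlg.smul_apply, inv_inv] }
  refine ⟨LinearEquiv.ofBijective T ((LinearMap.bijective_or_eq_zero T).resolve_right fun h0 => ?_)⟩
  obtain ⟨m, hm, hm0⟩ := Submodule.exists_mem_ne_zero_of_ne_bot hg
  have h1 : (T m).1 1 = 0 := by rw [h0]; rfl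
  have h2 : T0 m 1 = 0 := by
    have h3 : e (T0 m 1) = 0 := h1
    have := congrArg e.symm h3
    rwa [Representation.Equiv.symm_apply_apply, map_zero] at this
  have h3 := congrArg Subtype.val h2
  change dbl g • grp 1⁻¹ • m = 0 at h3
  rw [inv_one, grp_one, one_smul, mem_fiber.1 hm] at h3
  exact hm0 h3

end Coinduced

/-! ### Isomorphism classes of simple modules, independently of the universe -/

section Classification

variable {A : Type*} [Ring A] [Algebra ℂ A]

/-- A linear isomorphism over `A` regarded over `ℂ`. -/
def restrictScalarsEquiv {M N : Type*} [AddCommGroup M] [Module A M] [AddCommGroup N] [Module ℂ N]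
    [Module A N] [IsScalarTower ℂ A N] (e : M ≃ₗ[A] N) : RestrictScalars ℂ A M ≃ₗ[ℂ] N where
  toFun x := e x
  invFun y := e.symm y
  left_inv x := e.symm_apply_apply x
  right_inv y := e.apply_symm_apply y
  map_add' x y := e.map_add x y
  map_smul' c x := (e.map_smul (algebraMap ℂ A c) x).trans (algebraMap_smul A c (e x))

section

variable (M : Type*) [AddCommGroup M] [Module ℂ M] [Module A M] [IsScalarTower ℂ A M]
    [FiniteDimensional ℂ M] [IsSimpleModule A M]
variable (N : Type*) [AddCommGroup N] [Module ℂ N] [Module A N] [IsScalarTower ℂ A N]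
    [FiniteDimensional ℂ N] [IsSimpleModule A N]

variable (A) in
-- `AlgIrr` ranges over modules in the lowest universe, while coinduced modules may live higher. A
-- finite-dimensional space is in bijection with a power of ℂ, so it can be shrunk.
theorem exists_small_model : ∃ M' : {M : ModuleCat.{0} A //
    IsSimpleModule A M ∧ Module.Finite ℂ (RestrictScalars ℂ A M)}, Nonempty (M'.1 ≃ₗ[A] M) :=
  have : Small.{0} M := small_map (Module.finBasis ℂ M).equivFun.toEquiv
  ⟨⟨ModuleCat.of A (Shrink.{0} M), IsSimpleModule.congr (Shrink.linearEquiv.{0} A M),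
    Module.Finite.equiv (restrictScalarsEquiv (Shrink.linearEquiv.{0} A M)).symm⟩,
    ⟨Shrink.linearEquiv.{0} A M⟩⟩

variable (A) in
/-- The class of a simple module in any universe. -/
def AlgIrr.ofModule : AlgIrr A := Quotient.mk _ (exists_small_model A M).choose

variable {M N} in
theorem AlgIrr.ofModule_eq_iff :
    AlgIrr.ofModule A M = AlgIrr.ofModule A N ↔ Nonempty (M ≃ₗ[A] N) := by
  obtain ⟨e⟩ := (exists_small_model A M).choose_spec
  obtain ⟨f⟩ := (exists_small_model A N).choose_spec
  exact Quotient.eq.trans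
    ⟨fun ⟨h⟩ => ⟨e.symm.trans (h.trans f)⟩, fun ⟨h⟩ => ⟨e.trans (h.trans f.symm)⟩⟩

theorem AlgIrr.dim_ofModule : (AlgIrr.ofModule A M).dim = Module.finrank ℂ M := by
  obtain ⟨e⟩ := (exists_small_model A M).choose_spec
  exact (restrictScalarsEquiv e).finrank_eq

end

theorem AlgIrr.exists_module (P : AlgIrr A) : ∃ (M : Type) (_ : AddCommGroup M) (_ : Module ℂ M)
    (_ : Module A M) (_ : IsScalarTower ℂ A M) (_ : FiniteDimensional ℂ M)
    (_ : IsSimpleModule A M), P = AlgIrr.ofModule A M := by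
  obtain ⟨⟨M, h1, h2⟩, rfl⟩ := Quotient.exists_rep (s := algIrrSetoid A) P
  let : Module ℂ M := Module.compHom M (algebraMap ℂ A)
  have : IsScalarTower ℂ A M := IsScalarTower.of_compHom ℂ A M
  have : FiniteDimensional ℂ M :=
    Module.Finite.equiv (restrictScalarsEquiv (LinearEquiv.refl A M))
  refine ⟨M, inferInstance, inferInstance, inferInstance, inferInstance, inferInstance, h1, ?_⟩
  obtain ⟨e⟩ := (exists_small_model A M).choose_spec
  exact Quotient.sound ⟨e.symm⟩

end Classification

/-! ### Classification of the irreducible representations of the quantum double -/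

section Double

variable {G : Type*} [Group G] [Finite G]

/-- The irreducible representation of the quantum double attached to an element `g` and an
irreducible representation of its centralizer. -/
def doubleIrr (p : Σ g : G, Irr (Subgroup.centralizer {g})) : AlgIrr (QuantumDouble G) :=
  AlgIrr.ofModule _ (Coind (Quotient.out p.2).rep)

theorem doubleIrr_dim (p : Σ g : G, Irr (Subgroup.centralizer {g})) :
    (doubleIrr p).dim = (Subgroup.centralizer {p.1}).index * p.2.dim := by
  rw [doubleIrr, AlgIrr.dim_ofModule, Coind.finrank]
  congr 1
  conv_rhs => rw [← Quotient.out_eq p.2]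
  rfl

/-- Taking the fibre at `g` and coinducing from it are inverse operations, by `Coind.fiberEquiv` and
`nonempty_equiv_coind`. -/
theorem doubleIrr_eq_iff {M : Type*} [AddCommGroup M] [Module ℂ M] [Module (QuantumDouble G) M]
    [IsScalarTower ℂ (QuantumDouble G) M] [FiniteDimensional ℂ M]
    [IsSimpleModule (QuantumDouble G) M] (g : G) (π : Irr (Subgroup.centralizer {g})) :
    doubleIrr ⟨g, π⟩ = AlgIrr.ofModule _ M ↔
      fiber M g ≠ ⊥ ∧ Nonempty ((fiberRep M g).Equiv (Quotient.out π).rep) := by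
  rw [doubleIrr, AlgIrr.ofModule_eq_iff]
  constructor
  · rintro ⟨e⟩
    refine ⟨fiber_ne_bot_congr e g ?_,
      ⟨(fiberEquiv e.symm g).trans (Coind.fiberEquiv (Quotient.out π).rep)⟩⟩
    have := ((isIrreducible_iff _).1 (Quotient.out π).irreducible).1
    rw [← Submodule.nontrivial_iff_ne_bot]
    exact (Coind.fiberEquiv (Quotient.out π).rep).toLinearEquiv.toEquiv.nontrivial
  · rintro ⟨h, ⟨e⟩⟩
    obtain ⟨f⟩ := nonempty_equiv_coind h e
    exact ⟨f.symm⟩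

theorem fiber_ne_bot_iff_isConj {M : Type*} [AddCommGroup M] [Module ℂ M]
    [Module (QuantumDouble G) M] [IsScalarTower ℂ (QuantumDouble G) M] [FiniteDimensional ℂ M]
    [IsSimpleModule (QuantumDouble G) M] {g : G} (hg : fiber M g ≠ ⊥) (h : G) :
    fiber M h ≠ ⊥ ↔ IsConj g h := by
  constructor
  · intro hh
    have := fiberRep_irreducible hg
    obtain ⟨e⟩ := nonempty_equiv_coind hg (Representation.Equiv.refl (fiberRep M g))
    exact Coind.isConj_of_fiber_ne_bot (fiber_ne_bot_congr e h hh)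
  · intro hc
    obtain ⟨x, rfl⟩ := isConj_iff.1 hc
    obtain ⟨m, hm, hm0⟩ := Submodule.exists_mem_ne_zero_of_ne_bot hg
    intro hbot
    have h1 := grp_smul_mem_fiber hm x
    rw [hbot, Submodule.mem_bot] at h1
    refine hm0 ?_
    have h2 : grp x⁻¹ • grp x • m = m := by
      rw [← mul_smul, ← grp_mul, inv_mul_cancel, grp_one, one_smul]
    rw [← h2, h1, smul_zero]

/-- The support of a simple module is one conjugacy class, and each `g` in it admits exactly one π,
the representation on the fibre. The number of pairs giving P is thus the class size, which cancels
the weight. This makes a choice of class representatives unnecessary. -/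
theorem sum_doubleIrr_weight [Fintype G] [DecidableEq (AlgIrr (QuantumDouble G))]
    [∀ g : G, Fintype (Irr (Subgroup.centralizer {g}))] (P : AlgIrr (QuantumDouble G)) :
    ∑ g : G, ∑ π : Irr (Subgroup.centralizer {g}),
      (if doubleIrr ⟨g, π⟩ = P then ((Subgroup.centralizer {g}).index : ℂ)⁻¹ else 0) = 1 := by
  classical
  obtain ⟨M, _, _, _, _, _, _, rfl⟩ := P.exists_module
  have : Nontrivial M := IsSimpleModule.nontrivial (QuantumDouble G) M
  obtain ⟨g₀, hg₀⟩ := exists_fiber_ne_bot (G := G) (M := M)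
  have hidx : ∀ g, IsConj g₀ g → (Subgroup.centralizer {g}).index =
      (Subgroup.centralizer {g₀}).index := fun g hg => by
    rw [← card_isConj_eq_index, ← card_isConj_eq_index]
    exact Nat.card_congr (Equiv.subtypeEquivRight fun x => ⟨hg.trans, hg.symm.trans⟩)
  have hin : ∀ g : G, ∑ π : Irr (Subgroup.centralizer {g}),
      (if doubleIrr ⟨g, π⟩ = AlgIrr.ofModule _ M then
        ((Subgroup.centralizer {g}).index : ℂ)⁻¹ else 0) =
      if IsConj g₀ g then ((Subgroup.centralizer {g₀}).index : ℂ)⁻¹ else 0 := fun g => by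
    by_cases hg : IsConj g₀ g
    · have hf := (fiber_ne_bot_iff_isConj hg₀ g).2 hg
      have := fiberRep_irreducible hf
      rw [if_pos hg, ← hidx g hg, Finset.sum_eq_single (Irr.ofRep (fiberRep M g))]
      · refine if_pos ((doubleIrr_eq_iff g _).2 ⟨hf, ?_⟩)
        exact (Irr.ofRep_eq_mk_iff _ _).1 (Quotient.out_eq _).symm
      · intro π _ hπ
        refine if_neg fun h => hπ ?_
        have h1 := (Irr.ofRep_eq_mk_iff _ _).2 ((doubleIrr_eq_iff g π).1 h).2
        exact (Quotient.out_eq π).symm.trans h1.symm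
      · simp
    · rw [if_neg hg]
      refine Finset.sum_eq_zero fun π _ => if_neg fun h => hg ?_
      exact (fiber_ne_bot_iff_isConj hg₀ g).1 ((doubleIrr_eq_iff g π).1 h).1
  simp only [hin]
  rw [← Finset.sum_filter, Finset.sum_const, nsmul_eq_mul, ← Fintype.card_subtype,
    ← Nat.card_eq_fintype_card, card_isConj_eq_index]
  exact mul_inv_cancel₀ (Nat.cast_ne_zero.2 Subgroup.index_ne_zero_of_finite)

instance : Finite (AlgIrr (QuantumDouble G)) := by
  classical
  have := Fintype.ofFinite G
  have := fun g : G => Fintype.ofFinite (Irr (Subgroup.centralizer {g}))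
  refine Finite.of_surjective doubleIrr fun P => ?_
  by_contra h
  push Not at h
  have := sum_doubleIrr_weight P
  simp [h] at this

/-- The zeta function of the quantum double in terms of those of the centralizers. -/
theorem zetaDouble_eq [Fintype G] (s : ℂ) : zetaDouble G s =
    ∑ g : G, ((Subgroup.centralizer {g}).index : ℂ)⁻¹ *
      (1 / ((Subgroup.centralizer {g}).index : ℂ) ^ s * zeta (Subgroup.centralizer {g}) s) := by
  classical
  have := Fintype.ofFinite (AlgIrr (QuantumDouble G))
  have := fun g : G => Fintype.ofFinite (Irr (Subgroup.centralizer {g}))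
  rw [zetaDouble, finsum_eq_sum_of_fintype]
  calc _ = ∑ P : AlgIrr (QuantumDouble G), ∑ g : G, ∑ π : Irr (Subgroup.centralizer {g}),
      (if doubleIrr ⟨g, π⟩ = P then ((Subgroup.centralizer {g}).index : ℂ)⁻¹ else 0) *
        (1 / (P.dim : ℂ) ^ s) := by
        refine Finset.sum_congr rfl fun P _ => ?_
        simp only [← Finset.sum_mul]
        rw [sum_doubleIrr_weight, one_mul]
    _ = ∑ g : G, ∑ π : Irr (Subgroup.centralizer {g}),
        ((Subgroup.centralizer {g}).index : ℂ)⁻¹ * (1 / ((doubleIrr ⟨g, π⟩).dim : ℂ) ^ s) := by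
        rw [Finset.sum_comm]
        refine Finset.sum_congr rfl fun g _ => ?_
        rw [Finset.sum_comm]
        refine Finset.sum_congr rfl fun π _ => ?_
        simp
    _ = _ := by
        refine Finset.sum_congr rfl fun g _ => ?_
        rw [zeta_eq_sum, Finset.mul_sum, Finset.mul_sum]
        refine Finset.sum_congr rfl fun π _ => ?_
        rw [doubleIrr_dim, Nat.cast_mul, Complex.natCast_mul_natCast_cpow]
        simp only [one_div, mul_inv]

end Double

/-! ### Orthogonality relations for finite abelian groups -/

section Dual

variable {A : Type*} [CommGroup A] [Finite A]

theorem card_dual : Nat.card (A →* ℂˣ) = Nat.card A :=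
  CommGroup.card_monoidHom_of_hasEnoughRootsOfUnity A ℂ

instance : Finite (A →* ℂˣ) :=
  Nat.finite_of_card_ne_zero (by rw [card_dual]; exact Nat.card_pos.ne')

theorem delta_one {M : Type*} [One M] : delta (1 : M) = 1 := if_pos rfl

theorem delta_of_ne {M : Type*} [One M] {a : M} (h : a ≠ 1) : delta a = 0 := if_neg h

omit [Finite A] in
theorem sum_character_apply [Fintype A] (χ : A →* ℂˣ) :
    ∑ a, (χ a : ℂ) = Nat.card A * delta χ := by
  by_cases hχ : χ = 1
  · simp [hχ, delta_one, Nat.card_eq_fintype_card]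
  · rw [delta_of_ne hχ, mul_zero]
    obtain ⟨b, hb⟩ : ∃ b, χ b ≠ 1 := by
      by_contra h
      push Not at h
      exact hχ (MonoidHom.ext h)
    have h1 : (χ b : ℂ) * ∑ a, (χ a : ℂ) = ∑ a, (χ a : ℂ) := by
      rw [Finset.mul_sum]
      exact Fintype.sum_equiv (Equiv.mulLeft b) _ _ fun a => by simp
    have h2 : ((χ b : ℂ) - 1) * ∑ a, (χ a : ℂ) = 0 := by rw [sub_mul, h1, one_mul, sub_self]
    refine (mul_eq_zero.1 h2).resolve_left (sub_ne_zero.2 fun h => hb (Units.ext h))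

/-- For a ≠ 1 some character ψ has ψ(a) ≠ 1, and multiplying the summation variable by ψ scales the
sum by ψ(a). -/
theorem sum_dual_apply [Fintype (A →* ℂˣ)] (a : A) :
    ∑ χ : A →* ℂˣ, (χ a : ℂ) = Nat.card A * delta a := by
  by_cases ha : a = 1
  · simp only [ha, map_one, Units.val_one, delta_one, mul_one, Finset.sum_const, nsmul_eq_mul,
      Finset.card_univ, ← Nat.card_eq_fintype_card, card_dual]
  · rw [delta_of_ne ha, mul_zero]
    obtain ⟨ψ, hψ⟩ := CommGroup.exists_apply_ne_one_of_hasEnoughRootsOfUnity A ℂ ha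
    have h1 : (ψ a : ℂ) * ∑ χ : A →* ℂˣ, (χ a : ℂ) = ∑ χ : A →* ℂˣ, (χ a : ℂ) := by
      rw [Finset.mul_sum]
      exact Fintype.sum_equiv (Equiv.mulLeft ψ) _ _ fun χ => by simp
    have h2 : ((ψ a : ℂ) - 1) * ∑ χ : A →* ℂˣ, (χ a : ℂ) = 0 := by
      rw [sub_mul, h1, one_mul, sub_self]
    refine (mul_eq_zero.1 h2).resolve_left (sub_ne_zero.2 fun h => hψ (Units.ext h))

end Dual

/-! ### Conjugacy and centralizers in GL(2, F) -/

section Companion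

variable {F : Type*} [Field F]

/-- Trace and determinant. -/
def cls (g : GL (Fin 2) F) : F × Fˣ := (Matrix.trace (g : Matrix (Fin 2) (Fin 2) F),
  Matrix.GeneralLinearGroup.det g)

/-- The companion matrix with given trace and determinant. -/
def companion (p : F × Fˣ) : GL (Fin 2) F :=
  Matrix.GeneralLinearGroup.mkOfDetNeZero !![0, -(p.2 : F); 1, p.1] (by simp)

theorem coe_mkOfDetNeZero (A : Matrix (Fin 2) (Fin 2) F) (h : A.det ≠ 0) :
    ((Matrix.GeneralLinearGroup.mkOfDetNeZero A h : GL (Fin 2) F) : Matrix (Fin 2) (Fin 2) F) = A :=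
  rfl

theorem coe_c₁ (x : Fˣ) : ((c₁ x : GL (Fin 2) F) : Matrix (Fin 2) (Fin 2) F) =
    !![(x : F), 0; 0, x] := rfl

theorem coe_c₂ (x : Fˣ) : ((c₂ x : GL (Fin 2) F) : Matrix (Fin 2) (Fin 2) F) =
    !![(x : F), 1; 0, x] := rfl

theorem coe_c₃ (x y : Fˣ) : ((c₃ x y : GL (Fin 2) F) : Matrix (Fin 2) (Fin 2) F) =
    !![(x : F), 0; 0, y] := rfl

theorem c₃_self (x : Fˣ) : c₃ x x = c₁ x := rfl

theorem cls_eq_iff {g : GL (Fin 2) F} {t : F} {d : Fˣ} : cls g = (t, d) ↔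
    g 0 0 + g 1 1 = t ∧ g 0 0 * g 1 1 - g 0 1 * g 1 0 = d := by
  rw [cls, Prod.mk.injEq, Matrix.trace_fin_two, ← Matrix.det_fin_two, Units.ext_iff]
  rfl

theorem cls_c₁ (x : Fˣ) : cls (c₁ x) = ((x : F) + x, x * x) := by
  rw [cls_eq_iff]; simp [coe_c₁]

theorem cls_c₂ (x : Fˣ) : cls (c₂ x) = ((x : F) + x, x * x) := by
  rw [cls_eq_iff]; simp [coe_c₂]

theorem cls_c₃ (x y : Fˣ) : cls (c₃ x y) = ((x : F) + y, x * y) := by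
  rw [cls_eq_iff]; simp [coe_c₃]

theorem cls_companion (p : F × Fˣ) : cls (companion p) = p := by
  rw [← Prod.mk.eta (p := p), cls_eq_iff]; simp [companion]

theorem cls_eq_of_isConj {g h : GL (Fin 2) F} (e : IsConj g h) : cls g = cls h := by
  obtain ⟨c, rfl⟩ := isConj_iff.1 e
  refine Prod.ext ?_ ?_
  · simp only [cls, Matrix.GeneralLinearGroup.coe_mul]
    rw [Matrix.trace_mul_comm, ← mul_assoc, ← Matrix.GeneralLinearGroup.coe_mul, inv_mul_cancel]
    simp
  · simp [cls, mul_comm]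

theorem ext_entries {g h : GL (Fin 2) F} (h00 : g 0 0 = h 0 0) (h01 : g 0 1 = h 0 1)
    (h10 : g 1 0 = h 1 0) (h11 : g 1 1 = h 1 1) : g = h := by
  ext i j
  fin_cases i <;> fin_cases j <;> assumption

theorem exists_eq_c₁_iff {g : GL (Fin 2) F} :
    (∃ x, g = c₁ x) ↔ g 0 1 = 0 ∧ g 1 0 = 0 ∧ g 0 0 = g 1 1 := by
  constructor
  · rintro ⟨x, rfl⟩; simp [coe_c₁]
  · rintro ⟨h01, h10, h⟩
    have hdet : g 0 0 * g 1 1 - g 0 1 * g 1 0 ≠ 0 := by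
      rw [← Matrix.det_fin_two]
      exact (Matrix.GeneralLinearGroup.det g).ne_zero
    have h00 : g 0 0 ≠ 0 := by
      intro h0
      rw [h01, h0] at hdet
      simp at hdet
    refine ⟨Units.mk0 _ h00, ext_entries ?_ ?_ ?_ ?_⟩ <;> simp [coe_c₁, h01, h10, h]

/-- The hypothesis says that the vector (v, w) and its image under `g` are independent. In the basis
they form, `g` becomes its companion matrix by Cayley–Hamilton. -/
theorem isConj_companion_aux (g : GL (Fin 2) F) (v w : F)
    (h : v * (g 1 0 * v + g 1 1 * w) - (g 0 0 * v + g 0 1 * w) * w ≠ 0) :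
    IsConj (companion (cls g)) g := by
  have hP : (!![v, g 0 0 * v + g 0 1 * w; w, g 1 0 * v + g 1 1 * w] :
      Matrix (Fin 2) (Fin 2) F).det ≠ 0 := by
    rw [Matrix.det_fin_two_of]; exact h
  obtain ⟨h1, h2⟩ := cls_eq_iff.1 (Prod.mk.eta (p := cls g)).symm
  refine isConj_iff.2 ⟨Matrix.GeneralLinearGroup.mkOfDetNeZero _ hP, ?_⟩
  rw [mul_inv_eq_iff_eq_mul]
  refine ext_entries ?_ ?_ ?_ ?_ <;>
    simp only [Matrix.GeneralLinearGroup.coe_mul, companion, coe_mkOfDetNeZero, Matrix.mul_apply,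
      Fin.sum_univ_two, Matrix.of_apply, Matrix.cons_val', Matrix.cons_val_zero,
      Matrix.cons_val_one, Matrix.cons_val_fin_one, ← h1, ← h2] <;> ring

/-- A non-scalar invertible matrix is conjugate to its companion matrix. -/
theorem isConj_companion {g : GL (Fin 2) F} (hg : ¬ ∃ x, g = c₁ x) :
    IsConj (companion (cls g)) g := by
  rw [exists_eq_c₁_iff] at hg
  -- If both basis vectors and their sum are eigenvectors, the matrix is scalar; so one of the three
  -- is cyclic.
  by_cases h10 : g 1 0 = 0
  · by_cases h01 : g 0 1 = 0
    · refine isConj_companion_aux g 1 1 fun h => hg ⟨h01, h10, ?_⟩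
      linear_combination -h + h10 - h01
    · exact isConj_companion_aux g 0 1 fun h => h01 (by linear_combination -h)
  · exact isConj_companion_aux g 1 0 fun h => h10 (by linear_combination h)

theorem isConj_of_cls_eq {g h : GL (Fin 2) F} (hg : ¬ ∃ x, g = c₁ x) (hh : ¬ ∃ x, h = c₁ x)
    (e : cls g = cls h) : IsConj g h :=
  (isConj_companion hg).symm.trans (e ▸ isConj_companion hh)

theorem companion_not_scalar (p : F × Fˣ) : ¬ ∃ x, companion p = c₁ x := by
  rw [exists_eq_c₁_iff]
  simp [companion]

theorem c₂_not_scalar (x : Fˣ) : ¬ ∃ y, c₂ x = c₁ y := by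
  rw [exists_eq_c₁_iff]
  simp [coe_c₂]

theorem c₃_not_scalar {x y : Fˣ} (h : x ≠ y) : ¬ ∃ z, c₃ x y = c₁ z := by
  rw [exists_eq_c₁_iff]
  simpa [coe_c₃] using fun e => h (Units.ext e)

theorem eq_c₁_of_isConj {g : GL (Fin 2) F} {x : Fˣ} (e : IsConj (c₁ x) g) : g = c₁ x := by
  obtain ⟨c, rfl⟩ := isConj_iff.1 e
  rw [mul_inv_eq_iff_eq_mul]
  refine ext_entries ?_ ?_ ?_ ?_ <;>
    simp [coe_c₁, Matrix.mul_apply, mul_comm]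

theorem scalar_iff_of_isConj {g h : GL (Fin 2) F} (e : IsConj g h) :
    (∃ x, g = c₁ x) ↔ ∃ x, h = c₁ x := by
  constructor
  · rintro ⟨x, rfl⟩; exact ⟨x, eq_c₁_of_isConj e⟩
  · rintro ⟨x, rfl⟩; exact ⟨x, eq_c₁_of_isConj e.symm⟩

theorem c₁_injective : Function.Injective (c₁ : Fˣ → GL (Fin 2) F) := fun x y h => by
  have := congrArg (fun g : GL (Fin 2) F => g 0 0) h
  exact Units.ext this

theorem c₁_mul (x y : Fˣ) : c₁ (x * y) = c₁ x * c₁ y := by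
  refine ext_entries ?_ ?_ ?_ ?_ <;>
    simp [coe_c₁, Matrix.mul_apply]

theorem c₁_one : c₁ (1 : Fˣ) = 1 := by
  refine ext_entries ?_ ?_ ?_ ?_ <;> simp [coe_c₁]

theorem c₁_inv (x : Fˣ) : (c₁ x)⁻¹ = c₁ x⁻¹ :=
  inv_eq_of_mul_eq_one_right (by rw [← c₁_mul, mul_inv_cancel, c₁_one])

theorem c₃_mul (x y z w : Fˣ) : c₃ (x * z) (y * w) = c₃ x y * c₃ z w := by
  refine ext_entries ?_ ?_ ?_ ?_ <;>
    simp [coe_c₃, Matrix.mul_apply]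

theorem c₃_inv (x y : Fˣ) : (c₃ x y)⁻¹ = c₃ x⁻¹ y⁻¹ :=
  inv_eq_of_mul_eq_one_right (by
    rw [← c₃_mul, mul_inv_cancel, mul_inv_cancel, c₃_self, c₁_one])

theorem isConj_c₂_inv (x : Fˣ) : IsConj (c₂ x)⁻¹ (c₂ x⁻¹) := by
  have h : (c₂ x)⁻¹ = Matrix.GeneralLinearGroup.mkOfDetNeZero
      !![(x⁻¹ : F), -(x⁻¹ * x⁻¹); 0, x⁻¹] (by simp) := by
    refine inv_eq_of_mul_eq_one_right (ext_entries ?_ ?_ ?_ ?_) <;>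
    simp [coe_c₂, Matrix.mul_apply]
  refine isConj_of_cls_eq ?_ (c₂_not_scalar _) ?_
  · rw [h, exists_eq_c₁_iff]
    simp
  · rw [cls_c₂, cls_eq_iff, h]
    simp

/-- Matrices commuting with a non-scalar matrix commute with each other. -/
theorem centralizer_commutative {g : GL (Fin 2) F} (hg : ¬ ∃ x, g = c₁ x)
    (a b : Subgroup.centralizer {g}) : a * b = b * a := by
  rw [exists_eq_c₁_iff] at hg
  obtain ⟨a, ha⟩ := a
  obtain ⟨b, hb⟩ := b
  rw [Subgroup.mem_centralizer_singleton_iff] at ha hb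
  refine Subtype.ext ?_
  -- Commuting with `g` means that the triple (c₀₁, c₁₀, c₀₀ − c₁₁) is proportional to the triple of
  -- `g`, which is nonzero as `g` is not scalar. Two such triples are proportional to each other
  -- (`k1`, `k2`, `k3`), which is commutation.
  have entries : ∀ c : GL (Fin 2) F, c * g = g * c → g 0 1 * c 1 0 = c 0 1 * g 1 0 ∧
      (g 0 0 - g 1 1) * c 0 1 = (c 0 0 - c 1 1) * g 0 1 ∧
      (g 0 0 - g 1 1) * c 1 0 = (c 0 0 - c 1 1) * g 1 0 := fun c hc => by
    have e : ∀ i j, (c * g) i j = (g * c) i j := fun i j => by rw [hc]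
    simp only [Matrix.GeneralLinearGroup.coe_mul, Matrix.mul_apply, Fin.sum_univ_two] at e
    have e00 := e 0 0
    have e01 := e 0 1
    have e10 := e 1 0
    refine ⟨?_, ?_, ?_⟩
    · linear_combination -e00
    · linear_combination -e01
    · linear_combination e10
  obtain ⟨a1, a2, a3⟩ := entries a ha
  obtain ⟨b1, b2, b3⟩ := entries b hb
  have k1 : a 0 1 * b 1 0 = b 0 1 * a 1 0 := by
    by_cases h01 : g 0 1 = 0
    · by_cases h10 : g 1 0 = 0
      · have h : g 0 0 - g 1 1 ≠ 0 := fun h => hg ⟨h01, h10, sub_eq_zero.1 h⟩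
        rw [h01, mul_zero] at a2 b2
        rw [(mul_eq_zero.1 a2).resolve_left h, (mul_eq_zero.1 b2).resolve_left h]
        ring
      · refine mul_right_cancel₀ h10 ?_
        linear_combination -b 1 0 * a1 + a 1 0 * b1
    · refine mul_left_cancel₀ h01 ?_
      linear_combination a 0 1 * b1 - b 0 1 * a1
  have k2 : (a 0 0 - a 1 1) * b 0 1 = (b 0 0 - b 1 1) * a 0 1 := by
    by_cases h : g 0 0 - g 1 1 = 0
    · rw [h, zero_mul] at a2 b2 a3 b3
      by_cases h01 : g 0 1 = 0
      · have h10 : g 1 0 ≠ 0 := fun h10 => hg ⟨h01, h10, sub_eq_zero.1 h⟩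
        rw [(mul_eq_zero.1 a3.symm).resolve_right h10, (mul_eq_zero.1 b3.symm).resolve_right h10]
        ring
      · rw [(mul_eq_zero.1 a2.symm).resolve_right h01, (mul_eq_zero.1 b2.symm).resolve_right h01]
        ring
    · refine mul_left_cancel₀ h ?_
      linear_combination (a 0 0 - a 1 1) * b2 - (b 0 0 - b 1 1) * a2
  have k3 : (a 0 0 - a 1 1) * b 1 0 = (b 0 0 - b 1 1) * a 1 0 := by
    by_cases h : g 0 0 - g 1 1 = 0
    · rw [h, zero_mul] at a2 b2 a3 b3
      by_cases h01 : g 0 1 = 0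
      · have h10 : g 1 0 ≠ 0 := fun h10 => hg ⟨h01, h10, sub_eq_zero.1 h⟩
        rw [(mul_eq_zero.1 a3.symm).resolve_right h10, (mul_eq_zero.1 b3.symm).resolve_right h10]
        ring
      · rw [(mul_eq_zero.1 a2.symm).resolve_right h01, (mul_eq_zero.1 b2.symm).resolve_right h01]
        ring
    · refine mul_left_cancel₀ h ?_
      linear_combination (a 0 0 - a 1 1) * b3 - (b 0 0 - b 1 1) * a3
  change a * b = b * a
  refine ext_entries ?_ ?_ ?_ ?_ <;>
    simp only [Matrix.GeneralLinearGroup.coe_mul, Matrix.mul_apply, Fin.sum_univ_two]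
  · linear_combination k1
  · linear_combination k2
  · linear_combination -k3
  · linear_combination -k1

end Companion

set_option linter.unusedSectionVars false

/-! ### Push-forward of functions -/

section Push

variable {ι T : Type*} [Fintype ι] [DecidableEq T]

/-- Summation over the fibres of a map. -/
def push (p : ι → T) (u : ι → ℂ) (τ : T) : ℂ := ∑ i, if p i = τ then u i else 0

theorem sum_push_mul [Fintype T] (p : ι → T) (u : ι → ℂ) (m : T → ℂ) :
    ∑ τ, push p u τ * m τ = ∑ i, u i * m (p i) := by
  simp only [push, Finset.sum_mul]
  rw [Finset.sum_comm]
  refine Finset.sum_congr rfl fun i _ => ?_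
  simp [ite_mul]

theorem push_eq_pair [DecidableEq ι] {p : ι → T} {i j : ι} (h : ∀ k, p k = p i ↔ k = i ∨ k = j)
    (u : ι → ℂ) : push p u (p i) = if i = j then u i else u i + u j := by
  rw [push, ← Finset.sum_filter]
  split_ifs with hij
  · rw [show Finset.univ.filter (fun k => p k = p i) = {i} by
      ext k; simp [h, ← hij], Finset.sum_singleton]
  · rw [show Finset.univ.filter (fun k => p k = p i) = {i, j} by
      ext k; simp [h], Finset.sum_pair hij]

theorem push_eq_zero {p : ι → T} {τ : T} (h : ∀ k, p k ≠ τ) (u : ι → ℂ) : push p u τ = 0 :=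
  Finset.sum_eq_zero fun k _ => if_neg (h k)

theorem push_one (p : ι → T) (τ : T) :
    push p 1 τ = ((Finset.univ.filter fun k => p k = τ).card : ℂ) := by
  rw [push, Finset.card_filter]
  push_cast
  rfl

end Push

/-! ### The trace-determinant map on the group and on the two tori -/

section Field

variable {F : Type*} [Field F]

/-- Trace and determinant of a diagonal matrix. -/
def splitCls (p : Fˣ × Fˣ) : F × Fˣ := (p.1 + p.2, p.1 * p.2)

/-- The unordered pair is recovered as the roots of X² − tX + d. -/
theorem splitCls_eq_iff {p r : Fˣ × Fˣ} : splitCls p = splitCls r ↔ p = r ∨ p = r.swap := by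
  obtain ⟨x, y⟩ := p
  obtain ⟨z, w⟩ := r
  simp only [splitCls, Prod.mk.injEq, Prod.swap_prod_mk]
  constructor
  · rintro ⟨h1, h2⟩
    have h2' : (x : F) * y = z * w := by rw [← Units.val_mul, h2, Units.val_mul]
    have h : ((x : F) - z) * (x - w) = 0 := by linear_combination x * h1 - h2'
    rcases mul_eq_zero.1 h with h | h
    · exact Or.inl ⟨Units.ext (sub_eq_zero.1 h), Units.ext (by linear_combination h1 - h)⟩
    · exact Or.inr ⟨Units.ext (sub_eq_zero.1 h), Units.ext (by linear_combination h1 - h)⟩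
  · rintro (⟨rfl, rfl⟩ | ⟨rfl, rfl⟩)
    · exact ⟨rfl, rfl⟩
    · exact ⟨add_comm _ _, mul_comm _ _⟩

variable [Fintype F] [DecidableEq F]

theorem push_splitCls (u : Fˣ × Fˣ → ℂ) (x y : Fˣ) : push splitCls u (splitCls (x, y)) =
    if x = y then u (x, y) else u (x, y) + u (y, x) := by
  rw [push_eq_pair (j := (y, x)) fun k => splitCls_eq_iff]
  refine if_congr ?_ rfl rfl
  simp [eq_comm]

/-- Fix the upper left entry a; the condition becomes b c = a(t − a) − d, with q − 1 solutions if
the right side is nonzero and 2q − 1 if it is zero. The values a of the second kind are the roots of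
X² − tX + d in F, counted by the push-forward. -/
theorem sum_cls_eq (τ : F × Fˣ) : ∑ g : GL (Fin 2) F, (if cls g = τ then (1 : ℂ) else 0) =
    Nat.card F * (Nat.card F - 1) + Nat.card F * push splitCls 1 τ := by
  obtain ⟨t, d⟩ := τ
  have e1 : ∑ g : GL (Fin 2) F, (if cls g = (t, d) then (1 : ℂ) else 0) =
      ∑ a : F, ∑ b : F, ∑ c : F, (if a * (t - a) - b * c = d then (1 : ℂ) else 0) := by
    rw [← Fintype.sum_prod_type', ← Fintype.sum_prod_type', ← Finset.sum_filter,
      ← Finset.sum_filter]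
    refine Finset.sum_bij' (fun g _ => ((g 0 0, g 0 1), g 1 0)) (fun p hp =>
      Matrix.GeneralLinearGroup.mkOfDetNeZero !![p.1.1, p.1.2; p.2, t - p.1.1] ?_) ?_ ?_ ?_ ?_ ?_
    · rw [Matrix.det_fin_two_of, (Finset.mem_filter.1 hp).2]
      exact d.ne_zero
    · intro g hg
      obtain ⟨h1, h2⟩ := cls_eq_iff.1 (Finset.mem_filter.1 hg).2
      refine Finset.mem_filter.2 ⟨Finset.mem_univ _, ?_⟩
      rw [← h1, ← h2]
      simp only
      ring
    · intro p hp
      refine Finset.mem_filter.2 ⟨Finset.mem_univ _, cls_eq_iff.2 ?_⟩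
      simpa [coe_mkOfDetNeZero] using (Finset.mem_filter.1 hp).2
    · intro g hg
      obtain ⟨h1, h2⟩ := cls_eq_iff.1 (Finset.mem_filter.1 hg).2
      refine ext_entries ?_ ?_ ?_ ?_ <;> simp [← h1]
    · intro p hp
      simp
    · intros; rfl
  have e2 : ∀ a b : F, ∑ c : F, (if a * (t - a) - b * c = d then (1 : ℂ) else 0) =
      if b = 0 then (if a * (t - a) = d then (Nat.card F : ℂ) else 0) else 1 := by
    intro a b
    split_ifs with hb h
    · simp [hb, h]
    · simp [hb, h]
    · rw [Finset.sum_eq_single ((a * (t - a) - d) / b)]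
      · rw [if_pos]; field_simp; ring
      · intro c _ hc
        refine if_neg fun h => hc ?_
        rw [← h]; field_simp; ring
      · simp
  have e3 : ∀ a : F, ∑ b : F, ∑ c : F, (if a * (t - a) - b * c = d then (1 : ℂ) else 0) =
      (Nat.card F - 1) + Nat.card F * if a * (t - a) = d then 1 else 0 := by
    intro a
    rw [Finset.sum_congr rfl fun b _ => e2 a b, ← Finset.add_sum_erase _ _ (Finset.mem_univ 0),
      if_pos rfl, Finset.sum_congr rfl fun b hb => if_neg (Finset.ne_of_mem_erase hb)]
    rw [Finset.sum_const, Finset.card_erase_of_mem (Finset.mem_univ _), Finset.card_univ,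
      nsmul_eq_mul, mul_one, Nat.cast_sub Fintype.card_pos, Nat.card_eq_fintype_card]
    push_cast
    split_ifs <;> ring
  have e4 : ∑ a : F, (if a * (t - a) = d then (1 : ℂ) else 0) = push splitCls 1 (t, d) := by
    rw [push, ← Finset.sum_filter, ← Finset.sum_filter]
    refine Finset.sum_bij' (fun a ha => (Units.mk0 a ?_, Units.mk0 (t - a) ?_))
      (fun p _ => (p.1 : F)) ?_ ?_ ?_ ?_ ?_
    · rintro rfl
      have := (Finset.mem_filter.1 ha).2
      rw [zero_mul] at this
      exact d.ne_zero this.symm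
    · intro h
      have := (Finset.mem_filter.1 ha).2
      rw [h, mul_zero] at this
      exact d.ne_zero this.symm
    · intro a ha
      refine Finset.mem_filter.2 ⟨Finset.mem_univ _, Prod.ext ?_ (Units.ext ?_)⟩
      · simp [splitCls]
      · simpa [splitCls] using (Finset.mem_filter.1 ha).2
    · intro p hp
      have h := (Finset.mem_filter.1 hp).2
      simp only [splitCls, Prod.mk.injEq, Units.ext_iff, Units.val_mul] at h
      refine Finset.mem_filter.2 ⟨Finset.mem_univ _, ?_⟩
      rw [← h.1, ← h.2]
      ring
    · intros; rfl
    · intro p hp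
      have h := (Finset.mem_filter.1 hp).2
      simp only [splitCls, Prod.mk.injEq] at h
      refine Prod.ext (Units.ext rfl) (Units.ext ?_)
      simp [← h.1]
    · intros; rfl
  rw [e1, Finset.sum_congr rfl fun a _ => e3 a, Finset.sum_add_distrib, ← Finset.mul_sum, e4,
    Finset.sum_const, Finset.card_univ, nsmul_eq_mul, Nat.card_eq_fintype_card]

variable {E : Type*} [Field E] [Algebra F E]

/-- The norm on units. -/
def nrm : Eˣ →* Fˣ := Units.map (Algebra.norm F)

/-- The inclusion of the units of the base field. -/
def emb : Fˣ →* Eˣ := Units.map (algebraMap F E).toMonoidHom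

omit [Fintype F] [DecidableEq F] in
theorem coe_nrm (l : Eˣ) : ((nrm l : Fˣ) : F) = Algebra.norm F (l : E) := rfl

omit [Fintype F] [DecidableEq F] in
theorem coe_emb (x : Fˣ) : ((emb x : Eˣ) : E) = algebraMap F E x := rfl

omit [Fintype F] [DecidableEq F] in
theorem emb_injective : Function.Injective (emb : Fˣ → Eˣ) := fun _ _ h =>
  Units.ext ((algebraMap F E).injective (congrArg Units.val h))

variable (F) in
/-- Trace and norm of an element of the extension. -/
def extCls (l : Eˣ) : F × Fˣ := (Algebra.trace F E l, nrm l)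

omit [Fintype F] [DecidableEq F] in
theorem c₄_eq_companion (l : Eˣ) : c₄ l = companion (extCls F l) := rfl

omit [Fintype F] [DecidableEq F] in
theorem extCls_emb (hE : Module.finrank F E = 2) (x : Fˣ) :
    extCls F (emb x : Eˣ) = splitCls (x, x) := by
  refine Prod.ext ?_ (Units.ext ?_)
  · simp only [extCls, splitCls, coe_emb]
    rw [Algebra.trace_algebraMap, hE, two_nsmul]
  · simp only [extCls, splitCls, coe_nrm, coe_emb]
    rw [Algebra.norm_algebraMap, hE, pow_two, Units.val_mul]

variable [Finite E]

omit [Fintype F] [DecidableEq F] in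
-- The conjugation of E over F is the Frobenius map l ↦ l^q.
theorem trace_eq (hE : Module.finrank F E = 2) (l : Eˣ) :
    algebraMap F E (extCls F l).1 = l + (l ^ Nat.card F : Eˣ) := by
  have h := FiniteField.algebraMap_trace_eq_sum_pow F E (l : E)
  rw [hE, Finset.sum_range_succ, Finset.sum_range_one, pow_zero, pow_one, pow_one] at h
  rw [Units.val_pow_eq_pow_val]
  exact h

omit [Fintype F] [DecidableEq F] in
theorem emb_nrm (hE : Module.finrank F E = 2) (l : Eˣ) :
    emb (nrm l : Fˣ) = l * l ^ Nat.card F := by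
  have h := FiniteField.algebraMap_norm_eq_prod_pow F E (l : E)
  rw [hE, Finset.prod_range_succ, Finset.prod_range_one, pow_zero, pow_one, pow_one] at h
  refine Units.ext ?_
  rw [Units.val_mul, Units.val_pow_eq_pow_val]
  exact h

omit [DecidableEq F] [Finite E] in
theorem emb_pow_card (x : Fˣ) : (emb x : Eˣ) ^ Nat.card F = emb x := by
  rw [← map_pow, Nat.card_eq_fintype_card]
  exact congrArg emb (Units.ext (by rw [Units.val_pow_eq_pow_val, FiniteField.pow_card]))

omit [DecidableEq F] in
theorem card_ext (hE : Module.finrank F E = 2) : Nat.card E = Nat.card F ^ 2 := by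
  have := Fintype.ofFinite E
  rw [Nat.card_eq_fintype_card, Nat.card_eq_fintype_card, Module.card_eq_pow_finrank (K := F), hE]

omit [DecidableEq F] in
theorem pow_card_pow_card (hE : Module.finrank F E = 2) (l : Eˣ) :
    (l ^ Nat.card F) ^ Nat.card F = l := by
  have := Fintype.ofFinite E
  rw [← pow_mul, ← pow_two, ← card_ext hE, Nat.card_eq_fintype_card]
  exact Units.ext (by rw [Units.val_pow_eq_pow_val, FiniteField.pow_card])

omit [DecidableEq F] in
theorem extCls_pow_card (hE : Module.finrank F E = 2) (l : Eˣ) :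
    extCls F (l ^ Nat.card F) = extCls F l := by
  refine Prod.ext ((algebraMap F E).injective ?_) (emb_injective (E := E) ?_)
  · rw [trace_eq hE, trace_eq hE, pow_card_pow_card hE, add_comm]
  · simp only [extCls]
    rw [emb_nrm hE, emb_nrm hE, pow_card_pow_card hE, mul_comm]

omit [DecidableEq F] in
theorem extCls_eq_iff (hE : Module.finrank F E = 2) {k l : Eˣ} :
    extCls F k = extCls F l ↔ k = l ∨ k = l ^ Nat.card F := by
  constructor
  · intro h
    have h1 := congrArg (fun τ : F × Fˣ => algebraMap F E τ.1) h
    have h2 := congrArg (fun τ : F × Fˣ => ((emb τ.2 : Eˣ) : E)) h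
    simp only [trace_eq hE] at h1
    simp only [extCls, emb_nrm hE, Units.val_mul] at h2
    have : ((k : E) - l) * (k - (l ^ Nat.card F : Eˣ)) = 0 := by
      linear_combination (k : E) * h1 - h2
    refine (mul_eq_zero.1 this).imp (fun h => Units.ext (sub_eq_zero.1 h))
      fun h => Units.ext (sub_eq_zero.1 h)
  · rintro (rfl | rfl)
    · rfl
    · exact extCls_pow_card hE l

omit [DecidableEq F] in
-- Equality makes l a root of (X − x)(X − y), so l is x or y. Then l lies in F, its trace and norm
-- are those of a double root, and x = y.
theorem splitCls_eq_extCls_iff (hE : Module.finrank F E = 2) {p : Fˣ × Fˣ} {l : Eˣ} :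
    splitCls p = extCls F l ↔ p.1 = p.2 ∧ l = emb p.1 := by
  obtain ⟨x, y⟩ := p
  constructor
  · intro h
    have key : ∀ x y : Fˣ, splitCls (x, y) = extCls F l → l = emb x → x = y := by
      rintro x y h rfl
      rw [extCls_emb hE, splitCls_eq_iff] at h
      rcases h with h | h
      · exact (Prod.mk.inj h).2.symm
      · exact (Prod.mk.inj h).2.symm
    have h1 := congrArg (fun τ : F × Fˣ => algebraMap F E τ.1) h
    have h2 := congrArg (fun τ : F × Fˣ => ((emb τ.2 : Eˣ) : E)) h
    simp only [trace_eq hE] at h1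
    simp only [extCls, emb_nrm hE, Units.val_mul] at h2
    simp only [splitCls, map_add] at h1
    simp only [splitCls, map_mul, Units.val_mul, coe_emb] at h2
    have : ((l : E) - algebraMap F E x) * (l - algebraMap F E y) = 0 := by
      linear_combination -(l : E) * h1 + h2
    rcases mul_eq_zero.1 this with h' | h'
    · have hl : l = emb x := Units.ext (sub_eq_zero.1 h')
      exact ⟨key x y h hl, hl⟩
    · have hl : l = emb y := Units.ext (sub_eq_zero.1 h')
      have e : y = x := key y x (by rw [← h, splitCls_eq_iff]; exact Or.inr rfl) hl
      exact ⟨e.symm, e ▸ hl⟩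
  · rintro ⟨h1, h2⟩
    simp only at h1 h2
    rw [h2, extCls_emb hE, h1]

end Field

/-! ### Counting fibres, and summation over the group -/

section Fibres

variable {F : Type*} [Field F] [Fintype F] [DecidableEq F]
variable {E : Type*} [Field E] [Algebra F E] [Fintype E] [DecidableEq E]

omit [DecidableEq F] in
variable (F) in
theorem card_units_cast : (Nat.card Fˣ : ℂ) = Nat.card F - 1 := by
  rw [Nat.card_units, Nat.cast_sub Nat.card_pos, Nat.cast_one]

omit [DecidableEq F] [DecidableEq E] in
theorem card_ext_units (hE : Module.finrank F E = 2) :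
    (Nat.card Eˣ : ℂ) = (Nat.card F : ℂ) ^ 2 - 1 := by
  rw [Nat.card_units, Nat.cast_sub Nat.card_pos, Nat.cast_one, card_ext hE, Nat.cast_pow]

/-- A polynomial `X² - t X + d` has two roots, in the base field or in the extension. -/
theorem push_add_push (hE : Module.finrank F E = 2) (τ : F × Fˣ) :
    push splitCls 1 τ + push (extCls F (E := E)) 1 τ = 2 := by
  have key : ∀ τ : F × Fˣ, (Finset.univ.filter fun p => splitCls p = τ).card +
      (Finset.univ.filter fun l : Eˣ => extCls F l = τ).card ≤ 2 := by
    intro τ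
    by_cases h : ∃ p, splitCls p = τ
    · obtain ⟨⟨x, y⟩, rfl⟩ := h
      by_cases hxy : x = y
      · subst hxy
        have h1 : Finset.univ.filter (fun p => splitCls p = splitCls (x, x)) ⊆ {(x, x)} := by
          intro p hp
          rw [Finset.mem_filter, splitCls_eq_iff, Prod.swap_prod_mk, or_self] at hp
          exact Finset.mem_singleton.2 hp.2
        have h2 : Finset.univ.filter (fun l : Eˣ => extCls F l = splitCls (x, x)) ⊆ {emb x} := by
          intro l hl
          rw [Finset.mem_filter, eq_comm, splitCls_eq_extCls_iff hE] at hl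
          exact Finset.mem_singleton.2 hl.2.2
        exact add_le_add (Finset.card_le_card h1) (Finset.card_le_card h2)
      · have h1 : Finset.univ.filter (fun p => splitCls p = splitCls (x, y)) ⊆
            {(x, y), (y, x)} := by
          intro p hp
          rw [Finset.mem_filter, splitCls_eq_iff, Prod.swap_prod_mk] at hp
          simpa using hp.2
        have h2 : Finset.univ.filter (fun l : Eˣ => extCls F l = splitCls (x, y)) = ∅ := by
          refine Finset.filter_eq_empty_iff.2 fun l _ hl => hxy ?_
          exact ((splitCls_eq_extCls_iff hE).1 hl.symm).1
        rw [h2, Finset.card_empty, add_zero]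
        exact (Finset.card_le_card h1).trans Finset.card_le_two
    · have h1 : Finset.univ.filter (fun p => splitCls p = τ) = ∅ :=
        Finset.filter_eq_empty_iff.2 fun p _ hp => h ⟨p, hp⟩
      rw [h1, Finset.card_empty, zero_add]
      by_cases h' : ∃ l : Eˣ, extCls F l = τ
      · obtain ⟨l, rfl⟩ := h'
        have h2 : Finset.univ.filter (fun k : Eˣ => extCls F k = extCls F l) ⊆
            {l, l ^ Nat.card F} := by
          intro k hk
          rw [Finset.mem_filter, extCls_eq_iff hE] at hk
          simpa using hk.2
        exact (Finset.card_le_card h2).trans Finset.card_le_two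
      · rw [Finset.filter_eq_empty_iff.2 fun l _ hl => h' ⟨l, hl⟩, Finset.card_empty]
        exact zero_le_two
  -- Each fibre count is at most 2, and the total (q − 1)² + (q² − 1) equals 2q(q − 1), twice the
  -- number of τ. So equality holds for every τ.
  have total : ∑ τ : F × Fˣ, ((Finset.univ.filter fun p => splitCls p = τ).card +
      (Finset.univ.filter fun l : Eˣ => extCls F l = τ).card) = ∑ τ : F × Fˣ, 2 := by
    rw [Finset.sum_add_distrib,
      ← Finset.card_eq_sum_card_fiberwise (f := splitCls) 
        fun _ _ => Finset.mem_coe.2 (Finset.mem_univ _),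
      ← Finset.card_eq_sum_card_fiberwise (f := extCls F (E := E)) 
        fun _ _ => Finset.mem_coe.2 (Finset.mem_univ _),
      Finset.sum_const, smul_eq_mul, Finset.card_univ, Finset.card_univ, Finset.card_univ,
      ← Nat.card_eq_fintype_card, ← Nat.card_eq_fintype_card, ← Nat.card_eq_fintype_card,
      Nat.card_prod, Nat.card_prod, ← Nat.cast_inj (R := ℂ)]
    push_cast
    rw [card_units_cast F, card_ext_units hE]
    ring
  have := (Finset.sum_eq_sum_iff_of_le fun τ _ => key τ).1 total τ (Finset.mem_univ _)
  rw [push_one, push_one]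
  exact_mod_cast this

theorem push_splitCls_emb (hE : Module.finrank F E = 2) (u : Fˣ × Fˣ → ℂ) (x : Fˣ) :
    push splitCls u (extCls F (emb x : Eˣ)) = u (x, x) := by
  rw [extCls_emb hE, push_splitCls, if_pos rfl]

theorem push_splitCls_extCls (hE : Module.finrank F E = 2) (u : Fˣ × Fˣ → ℂ) {l : Eˣ}
    (hl : l ∉ Set.range (emb : Fˣ → Eˣ)) : push splitCls u (extCls F l) = 0 :=
  push_eq_zero (fun p hp => hl ⟨p.1, ((splitCls_eq_extCls_iff hE).1 hp).2.symm⟩) u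

omit [Fintype E] [DecidableEq E] in
-- A Frobenius-fixed l outside F would have a fibre with one element and no split pair, against the
-- total of two.
theorem pow_card_eq_iff [Finite E] (hE : Module.finrank F E = 2) (l : Eˣ) :
    l ^ Nat.card F = l ↔ l ∈ Set.range (emb : Fˣ → Eˣ) := by
  classical
  have := Fintype.ofFinite E
  constructor
  · intro h
    by_contra hl
    have h1 := push_add_push hE (extCls F l)
    rw [push_splitCls_extCls hE _ hl, push_eq_pair fun k => extCls_eq_iff hE, if_pos h.symm] at h1
    norm_num at h1
  · rintro ⟨x, rfl⟩
    exact emb_pow_card x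

theorem push_extCls (hE : Module.finrank F E = 2) (v : Eˣ → ℂ) {l : Eˣ}
    (hl : l ∉ Set.range (emb : Fˣ → Eˣ)) :
    push (extCls F) v (extCls F l) = v l + v (l ^ Nat.card F) := by
  rw [push_eq_pair fun k => extCls_eq_iff hE, if_neg]
  rwa [eq_comm, pow_card_eq_iff hE]

theorem push_extCls_emb (hE : Module.finrank F E = 2) (v : Eˣ → ℂ) (x : Fˣ) :
    push (extCls F) v (extCls F (emb x : Eˣ)) = v (emb x) := by
  rw [push_eq_pair fun k => extCls_eq_iff hE, if_pos (emb_pow_card x).symm]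

theorem push_extCls_splitCls (hE : Module.finrank F E = 2) (v : Eˣ → ℂ) (x y : Fˣ) :
    push (extCls F) v (splitCls (x, y)) = if x = y then v (emb x) else 0 := by
  split_ifs with h
  · rw [← h, ← extCls_emb hE, push_extCls_emb hE]
  · exact push_eq_zero (fun l hl => h ((splitCls_eq_extCls_iff hE).1 hl.symm).1) v

theorem sum_split_ext (u : Fˣ × Fˣ → ℂ) : ∑ p : Fˣ × Fˣ, (if p.1 = p.2 then u p else 0) =
    ∑ x, u (x, x) := by
  rw [Fintype.sum_prod_type]
  simp

theorem sum_range_emb (v : Eˣ → ℂ) [DecidablePred (· ∈ Set.range (emb : Fˣ → Eˣ))] :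
    ∑ l : Eˣ, (if l ∈ Set.range (emb : Fˣ → Eˣ) then v l else 0) = ∑ x : Fˣ, v (emb x) := by
  rw [← Finset.sum_filter, ← Finset.sum_image (s := Finset.univ) (g := emb) (f := v)
    fun _ _ _ _ h => emb_injective h]
  refine Finset.sum_congr ?_ fun _ _ => rfl
  ext l
  simp

/-- Summation over the group of a function of trace and determinant. -/
theorem sum_comp_cls (k : F × Fˣ → ℂ) : ∑ g : GL (Fin 2) F, k (cls g) =
    ∑ τ, (Nat.card F * (Nat.card F - 1) + Nat.card F * push splitCls 1 τ) * k τ := by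
  rw [← Finset.sum_congr rfl fun τ _ => congrArg (· * k τ) (sum_cls_eq τ)]
  simp only [Finset.sum_mul]
  rw [Finset.sum_comm]
  refine Finset.sum_congr rfl fun g _ => ?_
  simp [ite_mul]

/-- Above a pair x ≠ y lie q(q − 1) + 2q = q(q + 1) matrices. On the diagonal there are q², that is
q(q + 1) − q, which accounts for the second sum. -/
theorem sum_push_splitCls (u : Fˣ × Fˣ → ℂ) (m : F × Fˣ → ℂ) :
    ∑ g : GL (Fin 2) F, push splitCls u (cls g) * m (cls g) =
      Nat.card F * (Nat.card F + 1) * ∑ p, u p * m (splitCls p) -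
        Nat.card F * ∑ x, u (x, x) * m (splitCls (x, x)) := by
  rw [sum_comp_cls fun τ => push splitCls u τ * m τ]
  have : ∀ τ, (Nat.card F * (Nat.card F - 1) + Nat.card F * push splitCls 1 τ) *
      (push splitCls u τ * m τ) = push splitCls u τ * ((Nat.card F * (Nat.card F - 1) +
        Nat.card F * push splitCls 1 τ) * m τ) := fun τ => by ring
  rw [Finset.sum_congr rfl fun τ _ => this τ, sum_push_mul,
    ← sum_split_ext fun p => u p * m (splitCls p), Finset.mul_sum, Finset.mul_sum,
    ← Finset.sum_sub_distrib]
  refine Finset.sum_congr rfl fun p _ => ?_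
  rw [← Prod.mk.eta (p := p), push_splitCls]
  split_ifs <;> simp only [Pi.one_apply] <;> ring

/-- Here the fibre has q(q − 1) matrices for l outside F and q more for l in F. -/
theorem sum_push_extCls (hE : Module.finrank F E = 2) (v : Eˣ → ℂ) (m : F × Fˣ → ℂ) :
    ∑ g : GL (Fin 2) F, push (extCls F) v (cls g) * m (cls g) =
      Nat.card F * (Nat.card F - 1) * ∑ l, v l * m (extCls F l) +
        Nat.card F * ∑ x, v (emb x) * m (splitCls (x, x)) := by
  classical
  rw [sum_comp_cls fun τ => push (extCls F) v τ * m τ]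
  have : ∀ τ, (Nat.card F * (Nat.card F - 1) + Nat.card F * push splitCls 1 τ) *
      (push (extCls F) v τ * m τ) = push (extCls F) v τ * ((Nat.card F * (Nat.card F - 1) +
        Nat.card F * push splitCls 1 τ) * m τ) := fun τ => by ring
  rw [Finset.sum_congr rfl fun τ _ => this τ, sum_push_mul]
  simp only [← extCls_emb (E := E) hE]
  rw [← sum_range_emb (F := F) fun l => v l * m (extCls F l), Finset.mul_sum, Finset.mul_sum,
    ← Finset.sum_add_distrib]
  refine Finset.sum_congr rfl fun l _ => ?_
  split_ifs with h
  · obtain ⟨x, rfl⟩ := h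
    rw [push_splitCls_emb hE, Pi.one_apply]
    ring
  · rw [push_splitCls_extCls hE _ h]
    ring

end Fibres

/-! ### Class functions coming from the two tori -/

section ClassFunctions

variable {F : Type*} [Field F]

open scoped Classical in
/-- The indicator function of the scalar matrices. -/
def scalarInd (g : GL (Fin 2) F) : ℂ := if ∃ x, g = c₁ x then 1 else 0

theorem scalarInd_c₁ (x : Fˣ) : scalarInd (c₁ x) = 1 := if_pos ⟨x, rfl⟩

theorem scalarInd_of_not {g : GL (Fin 2) F} (h : ¬ ∃ x, g = c₁ x) : scalarInd g = 0 := if_neg h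

theorem scalarInd_eq_of_isConj {g h : GL (Fin 2) F} (e : IsConj g h) :
    scalarInd g = scalarInd h := by
  unfold scalarInd
  rw [scalar_iff_of_isConj e]

theorem cls_c₁_eq (x : Fˣ) : cls (c₁ x) = splitCls (x, x) := cls_c₁ x

theorem cls_c₂_eq (x : Fˣ) : cls (c₂ x) = splitCls (x, x) := cls_c₂ x

theorem cls_c₃_eq (x y : Fˣ) : cls (c₃ x y) = splitCls (x, y) := cls_c₃ x y

theorem isConj_companion_c₂ (x : Fˣ) : IsConj (companion (splitCls (x, x))) (c₂ x) := by
  rw [← cls_c₂_eq]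
  exact isConj_companion (c₂_not_scalar x)

theorem isConj_companion_c₃ {x y : Fˣ} (h : x ≠ y) :
    IsConj (companion (splitCls (x, y))) (c₃ x y) := by
  rw [← cls_c₃_eq]
  exact isConj_companion (c₃_not_scalar h)

theorem isConj_inv_inv {G : Type*} [Group G] {g h : G} (e : IsConj g h) : IsConj g⁻¹ h⁻¹ := by
  obtain ⟨c, rfl⟩ := isConj_iff.1 e
  exact isConj_iff.2 ⟨c, by group⟩

variable [Fintype F] [DecidableEq F]

theorem sum_scalarInd_mul (f : GL (Fin 2) F → ℂ) : ∑ g, scalarInd g * f g = ∑ x, f (c₁ x) := by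
  classical
  simp only [scalarInd, ite_mul, one_mul, zero_mul]
  rw [← Finset.sum_filter, ← Finset.sum_image (s := Finset.univ) (g := c₁) (f := f)
    fun _ _ _ _ h => c₁_injective h]
  refine Finset.sum_congr ?_ fun _ _ => rfl
  ext g
  simp [eq_comm]

/-- Off the scalars `g` may be replaced by its companion matrix, which leaves a sum over trace and
determinant. The last sum corrects the scalars, for which the companion matrix is conjugate to c₂(x)
instead of c₁(x). -/
theorem sum_cls_mul (ε : ℂ) (k : F × Fˣ → ℂ) {h : GL (Fin 2) F → ℂ}
    (hh : ∀ a b, IsConj a b → h a = h b) :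
    ∑ g, (ε + Nat.card F * scalarInd g) * k (cls g) * h g⁻¹ =
      ε * ∑ g : GL (Fin 2) F, k (cls g) * h (companion (cls g))⁻¹ +
        ∑ x, k (splitCls (x, x)) * ((ε + Nat.card F) * h (c₁ x)⁻¹ - ε * h (c₂ x)⁻¹) := by
  have e1 : ∑ x, k (splitCls (x, x)) * ((ε + Nat.card F) * h (c₁ x)⁻¹ - ε * h (c₂ x)⁻¹) =
      ∑ g, scalarInd g * (k (cls g) * ((ε + Nat.card F) * h g⁻¹ -
        ε * h (companion (cls g))⁻¹)) := by
    rw [sum_scalarInd_mul]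
    refine Finset.sum_congr rfl fun x _ => ?_
    rw [cls_c₁_eq, hh _ _ (isConj_inv_inv (isConj_companion_c₂ x))]
  rw [e1, Finset.mul_sum, ← Finset.sum_add_distrib]
  refine Finset.sum_congr rfl fun g _ => ?_
  by_cases hg : ∃ x, g = c₁ x
  · obtain ⟨x, rfl⟩ := hg
    rw [scalarInd_c₁]
    ring
  · rw [scalarInd_of_not hg, hh _ _ (isConj_inv_inv (isConj_companion hg))]
    ring

/-- The class function attached to a function on the split torus; on a character it is the
induced character. -/
def splitFun (u : Fˣ × Fˣ → ℂ) (g : GL (Fin 2) F) : ℂ :=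
  (1 + Nat.card F * scalarInd g) * push splitCls u (cls g)

theorem splitFun_eq_of_isConj (u : Fˣ × Fˣ → ℂ) {g h : GL (Fin 2) F} (e : IsConj g h) :
    splitFun u g = splitFun u h := by
  rw [splitFun, splitFun, scalarInd_eq_of_isConj e, cls_eq_of_isConj e]

theorem splitFun_c₁ (u : Fˣ × Fˣ → ℂ) (x : Fˣ) :
    splitFun u (c₁ x) = (Nat.card F + 1) * u (x, x) := by
  rw [splitFun, scalarInd_c₁, cls_c₁_eq, push_splitCls, if_pos rfl]
  ring

theorem splitFun_c₂ (u : Fˣ × Fˣ → ℂ) (x : Fˣ) : splitFun u (c₂ x) = u (x, x) := by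
  rw [splitFun, scalarInd_of_not (c₂_not_scalar x), cls_c₂_eq, push_splitCls, if_pos rfl]
  ring

theorem splitFun_c₃ (u : Fˣ × Fˣ → ℂ) {x y : Fˣ} (h : x ≠ y) :
    splitFun u (c₃ x y) = u (x, y) + u (y, x) := by
  rw [splitFun, scalarInd_of_not (c₃_not_scalar h), cls_c₃_eq, push_splitCls, if_neg h]
  ring

/-- The pairing with an induced character in terms of restrictions to subgroups. -/
theorem sum_splitFun_mul (u : Fˣ × Fˣ → ℂ) {h : GL (Fin 2) F → ℂ}
    (hh : ∀ a b, IsConj a b → h a = h b) :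
    ∑ g, splitFun u g * h g⁻¹ =
      Nat.card F * (Nat.card F + 1) * ∑ p, u p * h (c₃ p.1 p.2)⁻¹ -
        (Nat.card F ^ 2 - 1) * ∑ x, u (x, x) * (h (c₁ x)⁻¹ - h (c₂ x)⁻¹) := by
  -- On the diagonal of the torus c₃(x, x) is scalar while the companion matrix is conjugate to
  -- c₂(x); the difference joins the second sum.
  have e1 : ∑ p, u p * h (c₃ p.1 p.2)⁻¹ = ∑ p, u p * h (companion (splitCls p))⁻¹ +
      ∑ x, u (x, x) * (h (c₁ x)⁻¹ - h (c₂ x)⁻¹) := by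
    have := sum_split_ext fun p : Fˣ × Fˣ => u p * (h (c₁ p.1)⁻¹ - h (c₂ p.1)⁻¹)
    simp only at this
    rw [← this, ← Finset.sum_add_distrib]
    refine Finset.sum_congr rfl fun p _ => ?_
    obtain ⟨x, y⟩ := p
    simp only
    split_ifs with hxy
    · subst hxy
      rw [c₃_self, hh _ _ (isConj_inv_inv (isConj_companion_c₂ x))]
      ring
    · rw [hh _ _ (isConj_inv_inv (isConj_companion_c₃ hxy)), add_zero]
  simp only [splitFun]
  rw [sum_cls_mul 1 _ hh, sum_push_splitCls u fun τ => h (companion τ)⁻¹, e1]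
  have e2 : ∀ x, push splitCls u (splitCls (x, x)) *
      ((1 + Nat.card F) * h (c₁ x)⁻¹ - 1 * h (c₂ x)⁻¹) = Nat.card F * (u (x, x) * h (c₂ x)⁻¹) +
        (Nat.card F + 1) * (u (x, x) * (h (c₁ x)⁻¹ - h (c₂ x)⁻¹)) := fun x => by
    rw [push_splitCls, if_pos rfl]
    ring
  rw [Finset.sum_congr rfl fun x _ => e2 x, Finset.sum_add_distrib, ← Finset.mul_sum,
    ← Finset.mul_sum]
  rw [Finset.sum_congr rfl fun x _ => congrArg (u (x, x) * ·)
    (hh _ _ (isConj_inv_inv (isConj_companion_c₂ x)))]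
  ring

variable {E : Type*} [Field E] [Algebra F E]

theorem finite_of_finrank (hE : Module.finrank F E = 2) : Module.Finite F E :=
  Module.finite_of_finrank_pos (by omega)

/-- The embedding of the non-split torus. -/
def extEmb (hE : Module.finrank F E = 2) : Eˣ →* GL (Fin 2) F :=
  haveI := finite_of_finrank hE
  Units.map (Algebra.leftMulMatrix (Module.finBasisOfFinrankEq F E hE)).toMonoidHom

theorem cls_extEmb (hE : Module.finrank F E = 2) (l : Eˣ) : cls (extEmb hE l) = extCls F l := by
  have := finite_of_finrank hE
  refine Prod.ext ?_ (Units.ext ?_)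
  · exact (Algebra.trace_eq_matrix_trace (Module.finBasisOfFinrankEq F E hE) (l : E)).symm
  · exact (Algebra.norm_eq_matrix_det (Module.finBasisOfFinrankEq F E hE) (l : E)).symm

theorem extEmb_emb (hE : Module.finrank F E = 2) (x : Fˣ) : extEmb hE (emb x) = c₁ x := by
  have := finite_of_finrank hE
  have h : ((extEmb hE (emb x) : GL (Fin 2) F) : Matrix (Fin 2) (Fin 2) F) =
      algebraMap F (Matrix (Fin 2) (Fin 2) F) x :=
    AlgHom.commutes (Algebra.leftMulMatrix (Module.finBasisOfFinrankEq F E hE)) (x : F)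
  refine ext_entries ?_ ?_ ?_ ?_ <;> rw [h] <;> simp [coe_c₁, Matrix.algebraMap_matrix_apply]

theorem extEmb_injective (hE : Module.finrank F E = 2) : Function.Injective (extEmb hE) := by
  have := finite_of_finrank hE
  exact fun k l h => Units.ext
    (Algebra.leftMulMatrix_injective (Module.finBasisOfFinrankEq F E hE) (congrArg Units.val h))

theorem extEmb_not_scalar (hE : Module.finrank F E = 2) {l : Eˣ}
    (hl : l ∉ Set.range (emb : Fˣ → Eˣ)) : ¬ ∃ x, extEmb hE l = c₁ x := by
  rintro ⟨x, h⟩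
  rw [← extEmb_emb hE] at h
  exact hl ⟨x, (extEmb_injective hE h).symm⟩

theorem isConj_companion_extEmb (hE : Module.finrank F E = 2) {l : Eˣ}
    (hl : l ∉ Set.range (emb : Fˣ → Eˣ)) : IsConj (companion (extCls F l)) (extEmb hE l) := by
  rw [← cls_extEmb hE]
  exact isConj_companion (extEmb_not_scalar hE hl)

variable [Fintype E] [DecidableEq E]

/-- The class function attached to a function on the non-split torus; on a general character it
is the cuspidal character. -/
def extFun (v : Eˣ → ℂ) (g : GL (Fin 2) F) : ℂ :=
  (-1 + Nat.card F * scalarInd g) * push (extCls F) v (cls g)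

theorem extFun_eq_of_isConj (v : Eˣ → ℂ) {g h : GL (Fin 2) F} (e : IsConj g h) :
    extFun v g = extFun v h := by
  rw [extFun, extFun, scalarInd_eq_of_isConj e, cls_eq_of_isConj e]

theorem extFun_c₁ (hE : Module.finrank F E = 2) (v : Eˣ → ℂ) (x : Fˣ) :
    extFun v (c₁ x) = (Nat.card F - 1) * v (emb x) := by
  rw [extFun, scalarInd_c₁, cls_c₁_eq, push_extCls_splitCls hE, if_pos rfl]
  ring

theorem extFun_c₂ (hE : Module.finrank F E = 2) (v : Eˣ → ℂ) (x : Fˣ) :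
    extFun v (c₂ x) = -v (emb x) := by
  rw [extFun, scalarInd_of_not (c₂_not_scalar x), cls_c₂_eq, push_extCls_splitCls hE, if_pos rfl]
  ring

theorem extFun_extEmb (hE : Module.finrank F E = 2) (v : Eˣ → ℂ) {l : Eˣ}
    (hl : l ∉ Set.range (emb : Fˣ → Eˣ)) :
    extFun v (extEmb hE l) = -(v l + v (l ^ Nat.card F)) := by
  rw [extFun, scalarInd_of_not (extEmb_not_scalar hE hl), cls_extEmb, push_extCls hE v hl]
  ring

theorem sum_extFun_mul (hE : Module.finrank F E = 2) (v : Eˣ → ℂ) {h : GL (Fin 2) F → ℂ}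
    (hh : ∀ a b, IsConj a b → h a = h b) :
    ∑ g, extFun v g * h g⁻¹ =
      -(Nat.card F * (Nat.card F - 1) * ∑ l, v l * h (extEmb hE l)⁻¹) +
        (Nat.card F ^ 2 - 1) * ∑ x, v (emb x) * (h (c₁ x)⁻¹ - h (c₂ x)⁻¹) := by
  classical
  have e1 : ∑ l, v l * h (extEmb hE l)⁻¹ = ∑ l, v l * h (companion (extCls F l))⁻¹ +
      ∑ x : Fˣ, v (emb x) * (h (c₁ x)⁻¹ - h (c₂ x)⁻¹) := by
    have := sum_range_emb (F := F) fun l : Eˣ =>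
      v l * (h (extEmb hE l)⁻¹ - h (companion (extCls F l))⁻¹)
    have e : ∀ x, v (emb x) * (h (c₁ x)⁻¹ - h (c₂ x)⁻¹) = v (emb x) *
        (h (extEmb hE (emb x))⁻¹ - h (companion (extCls F (emb x : Eˣ)))⁻¹) := fun x => by
      rw [extEmb_emb, extCls_emb hE, hh _ _ (isConj_inv_inv (isConj_companion_c₂ x))]
    rw [Finset.sum_congr rfl fun x _ => e x, ← this, ← Finset.sum_add_distrib]
    refine Finset.sum_congr rfl fun l _ => ?_
    split_ifs with hl
    · ring
    · rw [hh _ _ (isConj_inv_inv (isConj_companion_extEmb hE hl)), add_zero]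
  simp only [extFun]
  rw [sum_cls_mul (-1) _ hh, sum_push_extCls hE v fun τ => h (companion τ)⁻¹, e1]
  have e2 : ∀ x, push (extCls F) v (splitCls (x, x)) *
      ((-1 + Nat.card F) * h (c₁ x)⁻¹ - -1 * h (c₂ x)⁻¹) =
        Nat.card F * (v (emb x) * h (c₂ x)⁻¹) +
        (Nat.card F - 1) * (v (emb x) * (h (c₁ x)⁻¹ - h (c₂ x)⁻¹)) := fun x => by
    rw [push_extCls_splitCls hE, if_pos rfl]
    ring
  rw [Finset.sum_congr rfl fun x _ => e2 x, Finset.sum_add_distrib, ← Finset.mul_sum,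
    ← Finset.mul_sum]
  rw [Finset.sum_congr rfl fun x _ => congrArg (v (emb x) * ·)
    (hh _ _ (isConj_inv_inv (isConj_companion_c₂ x)))]
  ring

variable (F) in
theorem card_GL_two : (Nat.card (GL (Fin 2) F) : ℂ) =
    Nat.card F * (Nat.card F - 1) * (Nat.card F ^ 2 - 1) := by
  rw [Matrix.card_GL_field, Fin.prod_univ_two, Nat.card_eq_fintype_card]
  have h : 1 ≤ Fintype.card F := Fintype.card_pos
  simp only [Fin.val_zero, Fin.val_one, pow_zero, pow_one]
  rw [Nat.cast_mul, Nat.cast_sub (Nat.one_le_pow _ _ h), Nat.cast_sub (by nlinarith)]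
  push_cast
  ring

end ClassFunctions

/-! ### Construction of the irreducible characters of GL(2, F) -/

section Multiplicity

theorem exists_nat_multiplicity_inv {G H : Type*} [Group G] [CommGroup H] [Fintype H] (φ : H →* G)
    (ψ : H →* ℂˣ) (π : Irr G) :
    ∃ n : ℕ, ∑ h, (ψ h : ℂ) * π.character (φ h)⁻¹ = Nat.card H * n := by
  obtain ⟨n, hn⟩ := exists_nat_multiplicity (φ.comp (MulEquiv.inv H).toMonoidHom) ψ π
  refine ⟨n, hn ▸ Finset.sum_congr rfl fun h _ => ?_⟩
  simp

variable {F : Type*} [Field F]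

/-- The split torus. -/
def splitEmb : Fˣ × Fˣ →* GL (Fin 2) F where
  toFun p := c₃ p.1 p.2
  map_one' := (c₃_self 1).trans c₁_one
  map_mul' p r := c₃_mul p.1 p.2 r.1 r.2

/-- The centraliser of a unipotent element. -/
def unipEmb : Fˣ × Multiplicative F →* GL (Fin 2) F where
  toFun p := Matrix.GeneralLinearGroup.mkOfDetNeZero
    !![(p.1 : F), p.1 * p.2.toAdd; 0, p.1] (by simp)
  map_one' := by
    refine ext_entries ?_ ?_ ?_ ?_ <;> simp
  map_mul' p r := by
    refine ext_entries ?_ ?_ ?_ ?_ <;> simp [Matrix.mul_apply]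
    ring

theorem unipEmb_one (x : Fˣ) : unipEmb (x, 1) = c₁ x := by
  refine ext_entries ?_ ?_ ?_ ?_ <;> simp [unipEmb, coe_c₁]

theorem isConj_unipEmb (x : Fˣ) {b : Multiplicative F} (hb : b ≠ 1) :
    IsConj (unipEmb (x, b)) (c₂ x) := by
  refine isConj_of_cls_eq ?_ (c₂_not_scalar x) ?_
  · rw [exists_eq_c₁_iff]
    simpa [unipEmb] using hb
  · rw [cls_c₂, cls_eq_iff]
    simp [unipEmb]

/-- A pair of characters as a function on the split torus. -/
def splitChar (α β : Fˣ →* ℂˣ) (p : Fˣ × Fˣ) : ℂ := α p.1 * β p.2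

/-- A character as a complex function. -/
def extChar {A : Type*} [Monoid A] (χ : A →* ℂˣ) (l : A) : ℂ := χ l

variable [Fintype F] [DecidableEq F]

theorem split_multiplicity (α β : Fˣ →* ℂˣ) (π : Irr (GL (Fin 2) F)) :
    ∃ n : ℕ, ∑ p, splitChar α β p * π.character (c₃ p.1 p.2)⁻¹ = (Nat.card F - 1) ^ 2 * n := by
  obtain ⟨n, hn⟩ := exists_nat_multiplicity_inv splitEmb (α.coprod β) π
  refine ⟨n, ?_⟩
  rw [Nat.card_prod, Nat.cast_mul, card_units_cast, ← pow_two] at hn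
  rw [← hn]
  refine Finset.sum_congr rfl fun p _ => ?_
  rw [MonoidHom.coprod_apply, Units.val_mul]
  rfl

theorem unip_multiplicity (α : Fˣ →* ℂˣ) (π : Irr (GL (Fin 2) F)) :
    ∃ n : ℕ, ∑ x, extChar α x * (π.character (c₁ x)⁻¹ - π.character (c₂ x)⁻¹) =
      Nat.card F * (Nat.card F - 1) * n := by
  -- All nontrivial unipotent parts are conjugate, and a nontrivial additive character sums to −1
  -- over the nonzero elements. This produces the difference between the values at c₁(x) and c₂(x).
  obtain ⟨ψ, hψ⟩ := CommGroup.exists_apply_ne_one_of_hasEnoughRootsOfUnity (Multiplicative F) ℂ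
    (a := Multiplicative.ofAdd 1) (by simp)
  have hψ1 : ψ ≠ 1 := fun h => hψ (by rw [h, MonoidHom.one_apply])
  obtain ⟨n, hn⟩ := exists_nat_multiplicity_inv unipEmb (α.coprod ψ) π
  refine ⟨n, ?_⟩
  rw [Nat.card_prod, Nat.cast_mul, card_units_cast, Nat.card_congr Multiplicative.toAdd,
    mul_comm ((Nat.card F : ℂ) - 1)] at hn
  rw [← hn, Fintype.sum_prod_type]
  refine Finset.sum_congr rfl fun x _ => ?_
  have h0 := sum_character_apply ψ
  rw [delta_of_ne hψ1, mul_zero, ← Finset.add_sum_erase _ _ (Finset.mem_univ 1), map_one,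
    Units.val_one] at h0
  rw [← Finset.add_sum_erase _ _ (Finset.mem_univ 1), unipEmb_one]
  have h1 : ∀ b ∈ Finset.univ.erase (1 : Multiplicative F),
      ((α.coprod ψ (x, b) : ℂˣ) : ℂ) * π.character (unipEmb (x, b))⁻¹ =
        (α x * π.character (c₂ x)⁻¹) * ψ b := by
    intro b hb
    rw [π.character_eq_of_isConj (isConj_inv_inv (isConj_unipEmb x (Finset.ne_of_mem_erase hb))),
      MonoidHom.coprod_apply, Units.val_mul]
    ring
  rw [Finset.sum_congr rfl h1, ← Finset.mul_sum, MonoidHom.coprod_apply, map_one, mul_one]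
  unfold extChar
  linear_combination -(α x : ℂ) * π.character (c₂ x)⁻¹ * h0

variable {E : Type*} [Field E] [Algebra F E] [Fintype E] [DecidableEq E]

theorem ext_multiplicity (hE : Module.finrank F E = 2) (χ : Eˣ →* ℂˣ) (π : Irr (GL (Fin 2) F)) :
    ∃ n : ℕ, ∑ l, extChar χ l * π.character (extEmb hE l)⁻¹ = (Nat.card F ^ 2 - 1) * n := by
  obtain ⟨n, hn⟩ := exists_nat_multiplicity_inv (extEmb hE) χ π
  rw [card_ext_units hE] at hn
  exact ⟨n, hn⟩

/-- With a the multiplicity of (α, β) on the torus and w that of αβ extended by a nontrivial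
additive character, both terms carry the factor |G|, and the integer is a − w. -/
theorem splitFun_pairing (α β : Fˣ →* ℂˣ) (π : Irr (GL (Fin 2) F)) :
    ∃ n : ℤ, ∑ g, splitFun (splitChar α β) g * π.character g⁻¹ =
      Nat.card (GL (Fin 2) F) * n := by
  obtain ⟨a, ha⟩ := split_multiplicity α β π
  obtain ⟨w, hw⟩ := unip_multiplicity (α * β) π
  refine ⟨a - w, ?_⟩
  rw [sum_splitFun_mul _ fun _ _ => π.character_eq_of_isConj, ha, card_GL_two]
  have : ∑ x, splitChar α β (x, x) * (π.character (c₁ x)⁻¹ - π.character (c₂ x)⁻¹) =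
      Nat.card F * (Nat.card F - 1) * w := by
    rw [← hw]
    exact Finset.sum_congr rfl fun x _ => by simp [splitChar, extChar]
  rw [this]
  push_cast
  ring

/-- As in the split case with the signs reversed: the integer is w − a. -/
theorem extFun_pairing (hE : Module.finrank F E = 2) (χ : Eˣ →* ℂˣ) (π : Irr (GL (Fin 2) F)) :
    ∃ n : ℤ, ∑ g, extFun (extChar χ) g * π.character g⁻¹ =
      Nat.card (GL (Fin 2) F) * n := by
  obtain ⟨a, ha⟩ := ext_multiplicity hE χ π
  obtain ⟨w, hw⟩ := unip_multiplicity (χ.comp emb) π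
  refine ⟨w - a, ?_⟩
  rw [sum_extFun_mul hE _ fun _ _ => π.character_eq_of_isConj, ha, card_GL_two]
  have : ∑ x, extChar χ (emb x) * (π.character (c₁ x)⁻¹ - π.character (c₂ x)⁻¹) =
      Nat.card F * (Nat.card F - 1) * w := hw
  rw [this]
  push_cast
  ring

/-- A character of the base field composed with the determinant. -/
def detFun (α : Fˣ →* ℂˣ) (g : GL (Fin 2) F) : ℂ := α (Matrix.GeneralLinearGroup.det g)

theorem detFun_eq_of_isConj (α : Fˣ →* ℂˣ) {g h : GL (Fin 2) F} (e : IsConj g h) :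
    detFun α g = detFun α h := congrArg (fun τ : F × Fˣ => ((α τ.2 : ℂˣ) : ℂ)) (cls_eq_of_isConj e)

theorem detFun_eq (α : Fˣ →* ℂˣ) (g : GL (Fin 2) F) : detFun α g = α (cls g).2 := rfl

theorem detFun_inv (α : Fˣ →* ℂˣ) (g : GL (Fin 2) F) : detFun α g * detFun α g⁻¹ = 1 := by
  rw [detFun, detFun, ← Units.val_mul, ← map_mul, ← map_mul, mul_inv_cancel, map_one, map_one,
    Units.val_one]

theorem detFun_pairing (α : Fˣ →* ℂˣ) (π : Irr (GL (Fin 2) F)) :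
    ∃ n : ℤ, ∑ g, detFun α g * π.character g⁻¹ = Nat.card (GL (Fin 2) F) * n := by
  obtain ⟨n, hn⟩ := exists_nat_multiplicity (MonoidHom.id _)
    (α⁻¹.comp Matrix.GeneralLinearGroup.det) π
  refine ⟨n, ?_⟩
  rw [Int.cast_natCast, ← hn]
  refine Fintype.sum_equiv (Equiv.inv _) _ _ fun g => ?_
  simp [detFun]

theorem exists_irr_det (α : Fˣ →* ℂˣ) : ∃ π : Irr (GL (Fin 2) F), π.character = detFun α := by
  refine exists_character_eq (fun g h => ?_) (detFun_pairing α) ?_ one_pos (by simp [detFun])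
  · exact (detFun_eq_of_isConj α (isConj_iff.2 ⟨h, rfl⟩)).symm
  · rw [Finset.sum_congr rfl fun g _ => detFun_inv α g]
    simp [Nat.card_eq_fintype_card]

theorem splitChar_inv (α β : Fˣ →* ℂˣ) (p : Fˣ × Fˣ) :
    splitChar α β p⁻¹ = (splitChar α β p)⁻¹ := by
  simp [splitChar, mul_comm]

theorem splitChar_ne_zero (α β : Fˣ →* ℂˣ) (p : Fˣ × Fˣ) : splitChar α β p ≠ 0 := by
  simp [splitChar]

/-- On the torus the integrand is 1 + (α/β)(x)(α/β)(y)⁻¹, plus q − 1 on the diagonal. The middle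
term sums to zero unless α = β, in which case it adds one more |G|. -/
theorem sum_splitFun_splitFun_inv (α β : Fˣ →* ℂˣ) :
    ∑ g, splitFun (splitChar α β) g * splitFun (splitChar α β) g⁻¹ =
      Nat.card (GL (Fin 2) F) * (1 + delta (α * β⁻¹)) := by
  rw [sum_splitFun_mul _ fun _ _ => splitFun_eq_of_isConj _]
  have e1 : ∀ x, splitChar α β (x, x) * (splitFun (splitChar α β) (c₁ x)⁻¹ -
      splitFun (splitChar α β) (c₂ x)⁻¹) = Nat.card F := fun x => by
    rw [c₁_inv, splitFun_c₁, splitFun_eq_of_isConj _ (isConj_c₂_inv x), splitFun_c₂,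
      ← Prod.inv_mk, splitChar_inv]
    have := splitChar_ne_zero α β (x, x)
    field_simp
    ring
  have e2 : ∀ p : Fˣ × Fˣ, splitChar α β p * splitFun (splitChar α β) (c₃ p.1 p.2)⁻¹ =
      1 + ((α * β⁻¹) p.1 : ℂ) * ((α * β⁻¹) p.2⁻¹ : ℂ) +
        if p.1 = p.2 then (Nat.card F : ℂ) - 1 else 0 := by
    rintro ⟨x, y⟩
    simp only
    have hx := (α x).ne_zero
    have hy := (α y).ne_zero
    have hx' := (β x).ne_zero
    have hy' := (β y).ne_zero
    split_ifs with h
    · subst h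
      rw [c₃_self, c₁_inv, splitFun_c₁]
      simp [splitChar]
      field_simp
      ring
    · rw [c₃_inv, splitFun_c₃ _ (by simpa using h)]
      simp [splitChar]
      field_simp
  rw [Finset.sum_congr rfl fun x _ => e1 x, Finset.sum_congr rfl fun p _ => e2 p,
    Finset.sum_add_distrib, Finset.sum_add_distrib, sum_split_ext fun _ => (Nat.card F : ℂ) - 1,
    Fintype.sum_prod_type
      (f := fun p : Fˣ × Fˣ => ((α * β⁻¹) p.1 : ℂ) * ((α * β⁻¹) p.2⁻¹ : ℂ))]
  simp only [← Finset.mul_sum]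
  rw [← Finset.sum_mul, sum_character_apply, Fintype.sum_equiv (Equiv.inv _)
    (fun y => ((α * β⁻¹) y⁻¹ : ℂ)) (fun y => ((α * β⁻¹) y : ℂ)) fun _ => rfl,
    sum_character_apply]
  simp only [Finset.sum_const, Finset.card_univ, ← Nat.card_eq_fintype_card, nsmul_eq_mul,
    Nat.card_prod, Nat.cast_mul, card_units_cast, card_GL_two]
  have : delta (α * β⁻¹) * delta (α * β⁻¹) = delta (α * β⁻¹) := by
    by_cases h : α * β⁻¹ = 1
    · rw [h, delta_one, one_mul]
    · rw [delta_of_ne h, zero_mul]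
  linear_combination (Nat.card F : ℂ) * (Nat.card F + 1) * (Nat.card F - 1) ^ 2 * this

theorem sum_splitFun_detFun_inv (α : Fˣ →* ℂˣ) :
    ∑ g, splitFun (splitChar α α) g * detFun α g⁻¹ = Nat.card (GL (Fin 2) F) := by
  rw [sum_splitFun_mul _ fun _ _ => detFun_eq_of_isConj _]
  have e0 : ∀ (p : Fˣ × Fˣ) (g : GL (Fin 2) F), cls g = splitCls p →
      splitChar α α p * detFun α g⁻¹ = 1 := fun p g h => by
    have : splitChar α α p = detFun α g := by
      rw [detFun_eq, h, splitCls, splitChar, map_mul, Units.val_mul]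
    rw [this, detFun_inv]
  rw [Finset.sum_congr rfl fun p _ => e0 p _ (cls_c₃_eq p.1 p.2),
    Finset.sum_eq_zero (s := (Finset.univ : Finset Fˣ)) fun x _ => by
      rw [mul_sub, e0 _ _ (cls_c₁_eq x), e0 _ _ (cls_c₂_eq x), sub_self]]
  simp only [Finset.sum_const, Finset.card_univ, ← Nat.card_eq_fintype_card, nsmul_eq_mul,
    Nat.card_prod, Nat.cast_mul, card_units_cast, card_GL_two]
  ring

/-- The Steinberg character twisted by a character of the determinant. -/
def steinbergFun (α : Fˣ →* ℂˣ) (g : GL (Fin 2) F) : ℂ := splitFun (splitChar α α) g - detFun α g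

theorem splitFun_one (α β : Fˣ →* ℂˣ) :
    splitFun (splitChar α β) (1 : GL (Fin 2) F) = Nat.card F + 1 := by
  rw [← c₁_one, splitFun_c₁]
  simp [splitChar]

/-- The function `splitFun` for (α, α) has norm two and contains α ∘ det once, so the difference has
norm 2 − 1 − 1 + 1 = 1; its value at 1 is q. -/
theorem exists_irr_steinberg (α : Fˣ →* ℂˣ) :
    ∃ π : Irr (GL (Fin 2) F), π.character = steinbergFun α := by
  refine exists_character_eq (fun g h => ?_) (fun π => ?_) ?_ (Nat.card_pos (α := F))
    (by rw [steinbergFun, splitFun_one]; simp [detFun])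
  · have e : IsConj (h * g * h⁻¹) g := (isConj_iff.2 ⟨h, rfl⟩ : IsConj g (h * g * h⁻¹)).symm
    rw [steinbergFun, steinbergFun, splitFun_eq_of_isConj _ e, detFun_eq_of_isConj _ e]
  · obtain ⟨a, ha⟩ := splitFun_pairing α α π
    obtain ⟨b, hb⟩ := detFun_pairing α π
    refine ⟨a - b, ?_⟩
    simp only [steinbergFun, sub_mul, Finset.sum_sub_distrib, ha, hb]
    push_cast
    ring
  · have h1 := sum_splitFun_splitFun_inv α α
    have h2 := sum_splitFun_detFun_inv α
    have h3 : ∑ g, detFun α g * splitFun (splitChar α α) g⁻¹ = Nat.card (GL (Fin 2) F) := by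
      rw [← h2]
      exact Fintype.sum_equiv (Equiv.inv _) _ _ fun g => by simp [mul_comm]
    rw [show α * α⁻¹ = 1 from mul_inv_cancel α, delta_one] at h1
    simp only [steinbergFun, sub_mul, mul_sub, Finset.sum_sub_distrib, h1, h2, h3,
      detFun_inv, Finset.sum_const, Finset.card_univ, ← Nat.card_eq_fintype_card, nsmul_eq_mul]
    ring

theorem exists_irr_split {α β : Fˣ →* ℂˣ} (h : α ≠ β) :
    ∃ π : Irr (GL (Fin 2) F), π.character = splitFun (splitChar α β) := by
  refine exists_character_eq (fun g h => ?_) (splitFun_pairing α β) ?_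
    (Nat.succ_pos (Nat.card F)) (by rw [splitFun_one]; push_cast; ring)
  · exact (splitFun_eq_of_isConj _ (isConj_iff.2 ⟨h, rfl⟩)).symm
  · rw [sum_splitFun_splitFun_inv, delta_of_ne fun e => h (mul_inv_eq_one.1 e), add_zero,
      mul_one]

theorem extFun_one (hE : Module.finrank F E = 2) (χ : Eˣ →* ℂˣ) :
    extFun (extChar χ) (1 : GL (Fin 2) F) = Nat.card F - 1 := by
  rw [← c₁_one, extFun_c₁ hE]
  simp [extChar]

/-- On E× the integrand is −(1 + χ(l)χ(l)^(−q)), corrected by q + 1 on F×. The assumption on χ makes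
the nonconstant term sum to zero. -/
theorem sum_extFun_extFun_inv (hE : Module.finrank F E = 2) {χ : Eˣ →* ℂˣ}
    (hχ : χ ^ Nat.card F ≠ χ) :
    ∑ g : GL (Fin 2) F, extFun (extChar χ) g * extFun (extChar χ) g⁻¹ =
      Nat.card (GL (Fin 2) F) := by
  classical
  rw [sum_extFun_mul hE _ fun _ _ => extFun_eq_of_isConj _]
  have e1 : ∀ x : Fˣ, extChar χ (emb x) * (extFun (extChar χ) (c₁ x)⁻¹ -
      extFun (extChar χ) (c₂ x)⁻¹) = Nat.card F := fun x => by
    rw [c₁_inv, extFun_c₁ hE, extFun_eq_of_isConj _ (isConj_c₂_inv x), extFun_c₂ hE, extChar,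
      extChar, map_inv, map_inv, Units.val_inv_eq_inv_val]
    have := (χ (emb x)).ne_zero
    field_simp
    ring
  have e2 : ∀ l : Eˣ, extChar χ l * extFun (extChar χ) (extEmb hE l)⁻¹ =
      -(1 + ((χ * (χ ^ Nat.card F)⁻¹) l : ℂ)) +
        if l ∈ Set.range (emb : Fˣ → Eˣ) then (Nat.card F : ℂ) + 1 else 0 := by
    intro l
    have h0 := (χ l).ne_zero
    split_ifs with h
    · obtain ⟨x, rfl⟩ := h
      rw [extEmb_emb, c₁_inv, extFun_c₁ hE, extChar, extChar, map_inv, map_inv,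
        Units.val_inv_eq_inv_val, MonoidHom.mul_apply, MonoidHom.inv_apply,
        MonoidHom.pow_apply, ← map_pow, emb_pow_card, mul_inv_cancel, Units.val_one]
      field_simp
      ring
    · have hl : l⁻¹ ∉ Set.range (emb : Fˣ → Eˣ) := by
        rintro ⟨x, hx⟩
        exact h ⟨x⁻¹, by rw [map_inv, hx, inv_inv]⟩
      rw [← map_inv, extFun_extEmb hE _ hl]
      simp [extChar]
      field_simp
  have hne : χ * (χ ^ Nat.card F)⁻¹ ≠ 1 := fun h => hχ (mul_inv_eq_one.1 h).symm
  rw [Finset.sum_congr rfl fun x _ => e1 x, Finset.sum_congr rfl fun l _ => e2 l,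
    Finset.sum_add_distrib, Finset.sum_neg_distrib, Finset.sum_add_distrib, sum_character_apply,
    delta_of_ne hne, sum_range_emb (F := F) fun _ : Eˣ => (Nat.card F : ℂ) + 1]
  simp only [Finset.sum_const, Finset.card_univ, ← Nat.card_eq_fintype_card, nsmul_eq_mul,
    card_units_cast, card_GL_two, card_ext_units hE]
  ring

theorem exists_irr_ext (hE : Module.finrank F E = 2) {χ : Eˣ →* ℂˣ} (hχ : χ ^ Nat.card F ≠ χ) :
    ∃ π : Irr (GL (Fin 2) F), π.character = extFun (extChar χ) := by
  have h1 : 1 < Nat.card F := Finite.one_lt_card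
  refine exists_character_eq (fun g h => ?_) (extFun_pairing hE χ)
    (sum_extFun_extFun_inv hE hχ) (Nat.sub_pos_of_lt h1)
    (by rw [extFun_one hE, Nat.cast_sub h1.le, Nat.cast_one])
  exact (extFun_eq_of_isConj _ (isConj_iff.2 ⟨h, rfl⟩)).symm

end Multiplicity

/-! ### The family of irreducible representations is complete -/

section Family

instance {A : Type*} [CommGroup A] [Finite A] : Fintype (A →* ℂˣ) := Fintype.ofFinite _

variable {F : Type*} [Field F] [Fintype F] [DecidableEq F]
variable {E : Type*} [Field E] [Algebra F E] [Fintype E] [DecidableEq E]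

/-- The one-dimensional representations. -/
def irrDet (α : Fˣ →* ℂˣ) : Irr (GL (Fin 2) F) := (exists_irr_det α).choose

/-- The twists of the Steinberg representation. -/
def irrSteinberg (α : Fˣ →* ℂˣ) : Irr (GL (Fin 2) F) := (exists_irr_steinberg α).choose

open scoped Classical in
/-- The principal series representation of a pair of distinct characters (with an irrelevant value
on the diagonal). -/
def irrSplit (α β : Fˣ →* ℂˣ) : Irr (GL (Fin 2) F) :=
  if h : α ≠ β then (exists_irr_split h).choose else irrDet α

open scoped Classical in
/-- The cuspidal representation of a general character (with an irrelevant value on the others). -/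
def irrExt (hE : Module.finrank F E = 2) (χ : Eˣ →* ℂˣ) : Irr (GL (Fin 2) F) :=
  if h : χ ^ Nat.card F ≠ χ then (exists_irr_ext hE h).choose else irrDet 1

theorem character_irrDet (α : Fˣ →* ℂˣ) : (irrDet α).character = detFun α :=
  (exists_irr_det α).choose_spec

theorem character_irrSteinberg (α : Fˣ →* ℂˣ) : (irrSteinberg α).character = steinbergFun α :=
  (exists_irr_steinberg α).choose_spec

theorem character_irrSplit {α β : Fˣ →* ℂˣ} (h : α ≠ β) :
    (irrSplit α β).character = splitFun (splitChar α β) := by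
  rw [irrSplit, dif_pos h]
  exact (exists_irr_split h).choose_spec

theorem character_irrExt (hE : Module.finrank F E = 2) {χ : Eˣ →* ℂˣ} (h : χ ^ Nat.card F ≠ χ) :
    (irrExt hE χ).character = extFun (extChar χ) := by
  rw [irrExt, dif_pos h]
  exact (exists_irr_ext hE h).choose_spec

theorem dim_irrDet (α : Fˣ →* ℂˣ) : ((irrDet α).dim : ℂ) = 1 := by
  rw [← Irr.character_one, character_irrDet]
  simp [detFun]

theorem dim_irrSteinberg (α : Fˣ →* ℂˣ) : ((irrSteinberg α).dim : ℂ) = Nat.card F := by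
  rw [← Irr.character_one, character_irrSteinberg, steinbergFun, splitFun_one]
  simp [detFun]

theorem dim_irrSplit {α β : Fˣ →* ℂˣ} (h : α ≠ β) :
    ((irrSplit α β).dim : ℂ) = Nat.card F + 1 := by
  rw [← Irr.character_one, character_irrSplit h, splitFun_one]

theorem dim_irrExt (hE : Module.finrank F E = 2) {χ : Eˣ →* ℂˣ} (h : χ ^ Nat.card F ≠ χ) :
    ((irrExt hE χ).dim : ℂ) = Nat.card F - 1 := by
  rw [← Irr.character_one, character_irrExt hE h, extFun_one hE]

theorem nrm_pow_card (hE : Module.finrank F E = 2) (l : Eˣ) :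
    (nrm (l ^ Nat.card F) : Fˣ) = nrm l :=
  congrArg Prod.snd (extCls_pow_card hE l)

/-- Composites with the norm are Frobenius-invariant and pairwise distinct, since the norm is
surjective; there are q − 1 of them. As the dual of E× is cyclic, χ^(q−1) = 1 has at most q − 1
solutions, so there are no others. -/
theorem exists_eq_comp_nrm_iff (hE : Module.finrank F E = 2) (χ : Eˣ →* ℂˣ) :
    χ ^ Nat.card F = χ ↔ χ ∈ Set.range fun α : Fˣ →* ℂˣ => α.comp nrm := by
  classical
  have hinj : Function.Injective fun α : Fˣ →* ℂˣ => α.comp (nrm : Eˣ →* Fˣ) := fun α β h =>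
    (MonoidHom.cancel_right (FiniteField.unitsMap_norm_surjective F E)).1 h
  have hsub : Finset.univ.image (fun α : Fˣ →* ℂˣ => α.comp (nrm : Eˣ →* Fˣ)) ⊆
      Finset.univ.filter fun χ : Eˣ →* ℂˣ => χ ^ Nat.card F = χ := by
    intro χ hχ
    obtain ⟨α, -, rfl⟩ := Finset.mem_image.1 hχ
    refine Finset.mem_filter.2 ⟨Finset.mem_univ _, MonoidHom.ext fun l => ?_⟩
    rw [MonoidHom.pow_apply, ← map_pow, MonoidHom.comp_apply, nrm_pow_card hE,
      MonoidHom.comp_apply]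
  have hcyc : IsCyclic (Eˣ →* ℂˣ) := by
    obtain ⟨e⟩ := CommGroup.monoidHom_mulEquiv_of_hasEnoughRootsOfUnity Eˣ ℂ
    exact isCyclic_of_surjective e.symm e.symm.surjective
  have hcard : (Finset.univ.filter fun χ : Eˣ →* ℂˣ => χ ^ Nat.card F = χ).card ≤
      (Finset.univ.image (fun α : Fˣ →* ℂˣ => α.comp (nrm : Eˣ →* Fˣ))).card := by
    rw [Finset.card_image_of_injective _ hinj, Finset.card_univ, ← Nat.card_eq_fintype_card,
      card_dual, Nat.card_units]
    have h1 : 0 < Nat.card F - 1 := Nat.sub_pos_of_lt Finite.one_lt_card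
    refine le_trans (le_of_eq ?_) (IsCyclic.card_pow_eq_one_le (α := Eˣ →* ℂˣ) h1)
    congr 1
    ext χ
    simp only [Finset.mem_filter, Finset.mem_univ, true_and]
    have e : χ ^ Nat.card F = χ ^ (Nat.card F - 1) * χ := by
      conv_lhs => rw [← Nat.sub_add_cancel (Nat.succ_le_of_lt (Nat.card_pos (α := F)))]
      exact pow_succ χ _
    rw [e]
    exact ⟨fun h => mul_right_cancel (h.trans (one_mul χ).symm), fun h => by
      rw [h]
      exact one_mul χ⟩
  have heq := Finset.eq_of_subset_of_card_le hsub hcard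
  have := Finset.ext_iff.1 heq χ
  simpa [eq_comm] using this.symm

open scoped Classical in
theorem sum_pow_card_eq (hE : Module.finrank F E = 2) (f : (Eˣ →* ℂˣ) → ℂ) :
    ∑ χ, (if χ ^ Nat.card F = χ then f χ else 0) = ∑ α : Fˣ →* ℂˣ, f (α.comp nrm) := by
  rw [← Finset.sum_filter, ← Finset.sum_image (s := Finset.univ)
    (g := fun α : Fˣ →* ℂˣ => α.comp (nrm : Eˣ →* Fˣ)) (f := f) fun α _ β _ h =>
      (MonoidHom.cancel_right (FiniteField.unitsMap_norm_surjective F E)).1 h]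
  refine Finset.sum_congr ?_ fun _ _ => rfl
  ext χ
  rw [Finset.mem_filter, exists_eq_comp_nrm_iff hE χ]
  simp

theorem sum_push {ι κ T : Type*} [Fintype ι] [Fintype κ] [DecidableEq T] (p : ι → T)
    (u : κ → ι → ℂ) (τ : T) : ∑ k, push p (u k) τ = push p (fun i => ∑ k, u k i) τ := by
  unfold push
  rw [Finset.sum_comm]
  refine Finset.sum_congr rfl fun i _ => ?_
  split_ifs <;> simp

/-- The indicator function of the elements with the trace and determinant of the identity. -/
def unipInd (g : GL (Fin 2) F) : ℂ := if cls g = splitCls (1, 1) then 1 else 0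

/-- Orthogonality in the dual of the torus concentrates the sum at (1, 1), so only the trace and
determinant of the identity survive. -/
theorem sum_splitFun (g : GL (Fin 2) F) :
    ∑ p : (Fˣ →* ℂˣ) × (Fˣ →* ℂˣ), splitFun (splitChar p.1 p.2) g =
      (1 + Nat.card F * scalarInd g) * (Nat.card F - 1) ^ 2 * unipInd g := by
  simp only [splitFun]
  rw [← Finset.mul_sum, sum_push splitCls fun p : (Fˣ →* ℂˣ) × (Fˣ →* ℂˣ) => splitChar p.1 p.2]
  have e : (fun i : Fˣ × Fˣ => ∑ k : (Fˣ →* ℂˣ) × (Fˣ →* ℂˣ), splitChar k.1 k.2 i) =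
      fun i => ((Nat.card F : ℂ) - 1) ^ 2 * if i = (1, 1) then 1 else 0 := by
    ext ⟨x, y⟩
    simp only [splitChar, Fintype.sum_prod_type, ← Finset.mul_sum]
    rw [← Finset.sum_mul, sum_dual_apply, sum_dual_apply, card_units_cast]
    by_cases hx : x = 1
    · by_cases hy : y = 1
      · simp [hx, hy, delta_one, pow_two]
      · simp [hy, delta_of_ne hy]
    · simp [hx, delta_of_ne hx]
  rw [e, mul_assoc]
  congr 1
  rw [push, Finset.sum_eq_single (1, 1)]
  · simp [unipInd, eq_comm]
  · intro i _ hi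
    simp [hi]
  · simp

theorem sum_splitFun_diag (g : GL (Fin 2) F) :
    ∑ α : Fˣ →* ℂˣ, splitFun (splitChar α α) g =
      (1 + Nat.card F * scalarInd g) * (Nat.card F - 1) * push splitCls 1 (cls g) *
        delta (cls g).2 := by
  simp only [splitFun]
  rw [← Finset.mul_sum, sum_push splitCls fun α : Fˣ →* ℂˣ => splitChar α α, mul_assoc, mul_assoc]
  congr 1
  simp only [push, Finset.sum_mul, Finset.mul_sum]
  refine Finset.sum_congr rfl fun i _ => ?_
  split_ifs with h
  · rw [← h, splitCls, ← card_units_cast, Pi.one_apply, one_mul, ← sum_dual_apply]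
    simp [splitChar]
  · simp

theorem sum_extFun (g : GL (Fin 2) F) (hE : Module.finrank F E = 2) :
    ∑ χ : Eˣ →* ℂˣ, extFun (extChar χ) g =
      (-1 + Nat.card F * scalarInd g) * (Nat.card F ^ 2 - 1) * unipInd g := by
  simp only [extFun]
  rw [← Finset.mul_sum, sum_push (extCls F) fun χ : Eˣ →* ℂˣ => extChar χ]
  have e : (fun l : Eˣ => ∑ χ : Eˣ →* ℂˣ, extChar χ l) =
      fun l => ((Nat.card F : ℂ) ^ 2 - 1) * if l = 1 then 1 else 0 := by
    ext l
    simp only [extChar]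
    rw [sum_dual_apply, card_ext_units hE]
    by_cases hl : l = 1
    · simp [hl, delta_one]
    · simp [hl, delta_of_ne hl]
  rw [e, mul_assoc]
  congr 1
  have h1 : extCls F (1 : Eˣ) = splitCls (1, 1) := by rw [← extCls_emb (E := E) hE, map_one]
  rw [push, Finset.sum_eq_single 1]
  · simp [unipInd, eq_comm, h1]
  · intro i _ hi
    simp [hi]
  · simp

/-- Each l in the fibre contributes (q − 1) δ(det g), and the fibre has 2 minus the number of split
pairs elements by `push_add_push`. -/
theorem sum_extFun_nrm (g : GL (Fin 2) F) (hE : Module.finrank F E = 2) :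
    ∑ α : Fˣ →* ℂˣ, extFun (extChar (α.comp (nrm : Eˣ →* Fˣ))) g =
      (-1 + Nat.card F * scalarInd g) * (Nat.card F - 1) * (2 - push splitCls 1 (cls g)) *
        delta (cls g).2 := by
  rw [← push_add_push (E := E) hE (cls g), add_sub_cancel_left]
  simp only [extFun]
  rw [← Finset.mul_sum, sum_push (extCls F) fun α : Fˣ →* ℂˣ => extChar (α.comp nrm), mul_assoc,
    mul_assoc]
  congr 1
  simp only [push, Finset.sum_mul, Finset.mul_sum]
  refine Finset.sum_congr rfl fun i _ => ?_
  split_ifs with h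
  · rw [← h, extCls, ← card_units_cast, Pi.one_apply, one_mul, ← sum_dual_apply]
    simp [extChar]
  · simp

theorem sum_detFun (g : GL (Fin 2) F) :
    ∑ α : Fˣ →* ℂˣ, detFun α g = (Nat.card F - 1) * delta (cls g).2 := by
  rw [← card_units_cast, ← sum_dual_apply]
  rfl

open scoped Classical in
theorem sum_splitFun_offDiag (g : GL (Fin 2) F) :
    ∑ p : (Fˣ →* ℂˣ) × (Fˣ →* ℂˣ),
      (if p.1 = p.2 then 0 else splitFun (splitChar p.1 p.2) g) =
      (1 + Nat.card F * scalarInd g) * ((Nat.card F - 1) ^ 2 * unipInd g -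
        (Nat.card F - 1) * push splitCls 1 (cls g) * delta (cls g).2) := by
  have h := sum_splitFun_diag g
  have e : ∑ α : Fˣ →* ℂˣ, splitFun (splitChar α α) g =
      ∑ p : (Fˣ →* ℂˣ) × (Fˣ →* ℂˣ), if p.1 = p.2 then splitFun (splitChar p.1 p.2) g else 0 := by
    rw [Fintype.sum_prod_type]
    simp
  have : ∀ p : (Fˣ →* ℂˣ) × (Fˣ →* ℂˣ), (if p.1 = p.2 then 0 else
      splitFun (splitChar p.1 p.2) g) = splitFun (splitChar p.1 p.2) g -
        if p.1 = p.2 then splitFun (splitChar p.1 p.2) g else 0 := fun p => by split_ifs <;> simp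
  rw [Finset.sum_congr rfl fun p _ => this p, Finset.sum_sub_distrib, ← e, h, sum_splitFun]
  ring

open scoped Classical in
theorem sum_extFun_general (g : GL (Fin 2) F) (hE : Module.finrank F E = 2) :
    ∑ χ : Eˣ →* ℂˣ, (if χ ^ Nat.card F = χ then 0 else extFun (extChar χ) g) =
      (-1 + Nat.card F * scalarInd g) * ((Nat.card F ^ 2 - 1) * unipInd g -
        (Nat.card F - 1) * (2 - push splitCls 1 (cls g)) * delta (cls g).2) := by
  have : ∀ χ : Eˣ →* ℂˣ, (if χ ^ Nat.card F = χ then 0 else extFun (extChar χ) g) =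
      extFun (extChar χ) g - if χ ^ Nat.card F = χ then extFun (extChar χ) g else 0 :=
    fun p => by split_ifs <;> simp
  rw [Finset.sum_congr rfl fun p _ => this p, Finset.sum_sub_distrib, sum_extFun g hE,
    sum_pow_card_eq hE fun χ => extFun (extChar χ) g, sum_extFun_nrm g hE]
  ring

theorem sum_steinbergFun (g : GL (Fin 2) F) :
    ∑ α : Fˣ →* ℂˣ, steinbergFun α g = ((1 + Nat.card F * scalarInd g) *
      push splitCls 1 (cls g) - 1) * (Nat.card F - 1) * delta (cls g).2 := by
  simp only [steinbergFun]
  rw [Finset.sum_sub_distrib, sum_splitFun_diag, sum_detFun]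
  ring

open scoped Classical in
theorem scalarInd_mul_unipInd (g : GL (Fin 2) F) :
    scalarInd g * unipInd g = if g = 1 then 1 else 0 := by
  by_cases hg : ∃ x, g = c₁ x
  · obtain ⟨x, rfl⟩ := hg
    rw [scalarInd_c₁, one_mul, unipInd, cls_c₁_eq]
    refine if_congr ?_ rfl rfl
    rw [splitCls_eq_iff, ← c₁_one, c₁_injective.eq_iff]
    simp
  · rw [scalarInd_of_not hg, zero_mul, if_neg]
    rintro rfl
    exact hg ⟨1, c₁_one.symm⟩

theorem scalarInd_mul_push (g : GL (Fin 2) F) :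
    scalarInd g * push splitCls 1 (cls g) = scalarInd g := by
  by_cases hg : ∃ x, g = c₁ x
  · obtain ⟨x, rfl⟩ := hg
    rw [cls_c₁_eq, push_splitCls, if_pos rfl, Pi.one_apply, mul_one]
  · rw [scalarInd_of_not hg, zero_mul]

variable (F E) in
/-- The index set of the family of all irreducible representations, with repetitions. -/
abbrev Family : Type _ :=
  (Fˣ →* ℂˣ) ⊕ (Fˣ →* ℂˣ) ⊕ ((Fˣ →* ℂˣ) × (Fˣ →* ℂˣ)) ⊕ (Eˣ →* ℂˣ)

/-- The irreducible representation attached to an index. -/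
def familyIrr (hE : Module.finrank F E = 2) : Family F E → Irr (GL (Fin 2) F) :=
  Sum.elim irrDet (Sum.elim irrSteinberg (Sum.elim (fun p => irrSplit p.1 p.2) (irrExt hE)))

open scoped Classical in
variable (F E) in
/-- The inverse multiplicity of an index. -/
def familyWeight : Family F E → ℂ :=
  Sum.elim 1 (Sum.elim 1 (Sum.elim (fun p => if p.1 = p.2 then 0 else 1 / 2)
    fun χ => if χ ^ Nat.card F = χ then 0 else 1 / 2))

open scoped Classical in
theorem sum_family (hE : Module.finrank F E = 2) (f : Irr (GL (Fin 2) F) → ℂ) :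
    ∑ i, familyWeight F E i * f (familyIrr hE i) = ∑ α, f (irrDet α) + ∑ α, f (irrSteinberg α) +
      1 / 2 * ∑ p : (Fˣ →* ℂˣ) × (Fˣ →* ℂˣ), (if p.1 = p.2 then 0 else f (irrSplit p.1 p.2)) +
      1 / 2 * ∑ χ : Eˣ →* ℂˣ, if χ ^ Nat.card F = χ then 0 else f (irrExt hE χ) := by
  rw [Fintype.sum_sum_type, Fintype.sum_sum_type, Fintype.sum_sum_type]
  simp only [familyWeight, familyIrr, Sum.elim_inl, Sum.elim_inr, Pi.one_apply, one_mul, ite_mul,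
    zero_mul, Finset.mul_sum, mul_ite, mul_zero, add_assoc]

open scoped Classical in
-- The terms in δ(det g) cancel among the four families, given that a scalar has exactly one split
-- pair above it. The terms with the trace and determinant of 1 cancel off the scalars and leave |G|
-- at the identity.
theorem sum_family_character (hE : Module.finrank F E = 2) (g : GL (Fin 2) F) :
    ∑ i, familyWeight F E i * ((familyIrr hE i).dim * (familyIrr hE i).character g) =
      Nat.card (GL (Fin 2) F) * if g = 1 then 1 else 0 := by
  rw [sum_family hE fun π => π.dim * π.character g]
  have e1 : ∀ p : (Fˣ →* ℂˣ) × (Fˣ →* ℂˣ), (if p.1 = p.2 then 0 else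
      ((irrSplit p.1 p.2).dim : ℂ) * (irrSplit p.1 p.2).character g) = (Nat.card F + 1) *
        if p.1 = p.2 then 0 else splitFun (splitChar p.1 p.2) g := fun p => by
    split_ifs with h
    · rw [mul_zero]
    · rw [dim_irrSplit h, character_irrSplit h]
  have e2 : ∀ χ : Eˣ →* ℂˣ, (if χ ^ Nat.card F = χ then 0 else
      ((irrExt hE χ).dim : ℂ) * (irrExt hE χ).character g) = (Nat.card F - 1) *
        if χ ^ Nat.card F = χ then 0 else extFun (extChar χ) g := fun χ => by
    split_ifs with h
    · rw [mul_zero]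
    · rw [dim_irrExt hE h, character_irrExt hE h]
  simp only [e1, e2, dim_irrDet, dim_irrSteinberg, character_irrDet, character_irrSteinberg,
    one_mul, ← Finset.mul_sum]
  rw [sum_splitFun_offDiag, sum_extFun_general g hE, sum_steinbergFun, sum_detFun, card_GL_two,
    ← scalarInd_mul_unipInd]
  linear_combination (Nat.card F : ℂ) * (Nat.card F - 1) ^ 2 * delta (cls g).2 *
    scalarInd_mul_push g

open scoped Classical in
theorem sum_familyWeight_eq_one (hE : Module.finrank F E = 2) (π : Irr (GL (Fin 2) F)) :
    ∑ i, (if familyIrr hE i = π then familyWeight F E i else 0) = 1 := by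
  refine sum_weight_eq_one _ _ (fun x hx => ?_) ?_ π
  · rw [sum_family_character, if_neg hx, mul_zero]
  · have := sum_family_character hE (1 : GL (Fin 2) F)
    simp only [Irr.character_one, ← pow_two, if_true, mul_one] at this
    exact this

open scoped Classical in
theorem sum_irr (hE : Module.finrank F E = 2) [Fintype (Irr (GL (Fin 2) F))]
    (f : Irr (GL (Fin 2) F) → ℂ) :
    ∑ π, f π = ∑ α, f (irrDet α) + ∑ α, f (irrSteinberg α) +
      1 / 2 * ∑ p : (Fˣ →* ℂˣ) × (Fˣ →* ℂˣ), (if p.1 = p.2 then 0 else f (irrSplit p.1 p.2)) +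
      1 / 2 * ∑ χ : Eˣ →* ℂˣ, if χ ^ Nat.card F = χ then 0 else f (irrExt hE χ) := by
  rw [← sum_family]
  refine sum_eq_weighted_sum _ _ (fun x hx => ?_) ?_ f
  · rw [sum_family_character, if_neg hx, mul_zero]
  · have := sum_family_character hE (1 : GL (Fin 2) F)
    simp only [Irr.character_one, ← pow_two, if_true, mul_one] at this
    exact this

end Family

/-! ### Twisting by linear characters -/

section Twist

variable {G : Type*} [Group G]

theorem exists_twist (ψ : G →* ℂˣ) (π : Irr G) :
    ∃ σ : Irr G, ∀ g, σ.character g = ψ g * π.character g := by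
  obtain ⟨V, rfl⟩ := π.exists_rep
  let ρ : Representation ℂ G V.carrier :=
    { toFun := fun g => (ψ g : ℂ) • V.rep g
      map_one' := by simp
      map_mul' := fun g h => by
        rw [map_mul, map_mul, Units.val_mul, smul_mul_smul_comm] }
  have hρ : ρ.IsIrreducible := by
    have hV := (isIrreducible_iff V.rep).1 V.irreducible
    refine (isIrreducible_iff ρ).2 ⟨hV.1, fun W hW => hV.2 W fun g v hv => ?_⟩
    have h1 := W.smul_mem (ψ g : ℂ)⁻¹ (hW g v hv)
    have h2 : (ψ g : ℂ)⁻¹ • ρ g v = V.rep g v := by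
      change (ψ g : ℂ)⁻¹ • ((ψ g : ℂ) • V.rep g v) = V.rep g v
      rw [inv_smul_smul₀ (ψ g).ne_zero]
    rwa [h2] at h1
  refine ⟨Irr.ofRep ρ, fun g => ?_⟩
  rw [Irr.character_ofRep, Irr.character_mk]
  exact (LinearMap.trace ℂ V.carrier).map_smul (ψ g : ℂ) (V.rep g)

/-- The zeta function with insertions vanishes unless all linear characters are trivial on the
product of the insertions. -/
theorem zetaIns_eq_zero [Finite G] (ψ : G →* ℂˣ) {r : ℕ} (γ : Fin r → G)
    (h : ψ (List.ofFn γ).prod ≠ 1) (s : ℂ) : zetaIns γ s = 0 := by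
  have := Fintype.ofFinite (Irr G)
  choose t ht using exists_twist ψ
  have htd : ∀ π, (t π).dim = π.dim := fun π => by
    have := ht π 1
    rw [Irr.character_one, Irr.character_one, map_one, Units.val_one, one_mul] at this
    exact_mod_cast this
  have hinj : Function.Injective t := fun π σ e => Irr.character_injective <| funext fun g => by
    have h1 := ht π g
    rw [e, ht σ g] at h1
    exact (mul_left_cancel₀ (ψ g).ne_zero h1).symm
  have hprod : ∏ j, (ψ (γ j) : ℂ) = ψ (List.ofFn γ).prod := by
    rw [map_list_prod, List.map_ofFn, List.prod_ofFn, Units.coe_prod]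
    rfl
  -- Reindexing by the twist preserves dimensions and multiplies each summand by ψ of the product of
  -- the insertions.
  have h1 : zetaIns γ s = ψ (List.ofFn γ).prod * zetaIns γ s := by
    conv_lhs => rw [zetaIns, finsum_eq_sum_of_fintype]
    rw [zetaIns, finsum_eq_sum_of_fintype, Finset.mul_sum, ← (Equiv.ofBijective t
      (Finite.injective_iff_bijective.1 hinj)).sum_comp]
    refine Finset.sum_congr rfl fun π _ => ?_
    simp only [Equiv.ofBijective_apply, ht, htd, Finset.prod_mul_distrib, hprod, mul_div_assoc]
  have h2 : ((ψ (List.ofFn γ).prod : ℂ) - 1) * zetaIns γ s = 0 := by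
    rw [sub_mul, ← h1, one_mul, sub_self]
  exact (mul_eq_zero.1 h2).resolve_left (sub_ne_zero.2 fun e => h (Units.ext e))

end Twist

/-! ### The zeta function of GL(2, F), without and with insertions -/

section Zeta

variable {F : Type*} [Field F] [Fintype F] [DecidableEq F]
variable {E : Type*} [Field E] [Algebra F E] [Fintype E] [DecidableEq E]

theorem zetaIns_eq_zero_of_det {r : ℕ} (γ : Fin r → GL (Fin 2) F)
    (h : Matrix.GeneralLinearGroup.det (List.ofFn γ).prod ≠ 1) (s : ℂ) : zetaIns γ s = 0 := by
  obtain ⟨α, hα⟩ := CommGroup.exists_apply_ne_one_of_hasEnoughRootsOfUnity Fˣ ℂ h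
  exact zetaIns_eq_zero (α.comp Matrix.GeneralLinearGroup.det) γ hα s

theorem card_dual_units : (Fintype.card (Fˣ →* ℂˣ) : ℂ) = Nat.card F - 1 := by
  rw [← Nat.card_eq_fintype_card, card_dual, card_units_cast]

open scoped Classical in
theorem sum_offDiag_const (c : ℂ) :
    ∑ p : (Fˣ →* ℂˣ) × (Fˣ →* ℂˣ), (if p.1 = p.2 then 0 else c) =
      (Nat.card F - 1) * (Nat.card F - 2) * c := by
  have : ∀ p : (Fˣ →* ℂˣ) × (Fˣ →* ℂˣ), (if p.1 = p.2 then 0 else c) =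
      c - if p.1 = p.2 then c else 0 := fun p => by split_ifs <;> simp
  rw [Finset.sum_congr rfl fun p _ => this p, Finset.sum_sub_distrib, Fintype.sum_prod_type,
    Fintype.sum_prod_type]
  simp only [Finset.sum_ite_eq, Finset.mem_univ, if_true, Finset.sum_const, Finset.card_univ,
    nsmul_eq_mul, card_dual_units]
  ring

open scoped Classical in
-- Of the q² − 1 characters of E×, the q − 1 composites with the norm are excluded, leaving q(q −
-- 1).
theorem sum_general_const (hE : Module.finrank F E = 2) (c : ℂ) :
    ∑ χ : Eˣ →* ℂˣ, (if χ ^ Nat.card F = χ then 0 else c) =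
      Nat.card F * (Nat.card F - 1) * c := by
  have : ∀ χ : Eˣ →* ℂˣ, (if χ ^ Nat.card F = χ then 0 else c) =
      c - if χ ^ Nat.card F = χ then c else 0 := fun p => by split_ifs <;> simp
  rw [Finset.sum_congr rfl fun p _ => this p, Finset.sum_sub_distrib,
    sum_pow_card_eq hE fun _ => c]
  simp only [Finset.sum_const, Finset.card_univ, nsmul_eq_mul, card_dual_units]
  rw [card_ext hE, Nat.cast_pow]
  ring

theorem zeta_GL (hE : Module.finrank F E = 2) (s : ℂ) : zeta (GL (Fin 2) F) s =
      (Nat.card F - 1) + (Nat.card F - 1) * (Nat.card F - 2) / (2 * (Nat.card F + 1 : ℂ) ^ s) +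
        (Nat.card F - 1) / (Nat.card F : ℂ) ^ s +
        Nat.card F * (Nat.card F - 1) / (2 * (Nat.card F - 1 : ℂ) ^ s) := by
  classical
  have := Fintype.ofFinite (Irr (GL (Fin 2) F))
  rw [zeta_eq_sum, sum_irr hE]
  have e1 : ∀ p : (Fˣ →* ℂˣ) × (Fˣ →* ℂˣ), (if p.1 = p.2 then 0 else
      1 / ((irrSplit p.1 p.2).dim : ℂ) ^ s) = if p.1 = p.2 then 0 else
        1 / (Nat.card F + 1 : ℂ) ^ s := fun p => by
    split_ifs with h
    · rfl
    · rw [dim_irrSplit h]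
  have e2 : ∀ χ : Eˣ →* ℂˣ, (if χ ^ Nat.card F = χ then 0 else
      1 / ((irrExt hE χ).dim : ℂ) ^ s) = if χ ^ Nat.card F = χ then 0 else
        1 / (Nat.card F - 1 : ℂ) ^ s := fun χ => by
    split_ifs with h
    · rfl
    · rw [dim_irrExt hE h]
  simp only [e1, e2, dim_irrDet, dim_irrSteinberg, sum_offDiag_const, sum_general_const hE,
    Finset.sum_const, Finset.card_univ, nsmul_eq_mul, card_dual_units, Complex.one_cpow]
  field_simp
  ring

theorem zetaIns_GL (hE : Module.finrank F E = 2) (g : GL (Fin 2) F) (s : ℂ) :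
    zetaIns ![g] s = (Nat.card F - 1) * delta (cls g).2 +
      (Nat.card F : ℂ) ^ (-s - 1) * (((1 + Nat.card F * scalarInd g) *
        push splitCls 1 (cls g) - 1) * (Nat.card F - 1) * delta (cls g).2) +
      1 / 2 * ((Nat.card F + 1 : ℂ) ^ (-s - 1) * ((1 + Nat.card F * scalarInd g) *
        ((Nat.card F - 1) ^ 2 * unipInd g -
          (Nat.card F - 1) * push splitCls 1 (cls g) * delta (cls g).2))) +
      1 / 2 * ((Nat.card F - 1 : ℂ) ^ (-s - 1) * ((-1 + Nat.card F * scalarInd g) *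
        ((Nat.card F ^ 2 - 1) * unipInd g -
          (Nat.card F - 1) * (2 - push splitCls 1 (cls g)) * delta (cls g).2))) := by
  classical
  have := Fintype.ofFinite (Irr (GL (Fin 2) F))
  have h0 : ∀ π : Irr (GL (Fin 2) F), (∏ j, π.character (![g] j)) / (π.dim : ℂ) ^ (s + (1 : ℕ)) =
      (π.dim : ℂ) ^ (-s - 1) * π.character g := fun π => by
    rw [Fin.prod_univ_one, Matrix.cons_val_zero, div_eq_mul_inv, ← Complex.cpow_neg, mul_comm,
      Nat.cast_one, neg_add']
  rw [zetaIns, finsum_congr h0, finsum_eq_sum_of_fintype, sum_irr hE]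
  have e1 : ∀ p : (Fˣ →* ℂˣ) × (Fˣ →* ℂˣ), (if p.1 = p.2 then 0 else
      ((irrSplit p.1 p.2).dim : ℂ) ^ (-s - 1) * (irrSplit p.1 p.2).character g) =
        (Nat.card F + 1 : ℂ) ^ (-s - 1) *
          if p.1 = p.2 then 0 else splitFun (splitChar p.1 p.2) g := fun p => by
    split_ifs with h
    · rw [mul_zero]
    · rw [dim_irrSplit h, character_irrSplit h]
  have e2 : ∀ χ : Eˣ →* ℂˣ, (if χ ^ Nat.card F = χ then 0 else
      ((irrExt hE χ).dim : ℂ) ^ (-s - 1) * (irrExt hE χ).character g) =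
        (Nat.card F - 1 : ℂ) ^ (-s - 1) *
        if χ ^ Nat.card F = χ then 0 else extFun (extChar χ) g := fun χ => by
    split_ifs with h
    · rw [mul_zero]
    · rw [dim_irrExt hE h, character_irrExt hE h]
  simp only [e1, e2, dim_irrDet, dim_irrSteinberg, character_irrDet, character_irrSteinberg,
    Complex.one_cpow, one_mul, ← Finset.mul_sum, sum_splitFun_offDiag, sum_extFun_general g hE,
    sum_steinbergFun, sum_detFun]

theorem unipInd_eq {g : GL (Fin 2) F} {x : Fˣ} (h : cls g = splitCls (x, x)) :
    unipInd g = delta x := by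
  rw [unipInd, h]
  simp only [splitCls_eq_iff, Prod.swap_prod_mk, or_self, Prod.mk.injEq, and_self]
  split_ifs with hx
  · rw [hx, delta_one]
  · rw [delta_of_ne hx]

variable (F) in
theorem card_sub_one_ne_zero : (Nat.card F : ℂ) - 1 ≠ 0 := by
  rw [sub_ne_zero]
  exact_mod_cast (Finite.one_lt_card (α := F)).ne'

variable (F) in
theorem card_ne_zero : (Nat.card F : ℂ) ≠ 0 := Nat.cast_ne_zero.2 Nat.card_pos.ne'

theorem cpow_neg_eq {a : ℂ} (ha : a ≠ 0) (s : ℂ) : a ^ (-s) = a ^ (-s - 1) * a := by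
  rw [Complex.cpow_sub _ _ ha, Complex.cpow_one, div_mul_cancel₀ _ ha]

theorem zetaIns_c₁ (hE : Module.finrank F E = 2) (x : Fˣ) (s : ℂ) : zetaIns ![c₁ x] s =
      (Nat.card F - 1) * delta (x ^ 2)
        + 1 / 2 * (Nat.card F + 1 : ℂ) ^ (-s)
          * ((Nat.card F - 1) ^ 2 * delta x - (Nat.card F - 1) * delta (x ^ 2))
        + (Nat.card F : ℂ) ^ (-s) * (Nat.card F - 1) * delta (x ^ 2)
        + 1 / 2 * (Nat.card F - 1 : ℂ) ^ (-s)
          * ((Nat.card F ^ 2 - 1) * delta x - (Nat.card F - 1) * delta (x ^ 2)) := by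
  rw [zetaIns_GL hE, unipInd_eq (cls_c₁_eq x), scalarInd_c₁, cls_c₁_eq, push_splitCls, if_pos rfl,
    Pi.one_apply, cpow_neg_eq (card_ne_zero F), cpow_neg_eq (card_sub_one_ne_zero F),
    cpow_neg_eq (Nat.cast_add_one_ne_zero _), splitCls, pow_two x]
  ring

theorem zetaIns_c₂ (hE : Module.finrank F E = 2) (x : Fˣ) (s : ℂ) : zetaIns ![c₂ x] s =
      (Nat.card F - 1) * delta (x ^ 2)
        + 1 / 2 * (Nat.card F + 1 : ℂ) ^ (-s - 1)
          * ((Nat.card F - 1) ^ 2 * delta x - (Nat.card F - 1) * delta (x ^ 2))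
        - 1 / 2 * (Nat.card F - 1 : ℂ) ^ (-s - 1)
          * ((Nat.card F ^ 2 - 1) * delta x - (Nat.card F - 1) * delta (x ^ 2)) := by
  rw [zetaIns_GL hE, unipInd_eq (cls_c₂_eq x), scalarInd_of_not (c₂_not_scalar x), cls_c₂_eq,
    push_splitCls, if_pos rfl, Pi.one_apply, splitCls, pow_two x]
  ring

theorem zetaIns_c₃ (hE : Module.finrank F E = 2) {x y : Fˣ} (h : x ≠ y) (s : ℂ) :
    zetaIns ![c₃ x y] s =
      (Nat.card F - 1) * delta (x * y)
        + (Nat.card F + 1 : ℂ) ^ (-s - 1)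
          * ((Nat.card F - 1) ^ 2 * delta x * delta y - (Nat.card F - 1) * delta (x * y))
        + (Nat.card F : ℂ) ^ (-s - 1) * (Nat.card F - 1) * delta (x * y) := by
  have h1 : unipInd (c₃ x y) = 0 := if_neg fun e => h <| by
    rw [cls_c₃_eq, splitCls_eq_iff, Prod.swap_prod_mk, or_self, Prod.mk.injEq] at e
    rw [e.1, e.2]
  -- The product of deltas is present only formally: x and y are distinct, so they are not both 1.
  have h2 : delta x * delta y = 0 := by
    by_cases hx : x = 1
    · rw [delta_of_ne (a := y) fun hy => h (hx.trans hy.symm), mul_zero]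
    · rw [delta_of_ne hx, zero_mul]
  rw [zetaIns_GL hE, h1, scalarInd_of_not (c₃_not_scalar h), cls_c₃_eq,
    push_splitCls, if_neg h, Pi.one_apply, Pi.one_apply, splitCls]
  linear_combination -(Nat.card F + 1 : ℂ) ^ (-s - 1) * (Nat.card F - 1) ^ 2 * h2

theorem zetaIns_c₄ (hE : Module.finrank F E = 2) {l : Eˣ}
    (h : (l : E) ∉ Set.range (algebraMap F E)) (s : ℂ) :
    zetaIns ![(c₄ l : GL (Fin 2) F)] s =
      (Nat.card F - 1) * delta (Algebra.norm F (l : E))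
        - (Nat.card F - 1) * (Nat.card F : ℂ) ^ (-s - 1) * delta (Algebra.norm F (l : E))
        - (Nat.card F ^ 2 - 1) * (Nat.card F - 1 : ℂ) ^ (-s - 1) * delta l
        + (Nat.card F - 1) * (Nat.card F - 1 : ℂ) ^ (-s - 1) *
          delta (Algebra.norm F (l : E)) := by
  have hl : l ∉ Set.range (emb : Fˣ → Eˣ) := by
    rintro ⟨x, rfl⟩
    exact h ⟨x, rfl⟩
  -- The delta function of the norm is taken in F, that of the determinant in the units.
  have h0 : delta (Algebra.norm F (l : E)) = delta (nrm l : Fˣ) := by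
    by_cases h1 : (nrm l : Fˣ) = 1
    · rw [← coe_nrm, h1, Units.val_one, delta_one, delta_one]
    · rw [delta_of_ne h1, delta_of_ne]
      rwa [Units.ext_iff, coe_nrm, Units.val_one] at h1
  have hc : cls (c₄ l : GL (Fin 2) F) = extCls F l := by rw [c₄_eq_companion, cls_companion]
  have h1 : unipInd (c₄ l : GL (Fin 2) F) = 0 := if_neg fun e => hl <| by
    rw [hc, eq_comm, splitCls_eq_extCls_iff hE] at e
    exact ⟨1, e.2.symm⟩
  have h2 : delta l = 0 := delta_of_ne fun e => hl ⟨1, by rw [e, map_one]⟩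
  rw [zetaIns_GL hE, h1, h2, h0, c₄_eq_companion, scalarInd_of_not (companion_not_scalar _),
    cls_companion, push_splitCls_extCls hE _ hl, extCls]
  ring

end Zeta

/-! ### The zeta function of the quantum double of GL(2, F) -/

section Double

variable {F : Type*} [Field F] [Fintype F] [DecidableEq F]
variable {E : Type*} [Field E] [Algebra F E] [Fintype E] [DecidableEq E]

/-- The size of the class of non-scalar matrices with given trace and determinant. -/
def classSize (τ : F × Fˣ) : ℂ :=
  Nat.card F * (Nat.card F - 1) + Nat.card F * push splitCls 1 τ -
    push (fun x : Fˣ => splitCls (x, x)) 1 τ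

theorem sum_not_scalar (k : F × Fˣ → ℂ) :
    ∑ g : GL (Fin 2) F, (1 - scalarInd g) * k (cls g) = ∑ τ, classSize τ * k τ := by
  simp only [sub_mul, one_mul, Finset.sum_sub_distrib, classSize]
  rw [sum_comp_cls, sum_scalarInd_mul fun g => k (cls g), sum_push_mul]
  simp only [Pi.one_apply, one_mul, cls_c₁_eq]

/-- The class of a non-scalar matrix consists of all non-scalar matrices with its trace and
determinant, so its size is obtained by removing the scalars from the fibre count. -/
theorem index_centralizer {g : GL (Fin 2) F} (hg : ¬ ∃ x, g = c₁ x) :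
    ((Subgroup.centralizer {g}).index : ℂ) = classSize (cls g) := by
  classical
  have h1 := sum_not_scalar fun τ : F × Fˣ => if cls g = τ then 1 else 0
  simp only [mul_ite, mul_one, mul_zero, Finset.sum_ite_eq, Finset.mem_univ, if_true] at h1
  rw [← h1, ← card_isConj_eq_index, Nat.card_eq_fintype_card, Fintype.card_subtype,
    Finset.card_filter]
  push_cast
  refine Finset.sum_congr rfl fun h _ => ?_
  by_cases hh : ∃ x, h = c₁ x
  · obtain ⟨x, rfl⟩ := hh
    rw [scalarInd_c₁, sub_self, ite_self, if_neg]
    exact fun e => hg ⟨x, eq_c₁_of_isConj e.symm⟩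
  · rw [scalarInd_of_not hh, sub_zero]
    exact if_congr ⟨cls_eq_of_isConj, isConj_of_cls_eq hg hh⟩ rfl rfl

theorem classSize_splitCls (x y : Fˣ) : classSize (splitCls (x, y)) =
    if x = y then (Nat.card F : ℂ) ^ 2 - 1 else (Nat.card F : ℂ) * (Nat.card F + 1) := by
  have h : push (fun z : Fˣ => splitCls (z, z)) 1 (splitCls (x, y)) = if x = y then 1 else 0 := by
    split_ifs with h
    · subst h
      rw [push, Finset.sum_eq_single x]
      · simp
      · intro z _ hz
        rw [if_neg]
        rw [splitCls_eq_iff]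
        simpa using hz
      · simp
    · refine push_eq_zero (fun z hz => h ?_) _
      rw [splitCls_eq_iff] at hz
      rcases hz with hz | hz
      · exact (Prod.mk.inj hz).1.symm.trans (Prod.mk.inj hz).2
      · exact (Prod.mk.inj hz).2.symm.trans (Prod.mk.inj hz).1
  rw [classSize, h, push_splitCls]
  split_ifs <;> simp only [Pi.one_apply] <;> ring

theorem classSize_extCls (hE : Module.finrank F E = 2) {l : Eˣ}
    (hl : l ∉ Set.range (emb : Fˣ → Eˣ)) :
    classSize (extCls F l) = Nat.card F * (Nat.card F - 1) := by
  rw [classSize, push_splitCls_extCls hE _ hl, push_eq_zero]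
  · ring
  · intro x hx
    exact hl ⟨x, ((splitCls_eq_extCls_iff hE).1 hx).2.symm⟩

/-- Summation over the classes of non-scalar matrices. -/
theorem sum_classSize (hE : Module.finrank F E = 2) (φ : ℂ → ℂ) :
    ∑ τ : F × Fˣ, φ (classSize τ) = (Nat.card F - 1) * φ (Nat.card F ^ 2 - 1) +
      1 / 2 * ((Nat.card F - 1) * (Nat.card F - 2) * φ (Nat.card F * (Nat.card F + 1))) +
      1 / 2 * (Nat.card F * (Nat.card F - 1) * φ (Nat.card F * (Nat.card F - 1))) := by
  classical
  -- Every τ is covered exactly twice by F× × F× and E× together, so a sum over τ is half the sum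
  -- over both.
  have h1 : ∑ τ : F × Fˣ, φ (classSize τ) =
      1 / 2 * ∑ τ : F × Fˣ, push splitCls 1 τ * φ (classSize τ) +
      1 / 2 * ∑ τ : F × Fˣ, push (extCls F (E := E)) 1 τ * φ (classSize τ) := by
    rw [Finset.mul_sum, Finset.mul_sum, ← Finset.sum_add_distrib]
    refine Finset.sum_congr rfl fun τ _ => ?_
    linear_combination -1 / 2 * φ (classSize τ) * push_add_push (E := E) hE τ
  have h2 : ∀ p : Fˣ × Fˣ, φ (classSize (splitCls p)) = φ (Nat.card F * (Nat.card F + 1)) +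
      if p.1 = p.2 then φ (Nat.card F ^ 2 - 1) - φ (Nat.card F * (Nat.card F + 1)) else 0 := by
    rintro ⟨x, y⟩
    rw [classSize_splitCls]
    split_ifs <;> simp
  have h3 : ∀ l : Eˣ, φ (classSize (extCls F l)) = φ (Nat.card F * (Nat.card F - 1)) +
      if l ∈ Set.range (emb : Fˣ → Eˣ) then
        φ (Nat.card F ^ 2 - 1) - φ (Nat.card F * (Nat.card F - 1)) else 0 := by
    intro l
    split_ifs with hl
    · obtain ⟨x, rfl⟩ := hl
      rw [extCls_emb hE, classSize_splitCls, if_pos rfl]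
      ring
    · rw [classSize_extCls hE hl, add_zero]
  rw [h1, sum_push_mul splitCls 1 fun τ => φ (classSize τ),
    sum_push_mul (extCls F) 1 fun τ => φ (classSize τ)]
  simp only [Pi.one_apply, one_mul]
  rw [Finset.sum_congr rfl fun p _ => h2 p, Finset.sum_congr rfl fun l _ => h3 l,
    Finset.sum_add_distrib, Finset.sum_add_distrib, sum_split_ext fun _ => _,
    sum_range_emb (F := F) fun _ : Eˣ => _]
  simp only [Finset.sum_const, Finset.card_univ, ← Nat.card_eq_fintype_card, nsmul_eq_mul,
    Nat.card_prod, Nat.cast_mul, card_units_cast, card_ext_units hE]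
  ring

theorem zetaDouble_GL (hE : Module.finrank F E = 2) (s : ℂ) : zetaDouble (GL (Fin 2) F) s =
      (Nat.card F - 1) ^ 2 +
        (Nat.card F - 1) ^ 2 * (Nat.card F - 2) / (2 * (Nat.card F + 1 : ℂ) ^ s) +
        (Nat.card F - 1) ^ 2 / (Nat.card F : ℂ) ^ s
        + (Nat.card F - 1) ^ 2 * Nat.card F / (2 * (Nat.card F - 1 : ℂ) ^ s)
        + Nat.card F * (Nat.card F - 1) ^ 2 / (Nat.card F ^ 2 - 1 : ℂ) ^ s
        + (Nat.card F - 1) ^ 3 * (Nat.card F - 2) /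
          (2 * (Nat.card F * (Nat.card F + 1) : ℂ) ^ s)
        + Nat.card F * (Nat.card F - 1) ^ 2 * (Nat.card F + 1) /
          (2 * (Nat.card F * (Nat.card F - 1) : ℂ) ^ s) := by
  have hsc : ∀ x : Fˣ, Subgroup.centralizer {c₁ x} = (⊤ : Subgroup (GL (Fin 2) F)) := fun x => by
    rw [eq_top_iff]
    intro g _
    rw [mem_centralizer_singleton_iff_conj]
    exact eq_c₁_of_isConj (isConj_iff.2 ⟨g, rfl⟩)
  set φ : ℂ → ℂ := fun i => Nat.card (GL (Fin 2) F) / i * (1 / i ^ s) with hφ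
  -- A scalar contributes the zeta function of the whole group. For any other `g` the centralizer is
  -- abelian and its zeta function is its order |G| / i, with i the class size; the factor i⁻¹ then
  -- leaves one term φ(i) per class.
  have key : ∀ g : GL (Fin 2) F, ((Subgroup.centralizer {g}).index : ℂ)⁻¹ *
      (1 / ((Subgroup.centralizer {g}).index : ℂ) ^ s * zeta (Subgroup.centralizer {g}) s) =
      scalarInd g * zeta (GL (Fin 2) F) s +
        (1 - scalarInd g) * ((classSize (cls g))⁻¹ * φ (classSize (cls g))) := by
    intro g
    by_cases hg : ∃ x, g = c₁ x
    · obtain ⟨x, rfl⟩ := hg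
      rw [scalarInd_c₁, hsc, Subgroup.index_top, zeta_congr Subgroup.topEquiv]
      simp
    · rw [scalarInd_of_not hg, ← index_centralizer hg,
        zeta_of_commutative (centralizer_commutative hg), hφ]
      have h1 : (Nat.card (GL (Fin 2) F) : ℂ) = Nat.card (Subgroup.centralizer {g}) *
          (Subgroup.centralizer {g}).index := by
        rw [← Nat.cast_mul, Subgroup.card_mul_index]
      have h2 : ((Subgroup.centralizer {g}).index : ℂ) ≠ 0 :=
        Nat.cast_ne_zero.2 Subgroup.index_ne_zero_of_finite
      simp only
      rw [h1, mul_div_cancel_right₀ _ h2]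
      ring
  rw [zetaDouble_eq, Finset.sum_congr rfl fun g _ => key g, Finset.sum_add_distrib,
    sum_scalarInd_mul fun _ => zeta (GL (Fin 2) F) s,
    sum_not_scalar fun τ => (classSize τ)⁻¹ * φ (classSize τ)]
  have hne : ∀ τ : F × Fˣ, classSize τ ≠ 0 := fun τ => by
    rw [← cls_companion τ, ← index_centralizer (companion_not_scalar τ)]
    exact Nat.cast_ne_zero.2 Subgroup.index_ne_zero_of_finite
  rw [Finset.sum_congr rfl fun τ _ => mul_inv_cancel_left₀ (hne τ) _, sum_classSize hE, zeta_GL hE]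
  simp only [hφ, card_GL_two, Finset.sum_const, Finset.card_univ, ← Nat.card_eq_fintype_card,
    nsmul_eq_mul, card_units_cast]
  have n0 := card_ne_zero F
  have n1 := card_sub_one_ne_zero F
  have n2 : (Nat.card F : ℂ) + 1 ≠ 0 := Nat.cast_add_one_ne_zero _
  have n3 : (Nat.card F : ℂ) ^ 2 - 1 = (Nat.card F - 1) * (Nat.card F + 1) := by ring
  have d1 : (Nat.card F : ℂ) * (Nat.card F - 1) * (Nat.card F ^ 2 - 1) / (Nat.card F ^ 2 - 1) =
      Nat.card F * (Nat.card F - 1) := by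
    rw [mul_div_cancel_right₀]
    rw [n3]
    exact mul_ne_zero n1 n2
  have d2 : (Nat.card F : ℂ) * (Nat.card F - 1) * (Nat.card F ^ 2 - 1) /
      (Nat.card F * (Nat.card F + 1)) = (Nat.card F - 1) ^ 2 := by
    rw [n3]
    field_simp
  have d3 : (Nat.card F : ℂ) * (Nat.card F - 1) * (Nat.card F ^ 2 - 1) /
      (Nat.card F * (Nat.card F - 1)) = Nat.card F ^ 2 - 1 := by
    rw [mul_div_cancel_left₀ _ (mul_ne_zero n0 n1)]
  rw [d1, d2, d3]
  -- The complex powers occur alike on both sides and can be treated as opaque.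
  generalize ((Nat.card F : ℂ) ^ 2 - 1) ^ s = a
  generalize ((Nat.card F : ℂ) * (Nat.card F + 1)) ^ s = b
  generalize ((Nat.card F : ℂ) * (Nat.card F - 1)) ^ s = c
  ring

end Double

/-! ### Self-dual irreducible representations -/

section SelfDual

variable {F : Type*} [Field F] [Fintype F] [DecidableEq F]
variable {E : Type*} [Field E] [Algebra F E] [Fintype E] [DecidableEq E]

theorem familyWeight_re_nonneg (i : Family F E) : 0 ≤ (familyWeight F E i).re := by
  rcases i with i | i | i | i <;> simp only [familyWeight, Sum.elim_inl, Sum.elim_inr, Pi.one_apply]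
  · simp
  · simp
  · split_ifs <;> norm_num
  · split_ifs <;> norm_num

/-- At most two indices of weight one half give the same representation. -/
theorem eq_or_eq_of_familyIrr_eq (hE : Module.finrank F E = 2) {i j k : Family F E} (hij : i ≠ j)
    (hi : familyWeight F E i = 1 / 2) (hj : familyWeight F E j = 1 / 2)
    (hk : familyWeight F E k = 1 / 2) (eij : familyIrr hE j = familyIrr hE i)
    (eik : familyIrr hE k = familyIrr hE i) : k = i ∨ k = j := by
  classical
  by_contra h
  push Not at h
  have h1 := congrArg Complex.re (sum_familyWeight_eq_one hE (familyIrr hE i))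
  rw [Complex.re_sum] at h1
  -- Three distinct indices of weight 1/2 with the same representation would contribute 3/2 to a
  -- total of 1. Real parts are taken because the weights are complex numbers.
  have h2 := Finset.sum_le_sum_of_subset_of_nonneg (Finset.subset_univ {i, j, k})
    (f := fun m : Family F E => Complex.re (if familyIrr hE m = familyIrr hE i then
      familyWeight F E m else 0)) fun m _ _ => by
        split_ifs
        · exact familyWeight_re_nonneg m
        · simp
  rw [Finset.sum_insert (by simp [hij, h.1.symm]), Finset.sum_pair h.2.symm, if_pos rfl,
    if_pos eij, if_pos eik, hi, hj, hk, h1] at h2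
  norm_num at h2

theorem det_c₃_one (x : Fˣ) :
    Matrix.GeneralLinearGroup.det (c₃ x 1 : GL (Fin 2) F) = x := by
  have := congrArg Prod.snd (cls_c₃ x 1)
  rw [mul_one] at this
  exact this

theorem splitCls_symm (x y : Fˣ) : splitCls (x, y) = splitCls (y, x) :=
  splitCls_eq_iff.2 (Or.inr rfl)

theorem splitFun_swap (α β : Fˣ →* ℂˣ) (g : GL (Fin 2) F) :
    splitFun (splitChar β α) g = splitFun (splitChar α β) g := by
  rw [splitFun, splitFun]
  congr 1
  refine Fintype.sum_equiv (Equiv.prodComm _ _) _ _ fun p => ?_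
  obtain ⟨x, y⟩ := p
  rw [Equiv.prodComm_apply, Prod.swap_prod_mk, splitCls_symm x y]
  simp only [splitChar, mul_comm]

/-- Trace and determinant of the inverse. -/
theorem cls_inv (g : GL (Fin 2) F) : cls g⁻¹ = ((cls g).1 * (((cls g).2⁻¹ : Fˣ) : F),
    (cls g).2⁻¹) := by
  by_cases hg : ∃ x, g = c₁ x
  · obtain ⟨x, rfl⟩ := hg
    rw [c₁_inv, cls_c₁, cls_c₁]
    refine Prod.ext ?_ (by simp)
    simp only [mul_inv, Units.val_mul]
    have := x.ne_zero
    rw [Units.val_inv_eq_inv_val]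
    field_simp
  · rw [← cls_eq_of_isConj (isConj_inv_inv (isConj_companion hg))]
    generalize cls g = τ
    have h : (companion τ)⁻¹ = Matrix.GeneralLinearGroup.mkOfDetNeZero
        !![τ.1 * ((τ.2⁻¹ : Fˣ) : F), 1; -((τ.2⁻¹ : Fˣ) : F), 0] (by simp) := by
      refine inv_eq_of_mul_eq_one_right (ext_entries ?_ ?_ ?_ ?_) <;>
      simp [companion, Matrix.mul_apply]
    rw [h, cls_eq_iff]
    simp

theorem cls_inv_inj {g h : GL (Fin 2) F} : cls g⁻¹ = cls h⁻¹ ↔ cls g = cls h := by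
  have key : ∀ g h : GL (Fin 2) F, cls g = cls h → cls g⁻¹ = cls h⁻¹ := fun g h e => by
    rw [cls_inv, cls_inv, e]
  exact ⟨fun e => by simpa using key _ _ e, key g h⟩

theorem scalarInd_inv (g : GL (Fin 2) F) : scalarInd g⁻¹ = scalarInd g := by
  have key : (∃ x, g⁻¹ = c₁ x) ↔ ∃ x, g = c₁ x :=
    ⟨fun ⟨x, hx⟩ => ⟨x⁻¹, by rw [← c₁_inv, ← hx, inv_inv]⟩,
      fun ⟨x, hx⟩ => ⟨x⁻¹, by rw [← c₁_inv, hx]⟩⟩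
  by_cases hg : ∃ x, g = c₁ x
  · rw [scalarInd, scalarInd, if_pos hg, if_pos (key.2 hg)]
  · rw [scalarInd, scalarInd, if_neg hg, if_neg fun h => hg (key.1 h)]

theorem splitFun_inv (α β : Fˣ →* ℂˣ) (g : GL (Fin 2) F) :
    splitFun (splitChar α β) g⁻¹ = splitFun (splitChar α⁻¹ β⁻¹) g := by
  rw [splitFun, splitFun, scalarInd_inv]
  congr 1
  refine Fintype.sum_equiv (Equiv.inv _) _ _ fun p => ?_
  have : splitCls p = cls g⁻¹ ↔ splitCls p⁻¹ = cls g := by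
    rw [← cls_c₃_eq, ← cls_inv_inj, inv_inv, c₃_inv, cls_c₃_eq]
    rfl
  simp only [Equiv.inv_apply, this]
  simp [splitChar]

theorem extFun_inv (hE : Module.finrank F E = 2) (χ : Eˣ →* ℂˣ) (g : GL (Fin 2) F) :
    extFun (extChar χ) g⁻¹ = extFun (extChar χ⁻¹) g := by
  rw [extFun, extFun, scalarInd_inv]
  congr 1
  refine Fintype.sum_equiv (Equiv.inv _) _ _ fun l => ?_
  have : extCls F l = cls g⁻¹ ↔ extCls F l⁻¹ = cls g := by
    rw [← cls_extEmb hE, ← cls_inv_inj, inv_inv, ← map_inv, cls_extEmb]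
  simp only [Equiv.inv_apply, this]
  simp [extChar]

theorem extFun_pow (hE : Module.finrank F E = 2) (χ : Eˣ →* ℂˣ) (g : GL (Fin 2) F) :
    extFun (extChar (χ ^ Nat.card F)) g = extFun (extChar χ) g := by
  rw [extFun, extFun]
  congr 1
  have hinv : Function.Involutive fun l : Eˣ => l ^ Nat.card F := pow_card_pow_card hE
  refine Fintype.sum_equiv hinv.toPerm _ _ fun l => ?_
  simp only [Function.Involutive.coe_toPerm, extCls_pow_card hE]
  simp [extChar]

theorem detFun_inv_eq (α : Fˣ →* ℂˣ) (g : GL (Fin 2) F) : detFun α g⁻¹ = detFun α⁻¹ g := by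
  simp [detFun]

theorem inv_eq_self_iff {A : Type*} [Group A] (α : A →* ℂˣ) :
    α⁻¹ = α ↔ ∀ x, (α x⁻¹ : ℂ) = α x := by
  constructor
  · intro h x
    conv_rhs => rw [← h]
    rw [map_inv, MonoidHom.inv_apply]
  · intro h
    ext x
    rw [MonoidHom.inv_apply, ← map_inv, h]

theorem selfDual_irrDet (α : Fˣ →* ℂˣ) : (irrDet α).SelfDual ↔ α⁻¹ = α := by
  rw [inv_eq_self_iff, Irr.SelfDual, character_irrDet]
  constructor
  · intro h x
    have := h (c₃ x 1)
    simp only [detFun, map_inv, det_c₃_one] at this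
    simpa using this
  · intro h g
    rw [detFun, map_inv, h, detFun]

theorem selfDual_irrSteinberg (α : Fˣ →* ℂˣ) : (irrSteinberg α).SelfDual ↔ α⁻¹ = α := by
  constructor
  · intro h
    rw [inv_eq_self_iff]
    intro x
    by_cases hx : x = 1
    · rw [hx, inv_one]
    -- For x ≠ 1 the value of the twisted Steinberg character at c₃(x, 1) is 2α(x) − α(x) = α(x).
    · have h1 := h (c₃ x 1)
      rw [character_irrSteinberg, steinbergFun, steinbergFun, c₃_inv, inv_one,
        splitFun_c₃ _ (by simpa using hx), splitFun_c₃ _ hx, detFun_eq, detFun_eq, cls_c₃_eq,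
        cls_c₃_eq] at h1
      simpa [splitChar, splitCls] using h1
  · intro h g
    rw [character_irrSteinberg, steinbergFun, steinbergFun, splitFun_inv, detFun_inv_eq, h]

/-- The dual has parameters (α⁻¹, β⁻¹). Since (α, β) and (β, α) already exhaust the weight of this
representation, the dual parameters must be one of these two pairs. -/
theorem selfDual_irrSplit (hE : Module.finrank F E = 2) {α β : Fˣ →* ℂˣ} (h : α ≠ β) :
    (irrSplit α β).SelfDual ↔ (α⁻¹ = α ∧ β⁻¹ = β) ∨ α⁻¹ = β := by
  have hi : α⁻¹ ≠ β⁻¹ := fun e => h (inv_injective e)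
  rw [Irr.SelfDual, character_irrSplit h]
  simp only [splitFun_inv]
  constructor
  · intro hs
    have e1 : irrSplit β α = irrSplit α β := Irr.character_injective <| by
      rw [character_irrSplit h, character_irrSplit (Ne.symm h)]
      exact funext fun g => splitFun_swap α β g
    have e2 : irrSplit α⁻¹ β⁻¹ = irrSplit α β := Irr.character_injective <| by
      rw [character_irrSplit h, character_irrSplit hi]
      exact funext hs
    have := eq_or_eq_of_familyIrr_eq hE (i := Sum.inr (Sum.inr (Sum.inl (α, β))))
      (j := Sum.inr (Sum.inr (Sum.inl (β, α)))) (k := Sum.inr (Sum.inr (Sum.inl (α⁻¹, β⁻¹))))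
      (by simp [h]) (if_neg h) (if_neg (Ne.symm h)) (if_neg hi) e1 e2
    simp only [Sum.inr.injEq, Sum.inl.injEq, Prod.mk.injEq] at this
    exact this.imp id And.left
  · rintro (⟨h1, h2⟩ | h1) g
    · rw [h1, h2]
    · have h2 : β⁻¹ = α := by rw [← h1]; exact inv_inv α
      rw [h1, h2, splitFun_swap]

/-- The same argument, with the dual parameter χ⁻¹ and the two parameters χ and χ^q. -/
theorem selfDual_irrExt (hE : Module.finrank F E = 2) {χ : Eˣ →* ℂˣ} (h : χ ^ Nat.card F ≠ χ) :
    (irrExt hE χ).SelfDual ↔ χ⁻¹ = χ ∨ χ⁻¹ = χ ^ Nat.card F := by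
  have hpp : (χ ^ Nat.card F) ^ Nat.card F = χ := MonoidHom.ext fun l => by
    rw [MonoidHom.pow_apply, MonoidHom.pow_apply, ← map_pow, ← map_pow, pow_card_pow_card hE]
  have hi : χ⁻¹ ^ Nat.card F ≠ χ⁻¹ := fun e => h (inv_injective ((inv_pow χ _).symm.trans e))
  have hp : (χ ^ Nat.card F) ^ Nat.card F ≠ χ ^ Nat.card F := by
    rw [hpp]
    exact Ne.symm h
  rw [Irr.SelfDual, character_irrExt hE h]
  simp only [extFun_inv hE]
  constructor
  · intro hs
    have e1 : irrExt hE (χ ^ Nat.card F) = irrExt hE χ := Irr.character_injective <| by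
      rw [character_irrExt hE h, character_irrExt hE hp]
      exact funext fun g => extFun_pow hE χ g
    have e2 : irrExt hE χ⁻¹ = irrExt hE χ := Irr.character_injective <| by
      rw [character_irrExt hE h, character_irrExt hE hi]
      exact funext hs
    have := eq_or_eq_of_familyIrr_eq hE (i := Sum.inr (Sum.inr (Sum.inr χ)))
      (j := Sum.inr (Sum.inr (Sum.inr (χ ^ Nat.card F)))) (k := Sum.inr (Sum.inr (Sum.inr χ⁻¹)))
      (by simpa using Ne.symm h) (if_neg h) (if_neg hp) (if_neg hi) e1 e2
    simpa only [Sum.inr.injEq] using this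
  · rintro (h1 | h1) g
    · rw [h1]
    · rw [h1, extFun_pow hE]

end SelfDual

/-! ### Counting self-dual representations and involutions -/

section Indicator

variable {F : Type*} [Field F] [Fintype F] [DecidableEq F]
variable {E : Type*} [Field E] [Algebra F E] [Fintype E] [DecidableEq E]

variable (F) in
/-- The number of square roots of unity. -/
def numInvolutions : ℂ := if (1 : Fˣ) = -1 then 1 else 2

theorem sum_units_inv_eq : ∑ x : Fˣ, (if x⁻¹ = x then (1 : ℂ) else 0) = numInvolutions F := by
  have h : ∀ x : Fˣ, x⁻¹ = x ↔ x = 1 ∨ x = -1 := fun x => by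
    rw [inv_eq_iff_mul_eq_one, Units.ext_iff, Units.ext_iff, Units.ext_iff, Units.val_mul,
      Units.val_neg, Units.val_one]
    exact mul_self_eq_one_iff
  simp only [h]
  rw [← Finset.sum_filter, numInvolutions]
  split_ifs with h1
  · rw [show Finset.univ.filter (fun x : Fˣ => x = 1 ∨ x = -1) = {1} by
      ext x; simp [← h1], Finset.sum_singleton]
  · rw [show Finset.univ.filter (fun x : Fˣ => x = 1 ∨ x = -1) = {1, -1} by
      ext x; simp, Finset.sum_pair h1]
    norm_num

open scoped Classical in
-- The dual of F× is isomorphic to F×, so both have the same number of elements equal to their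
-- inverse.
theorem sum_dual_inv_eq :
    ∑ α : Fˣ →* ℂˣ, (if α⁻¹ = α then (1 : ℂ) else 0) = numInvolutions F := by
  obtain ⟨e⟩ := CommGroup.monoidHom_mulEquiv_of_hasEnoughRootsOfUnity Fˣ ℂ
  rw [← sum_units_inv_eq]
  refine Fintype.sum_equiv e.toEquiv _ _ fun α => ?_
  refine if_congr ?_ rfl rfl
  change α⁻¹ = α ↔ (e α)⁻¹ = e α
  rw [← map_inv, e.injective.eq_iff]

open scoped Classical in
-- With N self-inverse characters, N² − N off-diagonal pairs have both entries self-inverse, and q −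
-- 1 − N pairs are of the form (α, α⁻¹) with α ≠ α⁻¹. The two kinds are disjoint.
theorem sum_offDiag_selfDual (c : ℂ) :
    ∑ p : (Fˣ →* ℂˣ) × (Fˣ →* ℂˣ), (if p.1 = p.2 then 0 else
      if (p.1⁻¹ = p.1 ∧ p.2⁻¹ = p.2) ∨ p.1⁻¹ = p.2 then c else 0) =
      (numInvolutions F ^ 2 - 2 * numInvolutions F + (Nat.card F - 1)) * c := by
  have h : ∀ p : (Fˣ →* ℂˣ) × (Fˣ →* ℂˣ), (if p.1 = p.2 then 0 else
      if (p.1⁻¹ = p.1 ∧ p.2⁻¹ = p.2) ∨ p.1⁻¹ = p.2 then c else 0) =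
      ((if p.1⁻¹ = p.1 then 1 else 0) * (if p.2⁻¹ = p.2 then 1 else 0) -
        2 * (if p.1 = p.2 then if p.1⁻¹ = p.1 then 1 else 0 else 0) +
        if p.1⁻¹ = p.2 then 1 else 0) * c := by
    rintro ⟨α, β⟩
    by_cases h : α = β
    · subst h
      by_cases h1 : α⁻¹ = α <;> simp [h1]
      norm_num
    · by_cases h1 : α⁻¹ = α
      · have h3 : α⁻¹ ≠ β := fun e => h (h1.symm.trans e)
        by_cases h2 : β⁻¹ = β <;> simp [h, h1, h2]
      · by_cases h3 : α⁻¹ = β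
        · simp [h, Ne.symm h, h3]
        · simp [h, h1, h3]
  rw [Finset.sum_congr rfl fun p _ => h p, ← Finset.sum_mul, Finset.sum_add_distrib,
    Finset.sum_sub_distrib, ← Finset.mul_sum, Fintype.sum_prod_type, Fintype.sum_prod_type,
    Fintype.sum_prod_type]
  simp only [Finset.sum_ite_eq, Finset.mem_univ, if_true, Finset.sum_const,
    Finset.card_univ, nsmul_eq_mul, mul_one, card_dual_units]
  have e : ∑ α : Fˣ →* ℂˣ, ∑ β : Fˣ →* ℂˣ, (if α⁻¹ = α then (1 : ℂ) else 0) *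
      (if β⁻¹ = β then 1 else 0) = numInvolutions F ^ 2 := by
    rw [pow_two, ← sum_dual_inv_eq, Finset.sum_mul_sum]
  rw [e, sum_dual_inv_eq]

open scoped Classical in
-- The double sum of χ(x) over characters of E× and x in F× is evaluated in both orders: it is q² −
-- 1, and also q − 1 times the number sought.
theorem sum_comp_emb (hE : Module.finrank F E = 2) :
    ∑ χ : Eˣ →* ℂˣ, (if χ.comp (emb : Fˣ →* Eˣ) = 1 then (1 : ℂ) else 0) = Nat.card F + 1 := by
  have h1 : ∑ χ : Eˣ →* ℂˣ, ∑ x : Fˣ, ((χ.comp emb) x : ℂ) = Nat.card F ^ 2 - 1 := by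
    rw [Finset.sum_comm, Finset.sum_eq_single 1]
    · have := sum_dual_apply (1 : Eˣ)
      rw [card_ext_units hE, delta_one, mul_one] at this
      rw [← this]
      simp
    · intro x _ hx
      have := sum_dual_apply (emb x : Eˣ)
      rwa [delta_of_ne fun e => hx (emb_injective (e.trans (map_one emb).symm)), mul_zero] at this
    · simp
  simp only [sum_character_apply, card_units_cast] at h1
  have h2 : ∀ χ : Eˣ →* ℂˣ, delta (χ.comp (emb : Fˣ →* Eˣ)) =
      if χ.comp (emb : Fˣ →* Eˣ) = 1 then (1 : ℂ) else 0 := fun χ => by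
    split_ifs with h
    · rw [h, delta_one]
    · rw [delta_of_ne h]
  rw [← Finset.mul_sum, Finset.sum_congr rfl fun χ _ => h2 χ] at h1
  refine mul_left_cancel₀ (card_sub_one_ne_zero F) (h1.trans ?_)
  ring

/-- The condition at l reads χ(l · l^q) = 1, that is, χ is trivial at the norm of l; the norm is
onto F×. -/
theorem inv_eq_pow_card_iff (hE : Module.finrank F E = 2) (χ : Eˣ →* ℂˣ) :
    χ⁻¹ = χ ^ Nat.card F ↔ χ.comp (emb : Fˣ →* Eˣ) = 1 := by
  have key : ∀ l, χ⁻¹ l = (χ ^ Nat.card F) l ↔ χ.comp (emb : Fˣ →* Eˣ) (nrm l) = 1 := fun l => by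
    rw [MonoidHom.inv_apply, MonoidHom.pow_apply, inv_eq_iff_mul_eq_one, MonoidHom.comp_apply,
      emb_nrm hE, map_mul, map_pow]
  constructor
  · intro h
    ext x
    obtain ⟨l, rfl⟩ := FiniteField.unitsMap_norm_surjective F E x
    exact congrArg Units.val ((key l).1 (by rw [h]))
  · intro h
    refine MonoidHom.ext fun l => (key l).2 ?_
    rw [h, MonoidHom.one_apply]

/-- The values are ±1. For odd q the power q changes nothing; for even q, χ^q is trivial, and l^(q²)
= l forces χ itself to be trivial. -/
theorem pow_card_eq_of_inv_eq (hE : Module.finrank F E = 2) {χ : Eˣ →* ℂˣ} (h : χ⁻¹ = χ) :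
    χ ^ Nat.card F = χ := by
  refine MonoidHom.ext fun l => ?_
  have h1 : χ l * χ l = 1 := by
    rw [← inv_eq_iff_mul_eq_one, ← MonoidHom.inv_apply, h]
  rw [MonoidHom.pow_apply]
  rcases Nat.even_or_odd' (Nat.card F) with ⟨k, hk | hk⟩
  · have h2 : χ l ^ Nat.card F = 1 := by rw [hk, pow_mul, pow_two, h1, one_pow]
    have h3 := congrArg χ (pow_card_pow_card hE l)
    rw [map_pow, map_pow, h2, one_pow] at h3
    rw [h2, h3]
  · rw [hk, pow_succ, pow_mul, pow_two, h1, one_pow, one_mul]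

open scoped Classical in
-- A self-inverse χ is Frobenius-invariant, so only χ⁻¹ = χ^q matters: these are the q + 1
-- characters trivial on F×. The Frobenius-invariant ones among them are α composed with the norm
-- where α² = 1.
theorem sum_general_selfDual (hE : Module.finrank F E = 2) (c : ℂ) :
    ∑ χ : Eˣ →* ℂˣ, (if χ ^ Nat.card F = χ then 0 else
      if χ⁻¹ = χ ∨ χ⁻¹ = χ ^ Nat.card F then c else 0) =
      (Nat.card F + 1 - numInvolutions F) * c := by
  have h : ∀ χ : Eˣ →* ℂˣ, (if χ ^ Nat.card F = χ then 0 else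
      if χ⁻¹ = χ ∨ χ⁻¹ = χ ^ Nat.card F then c else 0) =
      ((if χ.comp (emb : Fˣ →* Eˣ) = 1 then 1 else 0) -
        if χ ^ Nat.card F = χ then if χ⁻¹ = χ then 1 else 0 else 0) * c := by
    intro χ
    rw [← if_congr (inv_eq_pow_card_iff hE χ) rfl rfl]
    by_cases h1 : χ ^ Nat.card F = χ
    · simp only [h1, if_true]
      simp
    · have h2 : χ⁻¹ ≠ χ := fun e => h1 (pow_card_eq_of_inv_eq hE e)
      by_cases h3 : χ⁻¹ = χ ^ Nat.card F <;> 
        simp only [h1, h2, h3, if_true, if_false, or_true, or_false] <;> simp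
  have h2 : ∀ α : Fˣ →* ℂˣ, (α.comp (nrm : Eˣ →* Fˣ))⁻¹ = α.comp nrm ↔ α⁻¹ = α := fun α => by
    have : (α.comp (nrm : Eˣ →* Fˣ))⁻¹ = α⁻¹.comp nrm := rfl
    rw [this]
    exact MonoidHom.cancel_right (FiniteField.unitsMap_norm_surjective F E)
  rw [Finset.sum_congr rfl fun p _ => h p, ← Finset.sum_mul, Finset.sum_sub_distrib,
    sum_comp_emb hE, sum_pow_card_eq hE fun χ => if χ⁻¹ = χ then 1 else 0]
  simp only [h2, sum_dual_inv_eq]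

open scoped Classical in
theorem sum_selfDual (hE : Module.finrank F E = 2) [Fintype (Irr (GL (Fin 2) F))] (φ : ℂ → ℂ) :
    ∑ π : Irr (GL (Fin 2) F), (if π.SelfDual then φ π.dim else 0) =
      numInvolutions F * φ 1 + numInvolutions F * φ (Nat.card F) +
      1 / 2 * ((numInvolutions F ^ 2 - 2 * numInvolutions F + (Nat.card F - 1)) *
        φ (Nat.card F + 1)) +
      1 / 2 * ((Nat.card F + 1 - numInvolutions F) * φ (Nat.card F - 1)) := by
  rw [sum_irr hE, ← sum_offDiag_selfDual, ← sum_general_selfDual hE, ← sum_dual_inv_eq,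
    Finset.sum_mul, Finset.sum_mul]
  refine congrArg₂ _ (congrArg₂ _ (congrArg₂ _ ?_ ?_) (congrArg _ ?_)) (congrArg _ ?_) <;>
    refine Finset.sum_congr rfl fun i _ => ?_
  · simp only [selfDual_irrDet, dim_irrDet, ite_mul, one_mul, zero_mul]
  · simp only [selfDual_irrSteinberg, dim_irrSteinberg, ite_mul, one_mul, zero_mul]
  · by_cases h : i.1 = i.2
    · rw [if_pos h, if_pos h]
    · rw [if_neg h, if_neg h, dim_irrSplit h]
      exact if_congr (selfDual_irrSplit hE h) rfl rfl
  · by_cases h : i ^ Nat.card F = i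
    · rw [if_pos h, if_pos h]
    · rw [if_neg h, if_neg h, dim_irrExt hE h]
      exact if_congr (selfDual_irrExt hE h) rfl rfl

/-- The off-diagonal entries and the diagonal difference of g² are those of `g` multiplied by the
trace. So a non-scalar square root of 1 has trace 0, and then determinant −1. -/
theorem pow_two_eq_one_iff {g : GL (Fin 2) F} (hg : ¬ ∃ x, g = c₁ x) :
    g ^ 2 = 1 ↔ cls g = splitCls (1, -1) := by
  constructor
  · intro h
    have e : ∀ i j, (g * g) i j = (1 : GL (Fin 2) F) i j := fun i j => by rw [← pow_two, h]
    simp only [Matrix.GeneralLinearGroup.coe_mul, Matrix.mul_apply, Fin.sum_univ_two] at e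
    have e00 := e 0 0
    have e01 := e 0 1
    have e10 := e 1 0
    have e11 := e 1 1
    simp only [Matrix.GeneralLinearGroup.coe_one, Matrix.one_apply_eq, ne_eq, zero_ne_one,
      one_ne_zero, not_false_eq_true, Matrix.one_apply_ne] at e00 e01 e10 e11
    have ht : g 0 0 + g 1 1 = 0 := by
      by_contra ht
      refine hg (exists_eq_c₁_iff.2 ⟨?_, ?_, ?_⟩)
      · exact mul_right_cancel₀ ht (by linear_combination e01)
      · exact mul_right_cancel₀ ht (by linear_combination e10)
      · exact mul_right_cancel₀ ht (by linear_combination e00 - e11)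
    rw [splitCls, cls_eq_iff]
    simp only [Units.val_one, Units.val_neg, Units.val_mul]
    exact ⟨by rw [ht]; ring, by linear_combination g 0 0 * ht - e00⟩
  · intro h
    have h1 := isConj_companion hg
    rw [h] at h1
    obtain ⟨c, hc⟩ := isConj_iff.1 h1
    have h2 : companion (splitCls ((1 : Fˣ), -1)) ^ 2 = 1 := by
      rw [pow_two]
      refine ext_entries ?_ ?_ ?_ ?_ <;> simp [companion, splitCls, Matrix.mul_apply]
    rw [← hc, conj_pow, h2, mul_one, mul_inv_cancel]

theorem card_pow_two_eq_one :
    (Nat.card {g : GL (Fin 2) F // g ^ 2 = 1} : ℂ) =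
      numInvolutions F + classSize (splitCls ((1 : Fˣ), -1)) := by
  have h1 := sum_not_scalar fun τ : F × Fˣ => if splitCls (1, -1) = τ then 1 else 0
  simp only [mul_ite, mul_one, mul_zero, Finset.sum_ite_eq, Finset.mem_univ, if_true] at h1
  have h2 := sum_scalarInd_mul fun g : GL (Fin 2) F => if g ^ 2 = 1 then (1 : ℂ) else 0
  have h3 : ∀ x : Fˣ, (c₁ x) ^ 2 = 1 ↔ x⁻¹ = x := fun x => by
    rw [pow_two, ← c₁_mul, ← c₁_one, c₁_injective.eq_iff, inv_eq_iff_mul_eq_one]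
  simp only [h3, sum_units_inv_eq] at h2
  rw [← h1, ← h2, Nat.card_eq_fintype_card, Fintype.card_subtype, Finset.card_filter,
    ← Finset.sum_add_distrib]
  push_cast
  refine Finset.sum_congr rfl fun g _ => ?_
  by_cases hg : ∃ x, g = c₁ x
  · obtain ⟨x, rfl⟩ := hg
    rw [scalarInd_c₁]
    simp
  · rw [scalarInd_of_not hg, zero_mul, zero_add, sub_zero]
    exact if_congr ((pow_two_eq_one_iff hg).trans eq_comm) rfl rfl

open scoped Classical in
-- The self-dual dimensions and the solutions of g² = 1 have the same total: q² if 1 = −1 in F, and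
-- q² + q + 2 otherwise.
theorem indicator_GL (hE : Module.finrank F E = 2) (π : Irr (GL (Fin 2) F)) :
    π.indicator = if π.SelfDual then 1 else 0 := by
  have := Fintype.ofFinite (Irr (GL (Fin 2) F))
  refine indicator_eq_one ?_ π
  rw [sum_selfDual hE fun d => d, card_pow_two_eq_one, classSize_splitCls, numInvolutions]
  split_ifs <;> ring

theorem zetaInd_eq_sum {G : Type*} [Group G] [Finite G] [Fintype (Irr G)]
    [DecidableEq ℂ] (ε : ℤ) (s : ℂ) :
    zetaInd G ε s = ∑ π : Irr G, if π.indicator = ε then 1 / (π.dim : ℂ) ^ s else 0 := by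
  rw [zetaInd, finsum_eq_sum_of_fintype, ← Finset.sum_filter]
  exact (Finset.sum_subtype (p := fun π : Irr G => π.indicator = ε) _
    (fun π => by rw [Finset.mem_filter, and_iff_right (Finset.mem_univ π)])
    fun π : Irr G => 1 / (π.dim : ℂ) ^ s).symm

theorem zetaInd_neg_one (hE : Module.finrank F E = 2) (s : ℂ) :
    zetaInd (GL (Fin 2) F) (-1) s = 0 := by
  classical
  have := Fintype.ofFinite (Irr (GL (Fin 2) F))
  rw [zetaInd_eq_sum]
  refine Finset.sum_eq_zero fun π _ => if_neg ?_
  rw [indicator_GL hE]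
  split_ifs <;> norm_num

theorem zetaInd_one (hE : Module.finrank F E = 2) (s : ℂ) :
    zetaInd (GL (Fin 2) F) 1 s = numInvolutions F + numInvolutions F / (Nat.card F : ℂ) ^ s +
      (numInvolutions F ^ 2 - 2 * numInvolutions F + (Nat.card F - 1)) /
        (2 * (Nat.card F + 1 : ℂ) ^ s) +
      (Nat.card F + 1 - numInvolutions F) / (2 * (Nat.card F - 1 : ℂ) ^ s) := by
  classical
  have := Fintype.ofFinite (Irr (GL (Fin 2) F))
  have h : ∀ π : Irr (GL (Fin 2) F), π.indicator = (1 : ℤ) ↔ π.SelfDual := fun π => by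
    rw [indicator_GL hE, Int.cast_one]
    simp
  rw [zetaInd_eq_sum]
  simp only [h]
  rw [sum_selfDual hE fun d => 1 / d ^ s, Complex.one_cpow]
  field_simp

theorem zetaInd_zero (hE : Module.finrank F E = 2) (s : ℂ) :
    zetaInd (GL (Fin 2) F) 0 s = zeta (GL (Fin 2) F) s - zetaInd (GL (Fin 2) F) 1 s := by
  classical
  have := Fintype.ofFinite (Irr (GL (Fin 2) F))
  rw [zetaInd_eq_sum, zetaInd_eq_sum, zeta_eq_sum, ← Finset.sum_sub_distrib]
  refine Finset.sum_congr rfl fun π _ => ?_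
  rw [indicator_GL hE, Int.cast_zero, Int.cast_one]
  by_cases h : π.SelfDual
  · rw [if_pos h, if_neg one_ne_zero, if_pos rfl, sub_self]
  · rw [if_neg h, if_pos rfl, if_neg zero_ne_one, sub_zero]

variable (F) in
theorem numInvolutions_of_odd (h : Odd (Nat.card F)) : numInvolutions F = 2 := by
  refine if_neg fun e => ?_
  have h1 : ringChar F ≠ 2 := fun hc => by
    have := FiniteField.even_card_iff_char_two.1 hc
    rw [Nat.card_eq_fintype_card, Nat.odd_iff] at h
    omega
  exact Ring.neg_one_ne_one_of_char_ne_two h1 (congrArg Units.val e).symm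

variable (F) in
theorem numInvolutions_of_even (h : Even (Nat.card F)) : numInvolutions F = 1 := by
  refine if_pos (Units.ext ?_)
  have : CharP F 2 := by
    rw [Nat.card_eq_fintype_card, Nat.even_iff] at h
    exact ringChar.of_eq (FiniteField.even_card_iff_char_two.2 h)
  rw [Units.val_neg, Units.val_one, CharTwo.neg_eq]

end Indicator

end RepZeta

end

/-! ### The main theorem -/

theorem mainTheorem7 {F E : Type*} [Field F] [Finite F] [Field E] [Algebra F E]
    (hE : Module.finrank F E = 2) (q : ℕ) (hq : Nat.card F = q) :
    -- the zeta function of `GL(2, F)`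
    (∀ s : ℂ, RepZeta.zeta (GL (Fin 2) F) s =
      (q - 1) + (q - 1) * (q - 2) / (2 * (q + 1 : ℂ) ^ s) + (q - 1) / (q : ℂ) ^ s
        + q * (q - 1) / (2 * (q - 1 : ℂ) ^ s)) ∧
    -- vanishing of the zeta functions with insertions
    (∀ (r : ℕ) (γ : Fin r → GL (Fin 2) F),
      Matrix.GeneralLinearGroup.det (List.ofFn γ).prod ≠ 1 →
      ∀ s : ℂ, RepZeta.zetaIns γ s = 0) ∧
    -- one insertion, the four types of conjugacy classes
    (∀ (x : Fˣ) (s : ℂ), RepZeta.zetaIns ![RepZeta.c₁ x] s =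
      (q - 1) * RepZeta.delta (x ^ 2)
        + 1 / 2 * (q + 1 : ℂ) ^ (-s)
          * ((q - 1) ^ 2 * RepZeta.delta x - (q - 1) * RepZeta.delta (x ^ 2))
        + (q : ℂ) ^ (-s) * (q - 1) * RepZeta.delta (x ^ 2)
        + 1 / 2 * (q - 1 : ℂ) ^ (-s)
          * ((q ^ 2 - 1) * RepZeta.delta x - (q - 1) * RepZeta.delta (x ^ 2))) ∧
    (∀ (x : Fˣ) (s : ℂ), RepZeta.zetaIns ![RepZeta.c₂ x] s =
      (q - 1) * RepZeta.delta (x ^ 2)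
        + 1 / 2 * (q + 1 : ℂ) ^ (-s - 1)
          * ((q - 1) ^ 2 * RepZeta.delta x - (q - 1) * RepZeta.delta (x ^ 2))
        - 1 / 2 * (q - 1 : ℂ) ^ (-s - 1)
          * ((q ^ 2 - 1) * RepZeta.delta x - (q - 1) * RepZeta.delta (x ^ 2))) ∧
    (∀ (x y : Fˣ), x ≠ y → ∀ s : ℂ, RepZeta.zetaIns ![RepZeta.c₃ x y] s =
      (q - 1) * RepZeta.delta (x * y)
        + (q + 1 : ℂ) ^ (-s - 1)
          * ((q - 1) ^ 2 * RepZeta.delta x * RepZeta.delta y - (q - 1) * RepZeta.delta (x * y))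
        + (q : ℂ) ^ (-s - 1) * (q - 1) * RepZeta.delta (x * y)) ∧
    (∀ l : Eˣ, (l : E) ∉ Set.range (algebraMap F E) →
      ∀ s : ℂ, RepZeta.zetaIns ![(RepZeta.c₄ l : GL (Fin 2) F)] s =
      (q - 1) * RepZeta.delta (Algebra.norm F (l : E))
        - (q - 1) * (q : ℂ) ^ (-s - 1) * RepZeta.delta (Algebra.norm F (l : E))
        - (q ^ 2 - 1) * (q - 1 : ℂ) ^ (-s - 1) * RepZeta.delta l
        + (q - 1) * (q - 1 : ℂ) ^ (-s - 1) * RepZeta.delta (Algebra.norm F (l : E))) ∧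
    -- the zeta function of the quantum double
    (∀ s : ℂ, RepZeta.zetaDouble (GL (Fin 2) F) s =
      (q - 1) ^ 2 + (q - 1) ^ 2 * (q - 2) / (2 * (q + 1 : ℂ) ^ s) + (q - 1) ^ 2 / (q : ℂ) ^ s
        + (q - 1) ^ 2 * q / (2 * (q - 1 : ℂ) ^ s)
        + q * (q - 1) ^ 2 / (q ^ 2 - 1 : ℂ) ^ s
        + (q - 1) ^ 3 * (q - 2) / (2 * (q * (q + 1) : ℂ) ^ s)
        + q * (q - 1) ^ 2 * (q + 1) / (2 * (q * (q - 1) : ℂ) ^ s)) ∧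
    -- the zeta functions restricted by the Frobenius-Schur indicator
    (∀ s : ℂ, RepZeta.zetaInd (GL (Fin 2) F) (-1) s = 0) ∧
    (Odd q → ∀ s : ℂ, RepZeta.zetaInd (GL (Fin 2) F) 1 s =
      2 + (q - 1) / (2 * (q + 1 : ℂ) ^ s) + 2 / (q : ℂ) ^ s
        + (q - 1) / (2 * (q - 1 : ℂ) ^ s)) ∧
    (Even q → ∀ s : ℂ, RepZeta.zetaInd (GL (Fin 2) F) 1 s =
      1 + (q - 2) / (2 * (q + 1 : ℂ) ^ s) + 1 / (q : ℂ) ^ s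
        + q / (2 * (q - 1 : ℂ) ^ s)) ∧
    (∀ s : ℂ, RepZeta.zetaInd (GL (Fin 2) F) 0 s =
      RepZeta.zeta (GL (Fin 2) F) s - RepZeta.zetaInd (GL (Fin 2) F) 1 s) := by
  classical
  subst hq
  have := Fintype.ofFinite F
  have := RepZeta.finite_of_finrank hE
  have : Finite E := Module.finite_of_finite F
  have := Fintype.ofFinite E
  refine ⟨RepZeta.zeta_GL hE, fun r γ h => RepZeta.zetaIns_eq_zero_of_det γ h,
    RepZeta.zetaIns_c₁ hE, RepZeta.zetaIns_c₂ hE, fun x y h => RepZeta.zetaIns_c₃ hE h,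
    fun l h => RepZeta.zetaIns_c₄ hE h, RepZeta.zetaDouble_GL hE, RepZeta.zetaInd_neg_one hE,
    fun h s => ?_, fun h s => ?_, RepZeta.zetaInd_zero hE⟩
  · rw [RepZeta.zetaInd_one hE, RepZeta.numInvolutions_of_odd F h]
    ring
  · rw [RepZeta.zetaInd_one hE, RepZeta.numInvolutions_of_even F h]
    ring
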